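/- Conventions. For a compact convex set $K\subset\mathbb{R}^3$ let $h(K,u)=\sup_{x\in K}\langle u,x\rangle$, $H(K,u)=\{x:\langle u,x\rangle=h(K,u)\}$, and let $\omega(K)=\inf_{\|u\|=1}\bigl(h(K,u)+h(K,-u)\bigr)$ be its minimum width. A convex body (compact, convex, with non-empty interior) $K$ is \emph{reduced} if $\omega(K')<\omega(K)$ for every convex body $K'\subsetneq K$. A polytope $P$ is the convex hull of finitely many points; its (proper) faces are the sets $P\cap H(P,u)$, $u\neq 0$, and vertices, edges and facets are the faces of dimension $0$, $1$ and $2$. Distinct faces $F_1,F_2$ of $P$ are \emph{strictly antipodal} if there is a unit vector $u$ with $P\cap H(P,u)=F_1$ and $P\cap H(P,-u)=F_2$. For sets $A,B$ let $\rho(A,B)$ be the distance between the affine hulls of $A$ and $B$. We write $xy$ for the segment with endpoints $x,y$. (1) Let $P\subset\mathbb{R}^3$ be a reduced polytope. Let $F$ be a facet of $P$ with distinct vertices $a_1,\dots,a_k$ and edges $a_1a_2,\dots,a_{k-1}a_k,a_ka_1$, and let $v$ be a vertex of $P$ whose incident edges are, in cyclic order and without repetition, $vv_1,\dots,vv_k$;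 for $1\le j\le k$ let $F_j$ be the facet incident to $vv_j$ and $vv_{j+1}$ (with $v_{k+1}=v_1$). Then the following three conditions cannot all hold: (a) $F$ and $v$ are strictly antipodal, and $\rho(v,F)=\omega(P)$; (b) for every $j\in\{1,\dots,k\}$ the edges $vv_j$ and $a_{j-1}a_j$ are strictly antipodal (with $a_0=a_k$); (c) for every $j\in\{1,\dots,k\}$ the facet $F_j$ is strictly antipodal to $a_j$, and $\rho(a_j,F_j)=\omega(P)$. (2) Let $P\subset\mathbb{R}^3$ be a polytope that is combinatorially self-dual in the following sense: there is an inclusion-reversing bijection $\varphi$ of the face lattice of $P$ (the faces together with $\emptyset$ and $P$) onto itself such that every face $G\notin\{\emptyset,P\}$ is strictly antipodal to $\varphi(G)$. Then $P$ is not reduced. (3) No pyramid in $\mathbb{R}^3$ (the convex hull of a two-dimensional polytope and a point outside its plane) is reduced. -/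

import Mathlib

noncomputable section

namespace RedPoly

variable {d : ℕ}

/-- The support function `h(K, u) = sup {⟨u, x⟩ : x ∈ K}`. -/
def supp (K : Set (EuclideanSpace ℝ (Fin d))) (u : EuclideanSpace ℝ (Fin d)) : ℝ :=
  sSup ((fun x => inner ℝ u x) '' K)

/-- The hyperplane `H(K, u) = {x : ⟨u, x⟩ = h(K, u)}`. -/
def suppHyperplane (K : Set (EuclideanSpace ℝ (Fin d))) (u : EuclideanSpace ℝ (Fin d)) :
    Set (EuclideanSpace ℝ (Fin d)) :=
  {x | inner ℝ u x = supp K u}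

/-- The width `w(K, u) = h(K, -u) + h(K, u)`. -/
def width (K : Set (EuclideanSpace ℝ (Fin d))) (u : EuclideanSpace ℝ (Fin d)) : ℝ :=
  supp K (-u) + supp K u

/-- The minimum width `ω(K) = inf {w(K, u) : ‖u‖ = 1}`. -/
def minWidth (K : Set (EuclideanSpace ℝ (Fin d))) : ℝ :=
  sInf {t | ∃ u : EuclideanSpace ℝ (Fin d), ‖u‖ = 1 ∧ t = width K u}

/-- Convex bodies: compact convex sets with non-empty interior. -/
def IsConvexBody (K : Set (EuclideanSpace ℝ (Fin d))) : Prop :=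
  Convex ℝ K ∧ IsCompact K ∧ (interior K).Nonempty

/-- A convex body is reduced if every convex body properly contained in it has smaller
minimum width. -/
def IsReduced (K : Set (EuclideanSpace ℝ (Fin d))) : Prop :=
  IsConvexBody K ∧
    ∀ K' : Set (EuclideanSpace ℝ (Fin d)), IsConvexBody K' → K' ⊂ K → minWidth K' < minWidth K

/-- A polytope is the convex hull of finitely many points. -/
def IsPolytope (P : Set (EuclideanSpace ℝ (Fin d))) : Prop :=
  ∃ S : Set (EuclideanSpace ℝ (Fin d)), S.Finite ∧ P = convexHull ℝ S

/-- The dimension of the affine hull (of a non-empty set). -/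
def affDim (K : Set (EuclideanSpace ℝ (Fin d))) : ℕ :=
  Module.finrank ℝ (affineSpan ℝ K).direction

/-- Faces: intersections of `P` with its supporting hyperplanes. -/
def IsFace (P F : Set (EuclideanSpace ℝ (Fin d))) : Prop :=
  ∃ u : EuclideanSpace ℝ (Fin d), u ≠ 0 ∧ suppHyperplane P u ∩ P = F

/-- A vertex is a point `v` such that `{v}` is a (zero-dimensional) face. -/
def IsVertex (P : Set (EuclideanSpace ℝ (Fin d))) (v : EuclideanSpace ℝ (Fin d)) : Prop :=
  IsFace P {v}

/-- Edges are the faces of dimension `1`. -/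
def IsEdge (P e : Set (EuclideanSpace ℝ (Fin d))) : Prop :=
  IsFace P e ∧ affDim e = 1

/-- Facets are the faces of dimension `d - 1`. -/
def IsFacet (P F : Set (EuclideanSpace ℝ (Fin d))) : Prop :=
  IsFace P F ∧ affDim F + 1 = d

/-- Distinct faces `F₁`, `F₂` of `P` are strictly antipodal if, for some unit vector `u`, they are
the faces of `P` in the directions `u` and `-u`. -/
def StrictlyAntipodal (P F₁ F₂ : Set (EuclideanSpace ℝ (Fin d))) : Prop :=
  F₁ ≠ F₂ ∧ ∃ u : EuclideanSpace ℝ (Fin d), ‖u‖ = 1 ∧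
    suppHyperplane P u ∩ P = F₁ ∧ suppHyperplane P (-u) ∩ P = F₂

/-- `ρ(A, B)`: the minimal distance between points of the affine hulls of `A` and `B`. -/
def affDist (A B : Set (EuclideanSpace ℝ (Fin d))) : ℝ :=
  sInf {t | ∃ x ∈ affineSpan ℝ A, ∃ y ∈ affineSpan ℝ B, t = ‖x - y‖}

/-- The face lattice of `P`: the faces of `P` together with `∅` and `P`, ordered by inclusion. -/
abbrev FaceLattice (P : Set (EuclideanSpace ℝ (Fin d))) : Type :=
  {G : Set (EuclideanSpace ℝ (Fin d)) // G = ∅ ∨ IsFace P G ∨ G = P}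

/-- Self-duality realised by antipodality: there is an inclusion-reversing bijection `φ` of the
face lattice onto itself such that every proper face `G` (neither `∅` nor `P`) is strictly
antipodal to `φ G`. No uniqueness of the antipodal face is required. -/
def IsSelfDual (P : Set (EuclideanSpace ℝ (Fin d))) : Prop :=
  ∃ φ : FaceLattice P ≃o (FaceLattice P)ᵒᵈ, ∀ G : FaceLattice P,
    (G : Set (EuclideanSpace ℝ (Fin d))) ≠ ∅ → (G : Set (EuclideanSpace ℝ (Fin d))) ≠ P →
      StrictlyAntipodal P (G : Set (EuclideanSpace ℝ (Fin d)))
        (OrderDual.ofDual (φ G) : FaceLattice P)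

/-- A pyramid: the convex hull of a `(d - 1)`-dimensional polytope (the base) and a point outside
its affine hull (the apex). -/
def IsPyramid (P : Set (EuclideanSpace ℝ (Fin d))) : Prop :=
  ∃ (Q : Set (EuclideanSpace ℝ (Fin d))) (p : EuclideanSpace ℝ (Fin d)),
    IsPolytope Q ∧ Q.Nonempty ∧ affDim Q + 1 = d ∧ p ∉ affineSpan ℝ Q ∧
      P = convexHull ℝ (insert p Q)

end RedPoly

end

noncomputable section

namespace RedPoly

open Set Filter Topology Pointwise
open scoped RealInnerProductSpace

/-! ### Width, exposed faces and polytopes -/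

section General

variable {d : ℕ}

/-! The core is an angle comparison at a vertex `v` opposite to a facet `F`. Write `ω` for the
minimum width. By Hahn–Banach `P - P` contains the ball of radius `ω`, so whenever a vertex and its
opposite face are at distance `ω`, the foot of the perpendicular from the vertex lies in that face
(`sub_smul_mem_expo_neg`).

Suppose every edge `aa'` of `F` is opposite to an edge at `v` of direction `f`, and every vertex `a`
of `F` is opposite, at distance `ω`, to the facet at `v` containing the edges matched to the two
edges of `F` at `a`. The opposite edges span a parallelogram face of `P - P`, in a plane at distance
at least `ω` from the origin. Tangent segments from one of its vertices to the `ω`-ball all have the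
same length, so they can be turned about the sides of the parallelogram to a common point `q`. The
spherical triangle inequality then bounds the angle subtended by `aa'` at the foot of `v` by the sum
of two angles at `v`: between `f` and the foot of `a`, and between `f` and the foot of `a'`
(`ang_le_of_parallelogram`). Summed over the edges of `F`, the left sides go once around a point of
a polygon and give at least `2π`. Each foot of `a` lies in the angle of its facet at `v`, so the
right sides add up to the total facet angle at `v`, which is less than `2π`. This contradiction is
`false_of_configuration`.

Angles are handled by integral geometry: the angle of two vectors is, up to a factor, the measure of
the planes through the origin separating them. Angle identities become pointwise sign identities,
and the two bounds by `2π` become counts: a generic plane through a point of a polygon crosses at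
least two edges, and a plane through the apex of a convex cone crosses at most two facets.

For the self-dual and pyramid statements the equalities with `ω` come from reducedness: each vertex
of a reduced polytope is opposite to a facet at distance `ω` (`IsReduced.exists_antipodal`), as one
sees by cutting off ever smaller caps and passing to the limit. The matching of edges and facets
comes from the duality, or, in a pyramid, from an injective map from base vertices to base edges,
which are equally many. -/

/-- The exposed subset of `K` on which `⟪u, ·⟫` is maximal. -/
def expo (K : Set (EuclideanSpace ℝ (Fin d))) (u : EuclideanSpace ℝ (Fin d)) :
    Set (EuclideanSpace ℝ (Fin d)) :=
  {x | x ∈ K ∧ ∀ y ∈ K, ⟪u, y⟫ ≤ ⟪u, x⟫}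

section Basic

variable {K P F G : Set (EuclideanSpace ℝ (Fin d))} {u v x y : EuclideanSpace ℝ (Fin d)}

lemma expo_subset : expo K u ⊆ K := fun _ h => h.1

lemma inner_eq_of_mem_expo (hx : x ∈ expo K u) (hy : y ∈ expo K u) : ⟪u, y⟫ = ⟪u, x⟫ :=
  le_antisymm (hx.2 y hy.1) (hy.2 x hx.1)

lemma mem_expo_of_inner_eq (hx : x ∈ expo K u) (hy : y ∈ K) (h : ⟪u, y⟫ = ⟪u, x⟫) :
    y ∈ expo K u :=
  ⟨hy, fun z hz => h ▸ hx.2 z hz⟩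

lemma inner_lt_of_notMem_expo (hx : x ∈ expo K u) (hy : y ∈ K) (h : y ∉ expo K u) :
    ⟪u, y⟫ < ⟪u, x⟫ :=
  lt_of_le_of_ne (hx.2 y hy) fun e => h (mem_expo_of_inner_eq hx hy e)

lemma expo_smul {c : ℝ} (hc : 0 < c) : expo K (c • u) = expo K u := by
  ext x
  simp only [expo, mem_ofPred_eq, inner_smul_left, RCLike.conj_to_real]
  simp [hc]

lemma mem_expo_neg : x ∈ expo K (-u) ↔ x ∈ K ∧ ∀ y ∈ K, ⟪u, x⟫ ≤ ⟪u, y⟫ := by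
  simp [expo]

lemma expo_nonempty (hK : IsCompact K) (hne : K.Nonempty) (u : EuclideanSpace ℝ (Fin d)) :
    (expo K u).Nonempty := by
  obtain ⟨x, hx, h⟩ := hK.exists_isMaxOn hne
    (f := fun x => ⟪u, x⟫) (by fun_prop)
  exact ⟨x, hx, fun y hy => h hy⟩

lemma supp_eq (hx : x ∈ expo K u) : supp K u = ⟪u, x⟫ := by
  refine IsGreatest.csSup_eq ⟨⟨x, hx.1, rfl⟩, ?_⟩
  rintro _ ⟨y, hy, rfl⟩
  exact hx.2 y hy

lemma suppHyperplane_inter (hK : IsCompact K) : suppHyperplane K u ∩ K = expo K u := by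
  ext x
  constructor
  · rintro ⟨h, hx⟩
    obtain ⟨z, hz⟩ := expo_nonempty hK ⟨x, hx⟩ u
    have : ⟪u, x⟫ = ⟪u, z⟫ := by rw [← supp_eq hz]; exact h
    exact mem_expo_of_inner_eq hz hx this
  · intro h
    exact ⟨(supp_eq h).symm, h.1⟩

lemma width_eq (hx : x ∈ expo K u) (hy : y ∈ expo K (-u)) : width K u = ⟪u, x - y⟫ := by
  rw [width, supp_eq hx, supp_eq hy, inner_sub_right, inner_neg_left]; ring

lemma inner_sub_le_width (hK : IsCompact K) (hx : x ∈ K) (hy : y ∈ K) :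
    ⟪u, x - y⟫ ≤ width K u := by
  obtain ⟨a, ha⟩ := expo_nonempty hK ⟨x, hx⟩ u
  obtain ⟨b, hb⟩ := expo_nonempty hK ⟨x, hx⟩ (-u)
  rw [width_eq ha hb, inner_sub_right, inner_sub_right]
  have := ha.2 x hx
  have := (mem_expo_neg.1 hb).2 y hy
  linarith

lemma width_nonneg (hK : IsCompact K) (hne : K.Nonempty) : 0 ≤ width K u := by
  obtain ⟨x, hx⟩ := hne
  simpa using inner_sub_le_width (u := u) hK hx hx

lemma minWidth_le (hK : IsCompact K) (hne : K.Nonempty) (hu : ‖u‖ = 1) :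
    minWidth K ≤ width K u := by
  refine csInf_le ⟨0, ?_⟩ ⟨u, hu, rfl⟩
  rintro _ ⟨w, -, rfl⟩
  exact width_nonneg hK hne

lemma minWidth_nonneg (hK : IsCompact K) (hne : K.Nonempty) : 0 ≤ minWidth K := by
  refine Real.sInf_nonneg ?_
  rintro _ ⟨w, -, rfl⟩
  exact width_nonneg hK hne

/-- The homogeneous form of the width bound, for perturbed normals that are no longer of length one.
-/
lemma minWidth_mul_norm_le (hK : IsCompact K) (hx : x ∈ expo K u) (hy : y ∈ expo K (-u)) :
    minWidth K * ‖u‖ ≤ ⟪u, x - y⟫ := by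
  rcases eq_or_ne u 0 with rfl | hu
  · simp
  have hpos : 0 < ‖u‖ := norm_pos_iff.2 hu
  have h1 : ‖(‖u‖⁻¹ • u)‖ = 1 := norm_smul_inv_norm hu
  have := minWidth_le hK ⟨x, hx.1⟩ h1
  have hx' : x ∈ expo K (‖u‖⁻¹ • u) := by rwa [expo_smul (by positivity)]
  have hy' : y ∈ expo K (-(‖u‖⁻¹ • u)) := by
    rw [← smul_neg]; rwa [expo_smul (by positivity)]
  rw [width_eq hx' hy', inner_smul_left, RCLike.conj_to_real] at this
  rw [mul_comm]
  rwa [le_inv_mul_iff₀ hpos] at this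

lemma exists_minWidth_mul_norm_le (hK : IsCompact K) (hne : K.Nonempty)
    (u : EuclideanSpace ℝ (Fin d)) :
    ∃ x ∈ K, ∃ y ∈ K, minWidth K * ‖u‖ ≤ ⟪u, x - y⟫ := by
  obtain ⟨x, hx⟩ := expo_nonempty hK hne u
  obtain ⟨y, hy⟩ := expo_nonempty hK hne (-u)
  exact ⟨x, hx.1, y, hy.1, minWidth_mul_norm_le hK hx hy⟩

lemma exists_width_lt {c : ℝ} (hd : ∃ u : EuclideanSpace ℝ (Fin d), ‖u‖ = 1)
    (h : minWidth K < c) : ∃ u : EuclideanSpace ℝ (Fin d), ‖u‖ = 1 ∧ width K u < c := by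
  obtain ⟨u, hu⟩ := hd
  have hne : {t | ∃ u : EuclideanSpace ℝ (Fin d), ‖u‖ = 1 ∧ t = width K u}.Nonempty :=
    ⟨_, u, hu, rfl⟩
  obtain ⟨_, ⟨w, hw, rfl⟩, hlt⟩ := exists_lt_of_csInf_lt hne h
  exact ⟨w, hw, hlt⟩

lemma width_neg : width K (-u) = width K u := by
  simp [width, add_comm]

/-- The difference body contains the ball of radius the minimum width. -/
lemma exists_sub_eq (hK : IsCompact K) (hc : Convex ℝ K) (hne : K.Nonempty)
    (hu : ‖u‖ = 1) : ∃ x ∈ K, ∃ y ∈ K, x - y = minWidth K • u := by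
  by_contra hcon
  have hnot : minWidth K • u ∉ K - K := by
    rintro ⟨x, hx, y, hy, h⟩
    exact hcon ⟨x, hx, y, hy, h⟩
  have hcomp : IsCompact (K - K) := by
    rw [← image2_sub, ← image_prod]
    exact (hK.prod hK).image (by fun_prop)
  -- A functional strictly separating the point from `K - K` would see a width below `ω` times its
  -- norm.
  obtain ⟨f, c, h1, h2⟩ := geometric_hahn_banach_closed_point (hc.sub hc)
    hcomp.isClosed hnot
  obtain ⟨w, rfl⟩ := (InnerProductSpace.toDual ℝ _).surjective f
  simp only [InnerProductSpace.toDual_apply_apply] at h1 h2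
  obtain ⟨x, hx, y, hy, h⟩ := exists_minWidth_mul_norm_le hK hne w
  have h3 := h1 (x - y) ⟨x, hx, y, hy, rfl⟩
  have h4 : ⟪w, minWidth K • u⟫ ≤ minWidth K * ‖w‖ := by
    rw [inner_smul_right]
    refine mul_le_mul_of_nonneg_left ?_ (minWidth_nonneg hK hne)
    simpa [hu] using real_inner_le_norm w u
  linarith

/-- The contact point: in a direction of minimum width, translating an exposed point whose exposed
set is a singleton gives a point of the opposite exposed set. -/
lemma sub_smul_mem_expo_neg (hK : IsCompact K) (hc : Convex ℝ K) (hu : ‖u‖ = 1)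
    (hx : expo K u = {x}) (hw : width K u = minWidth K) :
    x - minWidth K • u ∈ expo K (-u) := by
  have hxm : x ∈ expo K u := by rw [hx]; rfl
  obtain ⟨a, ha, b, hb, hab⟩ := exists_sub_eq hK hc ⟨x, hxm.1⟩ hu
  obtain ⟨z, hz⟩ := expo_nonempty hK ⟨x, hxm.1⟩ (-u)
  have h1 : ⟪u, a - b⟫ = minWidth K := by
    rw [hab, inner_smul_right, real_inner_self_eq_norm_sq, hu]; simp
  have h2 := width_eq hxm hz
  rw [hw, ← h1, inner_sub_right, inner_sub_right] at h2
  have h3 := hxm.2 a ha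
  have h4 := (mem_expo_neg.1 hz).2 b hb
  have h5 : a ∈ expo K u := mem_expo_of_inner_eq hxm ha (by linarith)
  have h6 : b ∈ expo K (-u) := mem_expo_of_inner_eq hz hb (by simp; linarith)
  rw [hx] at h5
  obtain rfl : a = x := h5
  rw [← hab]; simpa using h6

lemma isFace_iff (hK : IsCompact P) : IsFace P F ↔ ∃ u, u ≠ 0 ∧ expo P u = F := by
  simp only [IsFace, suppHyperplane_inter hK]

lemma strictlyAntipodal_iff (hK : IsCompact P) : StrictlyAntipodal P F G ↔
    F ≠ G ∧ ∃ u : EuclideanSpace ℝ (Fin d), ‖u‖ = 1 ∧ expo P u = F ∧ expo P (-u) = G := by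
  simp only [StrictlyAntipodal, suppHyperplane_inter hK]

lemma inner_const_of_mem_affineSpan {A : Set (EuclideanSpace ℝ (Fin d))} {c : ℝ}
    (h : ∀ x ∈ A, ⟪u, x⟫ = c) {x : EuclideanSpace ℝ (Fin d)} (hx : x ∈ affineSpan ℝ A) :
    ⟪u, x⟫ = c := by
  refine affineSpan_induction (p := fun x => ⟪u, x⟫ = c) hx h ?_
  intro t a b e ha hb he
  simp [inner_add_right, inner_smul_right, inner_sub_right, ha, hb, he]

/-- The affine hulls of opposite faces lie in parallel supporting planes, so their distance is at
least the width; minimality gives the other inequality. -/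
lemma width_eq_of_affDist (hK : IsCompact K) (hne : K.Nonempty) (hu : ‖u‖ = 1)
    (h : affDist (expo K u) (expo K (-u)) = minWidth K) : width K u = minWidth K := by
  refine le_antisymm ?_ (minWidth_le hK hne hu)
  obtain ⟨x, hx⟩ := expo_nonempty hK hne u
  obtain ⟨y, hy⟩ := expo_nonempty hK hne (-u)
  rw [← h, width_eq hx hy]
  refine le_csInf ⟨_, x, subset_affineSpan _ _ hx, y, subset_affineSpan _ _ hy, rfl⟩ ?_
  rintro _ ⟨a, ha, b, hb, rfl⟩
  have h1 := inner_const_of_mem_affineSpan (u := u) (fun z hz => inner_eq_of_mem_expo hx hz) ha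
  have h2 := inner_const_of_mem_affineSpan (u := -u) (fun z hz => inner_eq_of_mem_expo hy hz) hb
  simp only [inner_neg_left, neg_inj] at h2
  have : ⟪u, x - y⟫ = ⟪u, a - b⟫ := by rw [inner_sub_right, inner_sub_right, h1, h2]
  rw [this]
  simpa [hu] using real_inner_le_norm u (a - b)

lemma affDist_comm (A B : Set (EuclideanSpace ℝ (Fin d))) : affDist A B = affDist B A := by
  unfold affDist
  congr 1
  ext t
  constructor <;>
  · rintro ⟨x, hx, y, hy, rfl⟩
    exact ⟨y, hy, x, hx, norm_sub_rev _ _⟩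

end Basic

/-! ### Polytopes -/

section Polytope

variable {S : Set (EuclideanSpace ℝ (Fin d))} {u v x y : EuclideanSpace ℝ (Fin d)}

lemma inner_le_of_mem_convexHull {c : ℝ} (h : ∀ s ∈ S, ⟪u, s⟫ ≤ c)
    (hx : x ∈ convexHull ℝ S) : ⟪u, x⟫ ≤ c := by
  have : convexHull ℝ S ⊆ {x | ⟪u, x⟫ ≤ c} :=
    convexHull_min h (convex_halfSpace_le (innerₛₗ ℝ u).isLinear c)
  exact this hx

lemma mem_expo_convexHull_iff : x ∈ expo (convexHull ℝ S) u ↔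
    x ∈ convexHull ℝ S ∧ ∀ s ∈ S, ⟪u, s⟫ ≤ ⟪u, x⟫ :=
  ⟨fun h => ⟨h.1, fun s hs => h.2 s (subset_convexHull ℝ S hs)⟩,
    fun h => ⟨h.1, fun _ hy => inner_le_of_mem_convexHull h.2 hy⟩⟩

/-- A convex combination attains the maximum only if every point of positive weight does. -/
lemma expo_convexHull : expo (convexHull ℝ S) u =
    convexHull ℝ (S ∩ expo (convexHull ℝ S) u) := by
  apply Subset.antisymm
  · intro x hx
    have key : convexHull ℝ S ⊆ {y | y ∈ convexHull ℝ S ∧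
        (⟪u, y⟫ = ⟪u, x⟫ → y ∈ convexHull ℝ (S ∩ expo (convexHull ℝ S) u))} := by
      refine convexHull_min (fun s hs => ⟨subset_convexHull ℝ S hs, fun h => ?_⟩) ?_
      · exact subset_convexHull ℝ _
          ⟨hs, mem_expo_of_inner_eq hx (subset_convexHull ℝ S hs) h⟩
      · intro a ha b hb s t hs ht hst
        refine ⟨convex_convexHull ℝ S ha.1 hb.1 hs ht hst, fun h => ?_⟩
        have h1 := hx.2 a ha.1
        have h2 := hx.2 b hb.1
        rw [inner_add_right, inner_smul_right, inner_smul_right] at h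
        rcases eq_or_lt_of_le hs with rfl | hs'
        · obtain rfl : t = 1 := by linarith
          simpa using hb.2 (by simpa using h)
        rcases eq_or_lt_of_le ht with rfl | ht'
        · obtain rfl : s = 1 := by linarith
          simpa using ha.2 (by simpa using h)
        obtain rfl : s = 1 - t := by linarith
        refine convex_convexHull ℝ _ (ha.2 ?_) (hb.2 ?_) hs ht hst <;> nlinarith
    exact (key hx.1).2 rfl
  · refine convexHull_min inter_subset_right ?_
    intro a ha b hb s t hs ht hst
    refine ⟨convex_convexHull ℝ S ha.1 hb.1 hs ht hst, fun y hy => ?_⟩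
    have h1 := ha.2 y hy
    have h2 := hb.2 y hy
    rw [inner_add_right, inner_smul_right, inner_smul_right]
    obtain rfl : s = 1 - t := by linarith
    nlinarith [mul_le_mul_of_nonneg_left h1 hs, mul_le_mul_of_nonneg_left h2 ht]

lemma mem_of_expo_eq_singleton (h : expo (convexHull ℝ S) u = {v}) : v ∈ S := by
  have h1 := expo_convexHull (S := S) (u := u)
  by_contra hv
  have h2 : S ∩ expo (convexHull ℝ S) u = ∅ := by
    rw [h]
    ext y
    simp only [mem_inter_iff, mem_singleton_iff, mem_empty_iff_false, iff_false, not_and]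
    rintro hy rfl
    exact hv hy
  rw [h2, h, convexHull_empty] at h1
  exact singleton_ne_empty v h1

/-- Faces of faces are faces. -/
lemma exists_expo_expo (hS : S.Finite) (hne : S.Nonempty) (u w : EuclideanSpace ℝ (Fin d)) :
    ∃ ε > (0 : ℝ), expo (convexHull ℝ S) (u + ε • w) = expo (expo (convexHull ℝ S) u) w := by
  have hK : IsCompact (convexHull ℝ S) := hS.isCompact_convexHull ℝ
  obtain ⟨a, ha⟩ := expo_nonempty hK hne.convexHull u
  have hF : IsCompact (expo (convexHull ℝ S) u) := by
    rw [expo_convexHull]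
    exact (hS.subset inter_subset_left).isCompact_convexHull ℝ
  obtain ⟨b, hb⟩ := expo_nonempty hF ⟨a, ha⟩ w
  -- The factor 2 leaves slack: a tie at the perturbed normal `u + ε • w` then forces a tie for `u`
  -- and for `w` separately.
  have hev : ∀ᶠ ε in 𝓝[>] (0 : ℝ), ∀ s ∈ S,
      2 * ε * (⟪w, s⟫ - ⟪w, b⟫) ≤ ⟪u, b⟫ - ⟪u, s⟫ := by
    rw [Filter.eventually_all_finite hS]
    intro s hs
    by_cases hsF : s ∈ expo (convexHull ℝ S) u
    · have h1 := inner_eq_of_mem_expo hb.1 hsF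
      have h2 := hb.2 s hsF
      filter_upwards [self_mem_nhdsWithin] with ε hε
      have hε : 0 < ε := hε
      nlinarith
    · have h1 := inner_lt_of_notMem_expo hb.1 (subset_convexHull ℝ S hs) hsF
      have hcont : Tendsto (fun ε : ℝ => 2 * ε * (⟪w, s⟫ - ⟪w, b⟫)) (𝓝 0) (𝓝 0) := by
        have : Continuous (fun ε : ℝ => 2 * ε * (⟪w, s⟫ - ⟪w, b⟫)) := by fun_prop
        simpa using this.tendsto 0
      exact (hcont.mono_left nhdsWithin_le_nhds).eventually_le_const (by linarith)
  obtain ⟨ε, hε, hε0⟩ := (hev.and self_mem_nhdsWithin).exists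
  have hε0 : 0 < ε := hε0
  refine ⟨ε, hε0, ?_⟩
  have key : ∀ x ∈ convexHull ℝ S, 2 * ε * (⟪w, x⟫ - ⟪w, b⟫) ≤ ⟪u, b⟫ - ⟪u, x⟫ := by
    intro x hx
    have := inner_le_of_mem_convexHull (u := (2 * ε) • w + u) (c := 2 * ε * ⟪w, b⟫ + ⟪u, b⟫)
      (fun s hs => by
        have := hε s hs
        rw [inner_add_left, inner_smul_left, RCLike.conj_to_real]; linarith) hx
    rw [inner_add_left, inner_smul_left, RCLike.conj_to_real] at this
    linarith
  have hval : ∀ x, ⟪u + ε • w, x⟫ = ⟪u, x⟫ + ε * ⟪w, x⟫ := fun x => by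
    rw [inner_add_left, inner_smul_left, RCLike.conj_to_real]
  have hbm : b ∈ expo (convexHull ℝ S) (u + ε • w) := by
    refine ⟨hb.1.1, fun y hy => ?_⟩
    rw [hval, hval]
    have := key y hy
    have := hb.1.2 y hy
    linarith
  ext x
  constructor
  · intro hx
    have h1 := inner_eq_of_mem_expo hbm hx
    rw [hval, hval] at h1
    have h2 := key x hx.1
    have h3 := hb.1.2 x hx.1
    have h4 : ⟪u, x⟫ = ⟪u, b⟫ := by linarith
    have h5 : ⟪w, x⟫ = ⟪w, b⟫ := by
      have : ε * (⟪w, x⟫ - ⟪w, b⟫) = 0 := by linarith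
      rcases mul_eq_zero.1 this with h | h <;> linarith
    exact mem_expo_of_inner_eq hb (mem_expo_of_inner_eq hb.1 hx.1 h4) h5
  · intro hx
    refine mem_expo_of_inner_eq hbm hx.1.1 ?_
    rw [hval, hval, inner_eq_of_mem_expo hb hx, inner_eq_of_mem_expo hb.1 hx.1]

/-- Every polytope is the convex hull of a finite set of vertices. -/
lemma exists_irredundant (hS : S.Finite) :
    ∃ T : Set (EuclideanSpace ℝ (Fin d)), T.Finite ∧ convexHull ℝ T = convexHull ℝ S ∧
      ∀ s ∈ T, ∃ u, expo (convexHull ℝ S) u = {s} := by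
  induction hn : S.ncard using Nat.strong_induction_on generalizing S with
  | _ n ih =>
    by_cases h : ∃ s ∈ S, s ∈ convexHull ℝ (S \ {s})
    · obtain ⟨s, hs, hsc⟩ := h
      obtain ⟨T, hT, h1, h2⟩ := ih (S \ {s}).ncard
        (by rw [← hn]; exact ncard_sdiff_singleton_lt_of_mem hs hS) (hS.subset sdiff_subset) rfl
      have heq : convexHull ℝ (S \ {s}) = convexHull ℝ S := by
        refine Subset.antisymm (convexHull_mono sdiff_subset) (convexHull_min ?_
          (convex_convexHull ℝ _))
        intro x hx
        by_cases hxs : x = s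
        · rwa [hxs]
        · exact subset_convexHull ℝ _ ⟨hx, hxs⟩
      rw [heq] at h1 h2
      exact ⟨T, hT, h1, h2⟩
    · push Not at h
      refine ⟨S, hS, rfl, fun s hs => ?_⟩
      -- Once nothing is redundant, each point is strictly separated from the hull of the others,
      -- and the separating functional exposes it.
      obtain ⟨f, c, h1, h2⟩ := geometric_hahn_banach_closed_point (convex_convexHull ℝ (S \ {s}))
        ((hS.subset sdiff_subset).isClosed_convexHull ℝ) (h s hs)
      obtain ⟨w, rfl⟩ := (InnerProductSpace.toDual ℝ _).surjective f
      simp only [InnerProductSpace.toDual_apply_apply] at h1 h2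
      refine ⟨w, ?_⟩
      have hlt : ∀ y ∈ S, y ≠ s → ⟪w, y⟫ < ⟪w, s⟫ := fun y hy hys =>
        (h1 y (subset_convexHull ℝ _ ⟨hy, hys⟩)).trans h2
      have hsm : s ∈ expo (convexHull ℝ S) w := by
        refine mem_expo_convexHull_iff.2 ⟨subset_convexHull ℝ S hs, fun y hy => ?_⟩
        rcases eq_or_ne y s with rfl | hys
        · exact le_rfl
        · exact (hlt y hy hys).le
      rw [expo_convexHull]
      have : S ∩ expo (convexHull ℝ S) w = {s} := by
        ext y
        simp only [mem_inter_iff, mem_singleton_iff]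
        constructor
        · rintro ⟨hy, hy'⟩
          by_contra hys
          have := inner_eq_of_mem_expo hsm hy'
          have := hlt y hy hys
          linarith
        · rintro rfl
          exact ⟨hs, hsm⟩
      rw [this, convexHull_singleton]

end Polytope

end General

/-! ### Angles as measures of separating planes -/

section Angle

open MeasureTheory

/-- Three-dimensional Euclidean space. -/
abbrev E3 := EuclideanSpace ℝ (Fin 3)

/-- Lebesgue measure on the unit ball. -/
def ballMeasure : Measure E3 := volume.restrict (Metric.ball 0 1)

instance : IsFiniteMeasure ballMeasure :=
  ⟨by simp [ballMeasure]⟩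

/-- Whether the plane with normal `g` separates `x` from `y`. -/
def sep (x y g : E3) : ℝ := if ⟪g, x⟫ * ⟪g, y⟫ < 0 then 1 else 0

/-- The measure of the set of normals of planes separating `x` from `y`: a multiple of the angle
between `x` and `y`. -/
def ang (x y : E3) : ℝ := ∫ g, sep x y g ∂ballMeasure

/-- The value of `ang` that corresponds to the straight angle. -/
def straight : ℝ := ∫ _, (1 : ℝ) ∂ballMeasure

lemma measurable_sep (x y : E3) : Measurable (sep x y) := by
  refine Measurable.ite ?_ measurable_const measurable_const
  exact (isOpen_lt (by fun_prop) continuous_const).measurableSet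

lemma integrable_sep (x y : E3) : Integrable (sep x y) ballMeasure := by
  refine Integrable.of_bound (measurable_sep x y).aestronglyMeasurable 1 ?_
  refine Eventually.of_forall fun g => ?_
  unfold sep
  split_ifs <;> simp

lemma ae_inner_ne_zero {x : E3} (hx : x ≠ 0) : ∀ᵐ g ∂ballMeasure, ⟪g, x⟫ ≠ 0 := by
  refine ae_restrict_of_ae ?_
  have h := Measure.addHaar_submodule (volume : Measure E3) (LinearMap.ker (innerₛₗ ℝ x)) (by
    intro h
    have : x ∈ LinearMap.ker (innerₛₗ ℝ x) := h ▸ Submodule.mem_top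
    simp at this
    exact hx this)
  rw [ae_iff]
  convert h using 2
  ext g
  simp [real_inner_comm]

lemma ang_map (L : E3 ≃ₗᵢ[ℝ] E3) (x y : E3) : ang (L x) (L y) = ang x y := by
  have hmp : MeasurePreserving L (ballMeasure) (ballMeasure) := by
    have := L.measurePreserving.restrict_preimage
      (Metric.isOpen_ball (x := (0 : E3)) (ε := 1)).measurableSet
    have hpre : L ⁻¹' (Metric.ball 0 1) = Metric.ball 0 1 := by
      ext z
      simp
    rwa [hpre] at this
  unfold ang
  rw [← hmp.integral_comp L.toHomeomorph.measurableEmbedding]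
  simp [sep]

/-- Two reflections carry one pair to the other: the first moves `x` to `x'`, the second moves the
image of `y` to `y'` and fixes `x'`. Lengths and inner product thus determine the angle, without any
trigonometry. -/
lemma ang_congr {x y x' y' : E3} (hx : ‖x‖ = ‖x'‖) (hy : ‖y‖ = ‖y'‖) (h : ⟪x, y⟫ = ⟪x', y'⟫) :
    ang x y = ang x' y' := by
  set L := (ℝ ∙ (x - x'))ᗮ.reflection with hL
  have h1 : L x = x' := Submodule.reflection_sub hx
  have hn : ‖L y‖ = ‖y'‖ := by rw [L.norm_map, hy]
  set M := (ℝ ∙ (L y - y'))ᗮ.reflection with hM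
  have h2 : M (L y) = y' := Submodule.reflection_sub hn
  have h3 : M x' = x' := by
    rw [hM, Submodule.reflection_eq_self_iff, Submodule.mem_orthogonal_singleton_iff_inner_right,
      inner_sub_left, real_inner_comm, real_inner_comm x', ← h, ← L.inner_map_map x y, h1, sub_self]
  rw [← ang_map L x y, h1, ← ang_map M, h2, h3]

/-- Almost every plane separates `y` from exactly one of `x` and `-x`. -/
lemma ang_neg_add {x y : E3} (hx : x ≠ 0) (hy : y ≠ 0) : ang x y + ang (-x) y = straight := by
  unfold ang straight
  rw [← integral_add (integrable_sep _ _) (integrable_sep _ _)]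
  refine integral_congr_ae ?_
  filter_upwards [ae_inner_ne_zero hx, ae_inner_ne_zero hy] with g h1 h2
  simp only [sep, inner_neg_right, neg_mul, Left.neg_neg_iff]
  rcases lt_or_gt_of_ne (mul_ne_zero h1 h2) with h | h
  · simp [h, not_lt.2 h.le]
  · simp [h, not_lt.2 h.le]

/-- A plane that separates `x` from `z` and misses `y` separates `y` from one of them. -/
lemma ang_triangle {x y z : E3} (hy : y ≠ 0) : ang x z ≤ ang x y + ang y z := by
  unfold ang
  rw [← integral_add (integrable_sep _ _) (integrable_sep _ _)]
  refine integral_mono_ae (integrable_sep _ _)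
    ((integrable_sep _ _).add (integrable_sep _ _)) ?_
  filter_upwards [ae_inner_ne_zero hy] with g h1
  simp only [sep]
  split_ifs with h2 h3 h4 h4 h3 h4 h4 <;> norm_num
  have h5 := mul_nonneg (not_lt.1 h3) (not_lt.1 h4)
  have : 0 < ⟪g, y⟫ ^ 2 := by positivity
  nlinarith [mul_pos_of_neg_of_neg h2 (neg_neg_of_pos this)]

/-- A generic plane separating `x` from `y` separates the intermediate vector `z` from exactly one
of them; a plane with `x` and `y` on one side has `z` there too. -/
lemma ang_add_of_cone {x y z : E3} {s t : ℝ} (hx : x ≠ 0) (hy : y ≠ 0) (hz : z ≠ 0)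
    (hs : 0 ≤ s) (ht : 0 ≤ t) (h : z = s • x + t • y) : ang z x + ang z y = ang x y := by
  unfold ang
  rw [← integral_add (integrable_sep _ _) (integrable_sep _ _)]
  refine integral_congr_ae ?_
  filter_upwards [ae_inner_ne_zero hx, ae_inner_ne_zero hy, ae_inner_ne_zero hz] with g h1 h2 h3
  have hv : ⟪g, z⟫ = s * ⟪g, x⟫ + t * ⟪g, y⟫ := by
    rw [h, inner_add_right, inner_smul_right, inner_smul_right]
  simp only [sep]
  generalize ⟪g, x⟫ = a at *
  generalize ⟪g, y⟫ = b at *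
  generalize ⟪g, z⟫ = c at *
  rcases lt_or_gt_of_ne h1 with ha | ha <;> rcases lt_or_gt_of_ne h2 with hb | hb <;>
    rcases lt_or_gt_of_ne h3 with hc | hc <;>
    simp [mul_neg_iff, ha, hb, hc, ha.le, hb.le, hc.le, not_lt.2] <;>
    nlinarith

/-- The angle sum of the triangle `0, x, y`: among the parallels to a generic plane through the
three vertices, exactly one enters the triangle, namely at the vertex of middle height. -/
lemma ang_triangle_sum {x y : E3} (hx : x ≠ 0) (hy : y ≠ 0) (hxy : y - x ≠ 0) :
    ang (y - x) y + ang (-(y - x)) x + ang x y = straight := by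
  unfold ang straight
  rw [← integral_add (integrable_sep _ _) (integrable_sep _ _),
    ← integral_add (by exact (integrable_sep _ _).add (integrable_sep _ _)) (integrable_sep _ _)]
  refine integral_congr_ae ?_
  filter_upwards [ae_inner_ne_zero hx, ae_inner_ne_zero hy, ae_inner_ne_zero hxy] with g h1 h2 h3
  simp only [sep, inner_sub_right, inner_neg_right] at h3 ⊢
  generalize ⟪g, x⟫ = a at *
  generalize ⟪g, y⟫ = b at *
  have e1 : -(b - a) * a = a * a - a * b := by ring
  have e2 : (b - a) * b = b * b - a * b := by ring
  rw [e1, e2]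
  have hne : a * a - a * b ≠ 0 := by rw [← e1]; exact mul_ne_zero (neg_ne_zero.2 h3) h1
  have hne' : b * b - a * b ≠ 0 := by rw [← e2]; exact mul_ne_zero h3 h2
  have hab : 0 < (b - a) ^ 2 := by positivity
  have ha : 0 < a ^ 2 := by positivity
  have hb : 0 < b ^ 2 := by positivity
  by_cases h4 : a * b < 0
  · rw [if_neg (by nlinarith), if_neg (by nlinarith), if_pos h4]; norm_num
  · rw [if_neg h4]
    have h4 := not_lt.1 h4
    rcases lt_or_gt_of_ne hne with h5 | h5 <;> rcases lt_or_gt_of_ne hne' with h6 | h6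
    · nlinarith
    · rw [if_neg (by linarith), if_pos h5]; norm_num
    · rw [if_pos h6, if_neg (by linarith)]; norm_num
    · exfalso
      have : 0 < (a * a - a * b) * (b * b - a * b) := mul_pos h5 h6
      have e : (a * a - a * b) * (b * b - a * b) = - (a * b * (b - a) ^ 2) := by ring
      have := mul_nonneg h4 hab.le
      linarith

/-- The angle inequality at a parallelogram face of the difference body. -/
lemma ang_le_of_parallelogram {n f y y' u U U' : E3} {ω h : ℝ} (hn : ‖n‖ = 1) (hu : ‖u‖ = 1)
    (hU : ‖U‖ = 1) (hU' : ‖U'‖ = 1) (hω : 0 ≤ ω) (hωh : ω ≤ h)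
    (hnf : ⟪n, f⟫ = 0) (hny : ⟪n, y⟫ = h) (hny' : ⟪n, y'⟫ = h) (huy : ⟪u, y⟫ = ω)
    (huy' : ⟪u, y'⟫ = ω) (hUy : ⟪U, y⟫ = ω) (hUy' : ⟪U', y'⟫ = ω) (hUf : ⟪U, f⟫ = 0)
    (hUf' : ⟪U', f⟫ = 0) (hf : f ≠ 0) (hyy : y ≠ y') (ht : ω • u - y ≠ 0)
    (ht' : ω • u - y' ≠ 0) :
    ang (ω • u - y) (ω • u - y') ≤ ang (ω • U - y) f + ang (ω • U' - y') f := by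
  -- The point over the plane at height `h` whose distance to any `z` of that plane is the tangent
  -- length from `z` to the sphere of radius `ω`. Its inner products with directions orthogonal to
  -- `n` and to a tangent normal also match, so `q` can replace each contact point in `ang_congr`.
  set q : E3 := (h + √(h ^ 2 - ω ^ 2)) • n with hq
  have hsq : √(h ^ 2 - ω ^ 2) ^ 2 = h ^ 2 - ω ^ 2 := Real.sq_sqrt (by nlinarith)
  have norm_q : ∀ z, ⟪n, z⟫ = h → ‖q - z‖ ^ 2 = ‖z‖ ^ 2 - ω ^ 2 := by
    intro z hz
    rw [@norm_sub_sq_real, hq, norm_smul, hn, inner_smul_left, RCLike.conj_to_real, hz, mul_one,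
      Real.norm_eq_abs, sq_abs]
    nlinarith
  have norm_u : ∀ w z : E3, ‖w‖ = 1 → ⟪w, z⟫ = ω → ‖ω • w - z‖ ^ 2 = ‖z‖ ^ 2 - ω ^ 2 := by
    intro w z hw hz
    rw [@norm_sub_sq_real, norm_smul, hw, inner_smul_left, RCLike.conj_to_real, hz, mul_one,
      Real.norm_eq_abs, sq_abs]
    ring
  have norm_eq : ∀ w z : E3, ‖w‖ = 1 → ⟪w, z⟫ = ω → ⟪n, z⟫ = h → ‖q - z‖ = ‖ω • w - z‖ := by
    intro w z hw hz hnz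
    rw [← sq_eq_sq₀ (norm_nonneg _) (norm_nonneg _), norm_q z hnz, norm_u w z hw hz]
  have inner_eq : ∀ w z e : E3, ⟪w, e⟫ = 0 → ⟪n, e⟫ = 0 → ⟪e, q - z⟫ = ⟪e, ω • w - z⟫ := by
    intro w z e hw hne
    rw [inner_sub_right, inner_sub_right, hq, inner_smul_right, inner_smul_right,
      real_inner_comm, hne, real_inner_comm w, hw]
    simp
  have hne : ⟪n, y - y'⟫ = 0 := by rw [inner_sub_right, hny, hny', sub_self]
  have hue : ⟪u, y - y'⟫ = 0 := by rw [inner_sub_right, huy, huy', sub_self]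
  have hq0 : q - y ≠ 0 := by
    rw [← norm_ne_zero_iff, norm_eq u y hu huy hny]; exact norm_ne_zero_iff.2 ht
  have hq0' : q - y' ≠ 0 := by
    rw [← norm_ne_zero_iff, norm_eq u y' hu huy' hny']; exact norm_ne_zero_iff.2 ht'
  have e1 : ang (y - y') (q - y') = ang (y - y') (ω • u - y') :=
    ang_congr rfl (norm_eq u y' hu huy' hny') (inner_eq _ _ _ hue hne)
  have e2 : ang (-(y - y')) (q - y) = ang (-(y - y')) (ω • u - y) :=
    ang_congr rfl (norm_eq u y hu huy hny)
      (inner_eq _ _ _ (by rw [inner_neg_right, hue, neg_zero]) (by rw [inner_neg_right, hne, neg_zero]))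
  have e3 : ang (q - y') f = ang (ω • U' - y') f :=
    ang_congr (norm_eq U' y' hU' hUy' hny') rfl (by
      rw [real_inner_comm, real_inner_comm f]; exact inner_eq _ _ _ hUf' hnf)
  have e4 : ang (q - y) f = ang (ω • U - y) f :=
    ang_congr (norm_eq U y hU hUy hny) rfl (by
      rw [real_inner_comm, real_inner_comm f]; exact inner_eq _ _ _ hUf hnf)
  -- The adjacent parallelogram angles at `y'` and `y` add up to the straight angle. Each is bounded
  -- through `q`, and the angle sum of the triangle `y, y', ω • u` turns the angles along the side
  -- `yy'` into the angle at `ω • u`.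
  have h1 := ang_triangle (x := y - y') (z := f) hq0'
  have h2 := ang_triangle (x := -(y - y')) (z := f) hq0
  have h3 := ang_neg_add (sub_ne_zero.2 hyy) hf
  have h4 := ang_triangle_sum ht ht' (by
    have : ω • u - y' - (ω • u - y) = y - y' := by abel
    rw [this]; exact sub_ne_zero.2 hyy)
  have h5 : ω • u - y' - (ω • u - y) = y - y' := by abel
  rw [h5] at h4
  rw [e1, e3] at h1
  rw [e2, e4] at h2
  linarith

/-- A counting form of the comparison between the total angle of a convex cone at its apex and the
total angle around a point of a polygon. -/
lemma not_sum_ang_le {ι κ : Type*} [Fintype ι] [Fintype κ] (p q : ι → κ) (e₁ e₂ : κ → ι)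
    (t : κ → E3) (f : ι → E3) (m : E3) (ht : ∀ a, t a ≠ 0) (hm : ∀ e, ⟪m, f e⟫ < 0)
    (hlow : ∀ g : E3, (∀ a, ⟪g, t a⟫ ≠ 0) → (2 : ℝ) ≤ ∑ e, sep (t (p e)) (t (q e)) g)
    (hup : ∀ g : E3, g ≠ 0 → ∑ a, sep (f (e₁ a)) (f (e₂ a)) g ≤ (2 : ℝ)) :
    ∑ a, ang (f (e₁ a)) (f (e₂ a)) < ∑ e, ang (t (p e)) (t (q e)) := by
  have hT : ∑ e, ang (t (p e)) (t (q e)) = ∫ g, ∑ e, sep (t (p e)) (t (q e)) g ∂ballMeasure :=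
    (integral_finsetSum _ fun i _ => integrable_sep _ _).symm
  have hF : ∑ a, ang (f (e₁ a)) (f (e₂ a)) =
      ∫ g, ∑ a, sep (f (e₁ a)) (f (e₂ a)) g ∂ballMeasure :=
    (integral_finsetSum _ fun i _ => integrable_sep _ _).symm
  have ae0 : ∀ᵐ g ∂ballMeasure, g ≠ 0 := by
    refine ae_restrict_of_ae ?_
    rw [ae_iff]
    simp
  have hlow' : ∫ _, (2 : ℝ) ∂ballMeasure ≤ ∫ g, ∑ e, sep (t (p e)) (t (q e)) g ∂ballMeasure := by
    refine integral_mono_ae (integrable_const _)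
      (integrable_finsetSum _ fun i _ => integrable_sep _ _) ?_
    filter_upwards [ae_all_iff.2 fun a => ae_inner_ne_zero (ht a)] with g hg
    exact hlow g hg
  rw [hT, hF]
  refine lt_of_lt_of_le ?_ hlow'
  rw [← sub_pos, ← integral_sub (integrable_const _)
    (integrable_finsetSum _ fun i _ => integrable_sep _ _)]
  set φ : E3 → ℝ := fun g => 2 - ∑ a, sep (f (e₁ a)) (f (e₂ a)) g with hφ
  have hint : Integrable φ ballMeasure :=
    (integrable_const _).sub (integrable_finsetSum _ fun i _ => integrable_sep _ _)
  rw [integral_pos_iff_support_of_nonneg_ae ?_ hint]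
  -- Strictness comes from normals near a multiple of `m`: for these all `f e` lie on one side, so
  -- no angle is crossed.
  · obtain ⟨W, hW, hWo, hWm⟩ : ∃ W : Set E3, (∀ g ∈ W, ∀ e, ⟪g, f e⟫ < 0) ∧ IsOpen W ∧
        W = {g | ∀ e, ⟪g, f e⟫ < 0} := by
      refine ⟨{g | ∀ e, ⟪g, f e⟫ < 0}, fun g hg => hg, ?_, rfl⟩
      have : {g : E3 | ∀ e, ⟪g, f e⟫ < 0} = ⋂ e, {g : E3 | ⟪g, f e⟫ < 0} := by ext; simp
      rw [this]
      exact isOpen_iInter_of_finite fun e => isOpen_lt (by fun_prop) continuous_const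
    have hsub : W ⊆ Function.support φ := by
      intro g hg
      have : ∑ a, sep (f (e₁ a)) (f (e₂ a)) g = 0 := by
        refine Finset.sum_eq_zero fun a _ => ?_
        rw [sep, if_neg (not_lt.2 (mul_pos_of_neg_of_neg (hW g hg _) (hW g hg _)).le)]
      simp [hφ, this]
    refine lt_of_lt_of_le ?_ (measure_mono hsub)
    rw [ballMeasure, Measure.restrict_apply hWo.measurableSet]
    refine (hWo.inter Metric.isOpen_ball).measure_pos _ ?_
    have hc : 0 < (‖m‖ + 1)⁻¹ := by positivity
    refine ⟨(‖m‖ + 1)⁻¹ • m, ?_, ?_⟩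
    · rw [hWm]
      intro e
      rw [inner_smul_left, RCLike.conj_to_real]
      exact mul_neg_of_pos_of_neg hc (hm e)
    · rw [mem_ball_zero_iff, norm_smul, Real.norm_of_nonneg hc.le, inv_mul_lt_iff₀ (by positivity)]
      linarith
  · filter_upwards [ae0] with g hg
    have := hup g hg
    simp only [hφ, Pi.zero_apply]
    linarith

end Angle

/-! ### Sign patterns in a plane -/

section Linear

/-- Three vectors in a plane, none of which lies behind the supporting lines of the others. -/
lemma false_of_three {g x₁ x₂ x₃ u₁ u₂ u₃ : E3} (hg : g ≠ 0)
    (h1 : ⟪g, x₁⟫ = 0) (h2 : ⟪g, x₂⟫ = 0) (h3 : ⟪g, x₃⟫ = 0)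
    (h11 : ⟪u₁, x₁⟫ = 0) (h12 : ⟪u₁, x₂⟫ < 0) (h13 : ⟪u₁, x₃⟫ < 0)
    (h21 : ⟪u₂, x₁⟫ < 0) (h22 : ⟪u₂, x₂⟫ = 0) (h23 : ⟪u₂, x₃⟫ < 0)
    (h31 : ⟪u₃, x₁⟫ < 0) (h32 : ⟪u₃, x₂⟫ < 0) (h33 : ⟪u₃, x₃⟫ = 0) : False := by
  -- In a linear relation each `uᵢ` forces the two other coefficients to be both zero or of opposite
  -- signs; three numbers cannot have pairwise opposite signs.
  have hli : LinearIndependent ℝ ![x₁, x₂, x₃] := by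
    rw [Fintype.linearIndependent_iff]
    intro c hc
    simp only [Fin.sum_univ_three, Matrix.cons_val_zero, Matrix.cons_val_one, Matrix.cons_val] at hc
    have e1 := congrArg (fun w => ⟪u₁, w⟫) hc
    have e2 := congrArg (fun w => ⟪u₂, w⟫) hc
    have e3 := congrArg (fun w => ⟪u₃, w⟫) hc
    simp only [inner_add_right, inner_smul_right, h11, h22, h33, inner_zero_right, mul_zero,
      zero_add, add_zero] at e1 e2 e3
    have pos : ∀ {x y a b : ℝ}, a < 0 → b < 0 → x * a + y * b = 0 → 0 < x → y < 0 := by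
      intro x y a b ha hb h hx
      by_contra hy
      nlinarith [mul_neg_of_pos_of_neg hx ha, mul_nonpos_of_nonneg_of_nonpos (not_lt.1 hy) hb.le]
    have neg : ∀ {x y a b : ℝ}, a < 0 → b < 0 → x * a + y * b = 0 → x < 0 → 0 < y := by
      intro x y a b ha hb h hx
      by_contra hy
      nlinarith [mul_pos_of_neg_of_neg hx ha, mul_nonneg_of_nonpos_of_nonpos (not_lt.1 hy) hb.le]
    rcases lt_trichotomy (c 0) 0 with h | h | h
    · have p1 := neg h31 h32 e3 h
      have p2 := neg h21 h23 e2 h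
      linarith [pos h12 h13 e1 p1]
    · rw [h] at e2 e3
      have c1 : c 1 = 0 := by simpa [h32.ne] using e3
      have c2 : c 2 = 0 := by simpa [h23.ne] using e2
      intro i
      fin_cases i <;> simp [h, c1, c2]
    · have p1 := pos h31 h32 e3 h
      have p2 := pos h21 h23 e2 h
      linarith [neg h12 h13 e1 p1]
  have hspan := hli.span_eq_top_of_card_eq_finrank (by simp)
  have hle : Submodule.span ℝ (range ![x₁, x₂, x₃]) ≤ LinearMap.ker (innerₛₗ ℝ g) := by
    rw [Submodule.span_le]
    rintro _ ⟨i, rfl⟩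
    fin_cases i <;> simp [h1, h2, h3]
  rw [hspan] at hle
  have : g ∈ LinearMap.ker (innerₛₗ ℝ g) := hle Submodule.mem_top
  simp at this
  exact hg this

/-- Coordinates in a plane with respect to two vectors separated by functionals. -/
lemma exists_coord {u x₁ x₂ n₁ n₂ z : E3} (hu : u ≠ 0) (hx1 : ⟪u, x₁⟫ = 0) (hx2 : ⟪u, x₂⟫ = 0)
    (h11 : ⟪n₁, x₁⟫ = 0) (h12 : ⟪n₁, x₂⟫ < 0) (h21 : ⟪n₂, x₁⟫ < 0) (h22 : ⟪n₂, x₂⟫ = 0)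
    (hz : ⟪u, z⟫ = 0) : ∃ s t : ℝ, z = s • x₁ + t • x₂ := by
  have hli : LinearIndependent ℝ ![x₁, x₂, u] := by
    rw [Fintype.linearIndependent_iff]
    intro c hc
    simp only [Fin.sum_univ_three, Matrix.cons_val_zero, Matrix.cons_val_one, Matrix.cons_val] at hc
    have e := congrArg (fun w => ⟪u, w⟫) hc
    simp only [inner_add_right, inner_smul_right, hx1, hx2, inner_zero_right, mul_zero,
      zero_add] at e
    have c2 : c 2 = 0 := by simpa [hu] using e
    rw [c2, zero_smul, add_zero] at hc
    have e := congrArg (fun w => ⟪n₁, w⟫) hc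
    simp only [inner_add_right, inner_smul_right, h11, inner_zero_right, mul_zero,
      zero_add] at e
    have c1 : c 1 = 0 := by simpa [h12.ne] using e
    have e := congrArg (fun w => ⟪n₂, w⟫) hc
    simp only [inner_add_right, inner_smul_right, h22, inner_zero_right, mul_zero,
      add_zero] at e
    have c0 : c 0 = 0 := by simpa [h21.ne] using e
    intro i
    fin_cases i <;> simp [c0, c1, c2]
  have hspan := hli.span_eq_top_of_card_eq_finrank (by simp)
  have hmem : z ∈ Submodule.span ℝ (range ![x₁, x₂, u]) := hspan ▸ Submodule.mem_top
  rw [Submodule.mem_span_range_iff_exists_fun] at hmem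
  obtain ⟨c, hc⟩ := hmem
  simp only [Fin.sum_univ_three, Matrix.cons_val_zero, Matrix.cons_val_one, Matrix.cons_val] at hc
  have e := congrArg (fun w => ⟪u, w⟫) hc
  simp only [inner_add_right, inner_smul_right, hx1, hx2, hz, mul_zero, zero_add] at e
  have c2 : c 2 = 0 := by simpa [hu] using e
  rw [c2, zero_smul, add_zero] at hc
  exact ⟨_, _, hc.symm⟩

/-- Two unit vectors orthogonal to the same plane agree up to sign. -/
lemma eq_or_eq_neg_of_orthogonal {u u' x₁ x₂ n₁ n₂ : E3} (hu : ‖u‖ = 1) (hu' : ‖u'‖ = 1)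
    (hx1 : ⟪u, x₁⟫ = 0) (hx2 : ⟪u, x₂⟫ = 0) (hx1' : ⟪u', x₁⟫ = 0) (hx2' : ⟪u', x₂⟫ = 0)
    (h11 : ⟪n₁, x₁⟫ = 0) (h12 : ⟪n₁, x₂⟫ < 0) (h21 : ⟪n₂, x₁⟫ < 0) (h22 : ⟪n₂, x₂⟫ = 0) :
    u' = u ∨ u' = -u := by
  have hu0 : u ≠ 0 := by rintro rfl; simp at hu
  have huu : ⟪u, u⟫ = 1 := by rw [real_inner_self_eq_norm_sq, hu]; norm_num
  obtain ⟨s, t, h⟩ := exists_coord (z := u' - ⟪u, u'⟫ • u) hu0 hx1 hx2 h11 h12 h21 h22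
    (by rw [inner_sub_right, inner_smul_right, huu]; ring)
  have hz : u' - ⟪u, u'⟫ • u = 0 := by
    rw [← inner_self_eq_zero (𝕜 := ℝ)]
    nth_rw 2 [h]
    simp only [inner_add_right, inner_smul_right, inner_sub_left, inner_smul_left, hx1, hx2, hx1',
      hx2']
    simp
  have hz := sub_eq_zero.1 hz
  have : |⟪u, u'⟫| = 1 := by
    have := congrArg norm hz
    rw [norm_smul, hu, hu'] at this
    simpa using this.symm
  rcases (abs_eq zero_le_one).1 this with h | h <;> rw [h] at hz
  · left; simpa using hz
  · right; simpa using hz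

end Linear

/-! ### The angle comparison at a matched facet and vertex -/

section Configuration

variable {P : Set E3}

/-- Otherwise the second edge overlaps the first, so each exposed segment contains the other and the
endpoints agree. -/
lemma inner_sub_lt_of_segment {v w w' n n' : E3} (hw : w ≠ w') (hv' : w' ≠ v)
    (hn : expo P n = segment ℝ v w) (hn' : expo P n' = segment ℝ v w') : ⟪n, w' - v⟫ < 0 := by
  have hvm : v ∈ expo P n := hn ▸ left_mem_segment ℝ v w
  have hvm' : v ∈ expo P n' := hn' ▸ left_mem_segment ℝ v w'
  have hwm : w ∈ expo P n := hn ▸ right_mem_segment ℝ v w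
  have hwm' : w' ∈ expo P n' := hn' ▸ right_mem_segment ℝ v w'
  have hlt : ⟪n, w'⟫ < ⟪n, v⟫ := by
    refine inner_lt_of_notMem_expo hvm hwm'.1 fun hmem => hw ?_
    rw [hn, segment_eq_image'] at hmem
    obtain ⟨θ, hθ, h⟩ := hmem
    have h : v + θ • (w - v) = w' := h
    have hθ0 : 0 < θ := by
      refine lt_of_le_of_ne hθ.1 ?_
      rintro rfl
      simp at h
      exact hv' h.symm
    have hwn' : w ∈ expo P n' := by
      refine mem_expo_of_inner_eq hvm' hwm.1 ?_
      have h1 := inner_eq_of_mem_expo hvm' hwm'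
      rw [← h, inner_add_right, inner_smul_right, inner_sub_right] at h1
      have : θ * (⟪n', w⟫ - ⟪n', v⟫) = 0 := by linarith
      rcases mul_eq_zero.1 this with h2 | h2 <;> linarith
    rw [hn', segment_eq_image'] at hwn'
    obtain ⟨τ, hτ, h'⟩ := hwn'
    have h' : v + τ • (w' - v) = w := h'
    have e1 : w - v = τ • (w' - v) := by rw [← h']; abel
    have e2 : w' - v = θ • (w - v) := by rw [← h]; abel
    rw [e1, smul_smul] at e2
    have e3 : (1 - θ * τ) • (w' - v) = 0 := by rw [sub_smul, ← e2, one_smul, sub_self]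
    rcases smul_eq_zero.1 e3 with e4 | e4
    · have : τ = 1 := by nlinarith [hθ.2, hτ.2, hτ.1]
      rw [this, one_smul] at e1
      exact sub_left_injective e1
    · exact absurd (sub_eq_zero.1 e4) hv'
  rw [inner_sub_right]
  linarith

/-- Minimum width is incompatible with a facet-vertex pair all of whose incident edges and facets
are antipodally matched. -/
theorem false_of_configuration (hK : IsCompact P) (hc : Convex ℝ P)
    {ι κ : Type*} [Fintype ι] [Fintype κ] (p q : ι → κ) (e₁ e₂ : κ → ι)
    (hpq : ∀ e, p e ≠ q e) (he : ∀ a, e₁ a ≠ e₂ a)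
    (hinc : ∀ φ : κ → ι → ℝ,
      ∑ a, (φ a (e₁ a) + φ a (e₂ a)) = ∑ e, (φ (p e) e + φ (q e) e))
    {v u : E3} (hu : ‖u‖ = 1) (hv : expo P u = {v}) (huw : width P u = minWidth P)
    {a U : κ → E3} (ha : Function.Injective a) (hau : ∀ i, a i ∈ expo P (-u))
    (hU : ∀ i, ‖U i‖ = 1) (haU : ∀ i, expo P (-(U i)) = {a i}) (hvU : ∀ i, v ∈ expo P (U i))
    (hUw : ∀ i, width P (U i) = minWidth P)
    {w n : ι → E3} (hw : Function.Injective w) (hwv : ∀ e, w e ≠ v) (hn : ∀ e, ‖n e‖ = 1)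
    (hnw : ∀ e, expo P (n e) = segment ℝ v (w e)) (hnp : ∀ e, a (p e) ∈ expo P (-(n e)))
    (hnq : ∀ e, a (q e) ∈ expo P (-(n e)))
    (hw₁ : ∀ i, w (e₁ i) ∈ expo P (U i)) (hw₂ : ∀ i, w (e₂ i) ∈ expo P (U i))
    (hwp : ∀ e, w e ∈ expo P (U (p e))) (hwq : ∀ e, w e ∈ expo P (U (q e)))
    (hlow : ∀ g : E3, (∀ i, ⟪g, a i - (v - minWidth P • u)⟫ ≠ 0) →
      ∃ e, ⟪g, a (p e) - (v - minWidth P • u)⟫ * ⟪g, a (q e) - (v - minWidth P • u)⟫ < 0) :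
    False := by
  set ω := minWidth P with hω
  have hvm : v ∈ expo P u := by rw [hv]; rfl
  have hvn : ∀ e, v ∈ expo P (n e) := fun e => hnw e ▸ left_mem_segment ℝ _ _
  have hwn : ∀ e, w e ∈ expo P (n e) := fun e => hnw e ▸ right_mem_segment ℝ _ _
  have haUm : ∀ i, a i ∈ expo P (-(U i)) := fun i => by rw [haU i]; rfl
  have hω0 : 0 ≤ ω := minWidth_nonneg hK ⟨v, hvm.1⟩
  have hne0 : ∀ e, ⟪n e, w e - v⟫ = 0 := fun e => by
    rw [inner_sub_right, inner_eq_of_mem_expo (hvn e) (hwn e), sub_self]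
  have hneg : ∀ e e', e ≠ e' → ⟪n e, w e' - v⟫ < 0 := fun e e' h =>
    inner_sub_lt_of_segment (hw.ne h) (hwv e') (hnw e) (hnw e')
  have hUle : ∀ i e, ⟪U i, w e - v⟫ ≤ 0 := fun i e => by
    rw [inner_sub_right, sub_nonpos]; exact (hvU i).2 _ (hwn e).1
  have hU0 : ∀ i e, w e ∈ expo P (U i) → ⟪U i, w e - v⟫ = 0 := fun i e h => by
    rw [inner_sub_right, inner_eq_of_mem_expo (hvU i) h, sub_self]
  have hUne : ∀ i, U i ≠ 0 := fun i h => by have := hU i; rw [h] at this; simp at this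
  have hwidth : ∀ i, ⟪U i, v - a i⟫ = ω := fun i => by
    rw [← hUw i]; exact (width_eq (hvU i) (haUm i)).symm
  have hwidthu : ∀ i, ⟪u, v - a i⟫ = ω := fun i => by
    rw [← huw]; exact (width_eq hvm (hau i)).symm
  have huU : ∀ i, U i ≠ u := by
    intro i h
    have h1 := hw₁ i
    rw [h, hv] at h1
    exact hwv _ h1
  -- The foot of `v` is not a vertex `a i`: otherwise `ω = 0`, or `U i` would equal `u`, whose
  -- exposed face is `{v}` alone.
  have ht : ∀ i, ω • u - (v - a i) ≠ 0 := by
    intro i h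
    have h1 := hwidth i
    rw [← sub_eq_zero.1 h, inner_smul_right] at h1
    have h2 : ω * (⟪U i, u⟫ - 1) = 0 := by linarith
    rcases mul_eq_zero.1 h2 with h3 | h3
    · have h4 : a i = v := by
        rw [h3, zero_smul] at h
        have := neg_eq_zero.1 (by simpa using h : -(v - a i) = 0)
        exact (sub_eq_zero.1 this).symm
      have h5 : w (e₁ i) ∈ expo P (-(U i)) := by
        refine mem_expo_of_inner_eq (haUm i) (hw₁ i).1 ?_
        rw [inner_neg_left, inner_neg_left, h4, inner_eq_of_mem_expo (hvU i) (hw₁ i)]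
      rw [haU i] at h5
      exact hwv _ (h5.trans h4)
    · have h4 : ⟪U i, u⟫ = 1 := by linarith
      exact huU i ((inner_eq_one_iff_of_norm_eq_one (hU i) hu).1 h4)
  have htau : ∀ i, ω • U i - (v - a i) ≠ 0 := by
    intro i h
    have h1 := hwidthu i
    -- Both are tangent segments from `v - a i` to the sphere of radius `ω`, hence equally long.
    have h2 : ‖ω • U i - (v - a i)‖ ^ 2 = ‖ω • u - (v - a i)‖ ^ 2 := by
      have h3 := hwidth i
      generalize v - a i = z at h1 h3 ⊢
      rw [@norm_sub_sq_real, @norm_sub_sq_real, norm_smul, norm_smul, hu, hU i, inner_smul_left,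
        inner_smul_left, h3, h1]
    rw [h, norm_zero] at h2
    have : ‖ω • u - (v - a i)‖ = 0 := by
      rw [zero_pow two_ne_zero] at h2
      exact pow_eq_zero_iff two_ne_zero |>.1 h2.symm
    exact ht i (norm_eq_zero.1 this)
  -- the contact points lie in the cones spanned by the edges
  have hcone : ∀ i, ang (ω • U i - (v - a i)) (w (e₁ i) - v) +
      ang (ω • U i - (v - a i)) (w (e₂ i) - v) = ang (w (e₁ i) - v) (w (e₂ i) - v) := by
    intro i
    have hcm : a i - ω • (-(U i)) ∈ expo P (U i) := by
      have := sub_smul_mem_expo_neg hK hc (u := -(U i)) (by rw [norm_neg, hU i]) (haU i)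
        (by rw [width_neg, hUw i])
      simpa using this
    have hz : ω • U i - (v - a i) = a i - ω • (-(U i)) - v := by rw [smul_neg]; abel
    have hz0 : ⟪U i, ω • U i - (v - a i)⟫ = 0 := by
      rw [hz, inner_sub_right, inner_eq_of_mem_expo (hvU i) hcm, sub_self]
    have hnz : ∀ e, ⟪n e, ω • U i - (v - a i)⟫ ≤ 0 := fun e => by
      rw [hz, inner_sub_right, sub_nonpos]
      exact (hvn e).2 _ hcm.1
    -- The foot of `a i` lies in its facet; the normals `n` of the two edges then make both
    -- coordinates nonnegative.
    obtain ⟨s, t, hst⟩ := exists_coord (hUne i) (hU0 i _ (hw₁ i)) (hU0 i _ (hw₂ i))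
      (hne0 (e₁ i)) (hneg _ _ (he i)) (hneg _ _ (he i).symm) (hne0 (e₂ i)) hz0
    have h1 := hnz (e₁ i)
    have h2 := hnz (e₂ i)
    rw [hst, inner_add_right, inner_smul_right, inner_smul_right, hne0] at h1 h2
    refine ang_add_of_cone (sub_ne_zero.2 (hwv _)) (sub_ne_zero.2 (hwv _)) (htau i) ?_ ?_ hst
    · have := hneg _ _ (he i).symm
      by_contra hs
      nlinarith [mul_pos_of_neg_of_neg (not_le.1 hs) this]
    · have := hneg _ _ (he i)
      by_contra hs
      nlinarith [mul_pos_of_neg_of_neg (not_le.1 hs) this]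
  have hle : ∀ e, ang (ω • u - (v - a (p e))) (ω • u - (v - a (q e))) ≤
      ang (ω • U (p e) - (v - a (p e))) (w e - v) +
        ang (ω • U (q e) - (v - a (q e))) (w e - v) := by
    intro e
    have hle : ω ≤ ⟪n e, v - a (p e)⟫ := by
      rw [← width_eq (hvn e) (hnp e)]
      exact minWidth_le hK ⟨v, hvm.1⟩ (hn e)
    refine ang_le_of_parallelogram (hn e) hu (hU _) (hU _) hω0 hle (hne0 e) rfl ?_ (hwidthu _)
      (hwidthu _) (hwidth _) (hwidth _) (hU0 _ _ (hwp e)) (hU0 _ _ (hwq e))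
      (sub_ne_zero.2 (hwv e)) ?_ (ht _) (ht _)
    · rw [← width_eq (hvn e) (hnp e), ← width_eq (hvn e) (hnq e)]
    · intro h
      exact hpq e (ha (sub_right_injective h))
  have hsum : ∑ e, ang (ω • u - (v - a (p e))) (ω • u - (v - a (q e))) ≤
      ∑ i, ang (w (e₁ i) - v) (w (e₂ i) - v) := by
    refine (Finset.sum_le_sum fun e _ => hle e).trans (le_of_eq ?_)
    rw [← hinc fun i e => ang (ω • U i - (v - a i)) (w e - v)]
    exact Finset.sum_congr rfl fun i _ => hcone i
  refine absurd hsum (not_le.2 ?_)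
  refine not_sum_ang_le p q e₁ e₂ (fun i => ω • u - (v - a i)) (fun e => w e - v) u ht ?_ ?_ ?_
  · intro e
    rw [inner_sub_right, sub_neg]
    refine inner_lt_of_notMem_expo hvm (hwn e).1 ?_
    rw [hv]
    exact hwv e
  · -- crossing number below
    intro g hg
    have heq : ∀ i, ω • u - (v - a i) = a i - (v - ω • u) := fun i => by abel
    simp only [heq] at hg ⊢
    obtain ⟨e, hlt⟩ := hlow g hg
    -- Indicator of the side of the plane. As every vertex occurs in two incidences, the number of
    -- separated edges is an even integer, so being positive it is at least two.
    set σ : κ → ℤ := fun i => if 0 < ⟪g, a i - (v - ω • u)⟫ then 1 else 0 with hσ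
    have hsep : ∀ e, sep (a (p e) - (v - ω • u)) (a (q e) - (v - ω • u)) g =
        (σ (p e) : ℝ) + σ (q e) - 2 * (σ (p e) * σ (q e)) := by
      intro e
      simp only [sep, hσ]
      rcases lt_or_gt_of_ne (hg (p e)) with h1 | h1 <;>
        rcases lt_or_gt_of_ne (hg (q e)) with h2 | h2 <;>
        simp [mul_neg_iff, h1, h2, h1.le, h2.le, not_lt.2] <;> norm_num
    have htot : ∑ e, sep (a (p e) - (v - ω • u)) (a (q e) - (v - ω • u)) g =
        ((2 * (∑ i, σ i - ∑ e, σ (p e) * σ (q e)) : ℤ) : ℝ) := by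
      have h1 := hinc fun i _ => (σ i : ℝ)
      simp only [hsep]
      rw [Finset.sum_sub_distrib, ← h1, ← Finset.mul_sum]
      push_cast
      rw [Finset.sum_add_distrib]
      ring
    have hpos : 0 < ∑ e, sep (a (p e) - (v - ω • u)) (a (q e) - (v - ω • u)) g := by
      refine Finset.sum_pos' (fun i _ => ?_) ⟨e, Finset.mem_univ e, ?_⟩
      · unfold sep; split_ifs <;> simp
      · rw [sep, if_pos hlt]; exact one_pos
    rw [htot] at hpos ⊢
    have hpos : 0 < 2 * (∑ i, σ i - ∑ e, σ (p e) * σ (q e)) := by exact_mod_cast hpos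
    have : 2 ≤ 2 * (∑ i, σ i - ∑ e, σ (p e) * σ (q e)) := by omega
    exact_mod_cast this
  · -- crossing number above
    intro g hg
    by_contra hcon
    simp only [sep, Finset.sum_boole, not_le] at hcon
    have hcard : 2 < (Finset.univ.filter fun i =>
        ⟪g, w (e₁ i) - v⟫ * ⟪g, w (e₂ i) - v⟫ < 0).card := by exact_mod_cast hcon
    obtain ⟨i, j, k, hi, hj, hk, hij, hik, hjk⟩ := Finset.two_lt_card_iff.1 hcard
    -- The point where the plane meets the cone of facet `i`; the weights make `g` vanish on it.
    -- Three such points in one plane contradict `false_of_three`.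
    set x : κ → E3 := fun i => |⟪g, w (e₂ i) - v⟫| • (w (e₁ i) - v) +
      |⟪g, w (e₁ i) - v⟫| • (w (e₂ i) - v) with hx
    have hxg : ∀ i, ⟪g, w (e₁ i) - v⟫ * ⟪g, w (e₂ i) - v⟫ < 0 → ⟪g, x i⟫ = 0 := by
      intro i hi
      simp only [hx, inner_add_right, inner_smul_right]
      rcases mul_neg_iff.1 hi with ⟨h1, h2⟩ | ⟨h1, h2⟩
      · rw [abs_of_pos h1, abs_of_neg h2]; ring
      · rw [abs_of_neg h1, abs_of_pos h2]; ring
    have hxU : ∀ i, ⟪U i, x i⟫ = 0 := by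
      intro i
      simp only [hx, inner_add_right, inner_smul_right, hU0 i _ (hw₁ i), hU0 i _ (hw₂ i)]
      simp
    have hxUneg : ∀ i j, i ≠ j → ⟪g, w (e₁ j) - v⟫ * ⟪g, w (e₂ j) - v⟫ < 0 →
        ⟪U i, x j⟫ < 0 := by
      intro i j hij hj
      have p1 : 0 < |⟪g, w (e₁ j) - v⟫| := abs_pos.2 (left_ne_zero_of_mul hj.ne)
      have p2 : 0 < |⟪g, w (e₂ j) - v⟫| := abs_pos.2 (right_ne_zero_of_mul hj.ne)
      have h1 := hUle i (e₁ j)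
      have h2 := hUle i (e₂ j)
      simp only [hx, inner_add_right, inner_smul_right]
      by_contra hcon
      have z1 : ⟪U i, w (e₁ j) - v⟫ = 0 := by nlinarith [mul_nonpos_of_nonneg_of_nonpos p1.le h2]
      have z2 : ⟪U i, w (e₂ j) - v⟫ = 0 := by nlinarith [mul_nonpos_of_nonneg_of_nonpos p2.le h1]
      -- Two facets sharing both edge directions would have equal or opposite normals, contrary to
      -- the distinctness of the `a i` or to `w (e₁ i) ≠ v`.
      rcases eq_or_eq_neg_of_orthogonal (hU j) (hU i) (hU0 j _ (hw₁ j)) (hU0 j _ (hw₂ j)) z1 z2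
        (hne0 (e₁ j)) (hneg _ _ (he j)) (hneg _ _ (he j).symm) (hne0 (e₂ j)) with h | h
      · have h3 := haU i
        rw [h, haU j] at h3
        exact hij (ha (singleton_injective h3)).symm
      · have h3 := hvU i
        have h4 : w (e₁ i) ∈ _ := hw₁ i
        rw [h, haU j] at h3 h4
        exact hwv _ (h4.trans h3.symm)
    simp only [Finset.mem_filter, Finset.mem_univ, true_and] at hi hj hk
    exact false_of_three hg (hxg i hi) (hxg j hj) (hxg k hk) (hxU i) (hxUneg i j hij hj)
      (hxUneg i k hik hk) (hxUneg j i hij.symm hi) (hxU j) (hxUneg j k hjk hk)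
      (hxUneg k i hik.symm hi) (hxUneg k j hjk.symm hj) (hxU k)

end Configuration

/-! ### Dimension of faces -/

section Dimension

variable {P A B F : Set E3} {u w x y z ν : E3}

lemma affDim_eq (A : Set E3) : affDim A = Module.finrank ℝ (vectorSpan ℝ A) := by
  rw [affDim, direction_affineSpan]

lemma vectorSpan_le_orthogonal (h : ∀ x ∈ A, ∀ y ∈ A, ⟪w, x⟫ = ⟪w, y⟫) :
    vectorSpan ℝ A ≤ (ℝ ∙ w)ᗮ := by
  rw [vectorSpan_def, Submodule.span_le]
  rintro _ ⟨x, hx, y, hy, rfl⟩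
  rw [SetLike.mem_coe, Submodule.mem_orthogonal_singleton_iff_inner_right]
  simp [inner_sub_right, h x hx y hy]

lemma expo_const : ∀ x ∈ expo P u, ∀ y ∈ expo P u, ⟪u, x⟫ = ⟪u, y⟫ :=
  fun _ hx _ hy => inner_eq_of_mem_expo hy hx

lemma affDim_le_two (hw : w ≠ 0) (h : ∀ x ∈ A, ∀ y ∈ A, ⟪w, x⟫ = ⟪w, y⟫) : affDim A ≤ 2 := by
  have h1 := Submodule.finrank_mono (vectorSpan_le_orthogonal h)
  have : Fact (Module.finrank ℝ E3 = 2 + 1) := ⟨by simp⟩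
  rw [Submodule.finrank_orthogonal_span_singleton (n := 2) hw] at h1
  rwa [affDim_eq]

/-- The directions of a two-dimensional set fill the orthogonal plane of `ν`, whose orthogonal
complement is the line of `ν`. -/
lemma exists_eq_smul_of_const (hF : affDim F = 2) (hν : ν ≠ 0)
    (h : ∀ x ∈ F, ∀ y ∈ F, ⟪ν, x⟫ = ⟪ν, y⟫) (h' : ∀ x ∈ F, ∀ y ∈ F, ⟪w, x⟫ = ⟪w, y⟫) :
    ∃ c : ℝ, w = c • ν := by
  have : Fact (Module.finrank ℝ E3 = 2 + 1) := ⟨by simp⟩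
  have heq : vectorSpan ℝ F = (ℝ ∙ ν)ᗮ := by
    refine Submodule.eq_of_le_of_finrank_eq (vectorSpan_le_orthogonal h) ?_
    rw [Submodule.finrank_orthogonal_span_singleton (n := 2) hν, ← affDim_eq, hF]
  have hle := vectorSpan_le_orthogonal h'
  rw [heq] at hle
  have hle := Submodule.orthogonal_le hle
  rw [Submodule.orthogonal_orthogonal, Submodule.orthogonal_orthogonal] at hle
  obtain ⟨c, hc⟩ := Submodule.mem_span_singleton.1 (hle (Submodule.mem_span_singleton_self w))
  exact ⟨c, hc.symm⟩

lemma exists_orthogonal_pair (u w : E3) : ∃ h : E3, h ≠ 0 ∧ ⟪h, u⟫ = 0 ∧ ⟪h, w⟫ = 0 := by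
  have h1 : Module.finrank ℝ (Submodule.span ℝ ({u, w} : Set E3)) ≤ 2 := by
    have := finrank_span_le_card (R := ℝ) ({u, w} : Set E3)
    refine this.trans ?_
    rw [toFinset_card]
    simpa using Finset.card_le_two (a := u) (b := w)
  have h2 := Submodule.finrank_add_finrank_orthogonal (Submodule.span ℝ ({u, w} : Set E3))
  have h3 : Module.finrank ℝ E3 = 3 := by simp
  have h4 : (Submodule.span ℝ ({u, w} : Set E3))ᗮ ≠ ⊥ := by
    intro h
    rw [h, finrank_bot] at h2
    omega
  obtain ⟨h, hm, h0⟩ := Submodule.exists_mem_ne_zero_of_ne_bot h4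
  rw [Submodule.mem_orthogonal'] at hm
  exact ⟨h, h0, hm u (Submodule.subset_span (by simp)), hm w (Submodule.subset_span (by simp))⟩

lemma affDim_eq_one (hν : ν ≠ 0) (hνA : ∀ x ∈ A, ∀ y ∈ A, ⟪ν, x⟫ = ⟪ν, y⟫)
    (hwA : ∀ x ∈ A, ∀ y ∈ A, ⟪w, x⟫ = ⟪w, y⟫) (hw : ∀ c : ℝ, w ≠ c • ν)
    (hx : x ∈ A) (hy : y ∈ A) (hxy : x ≠ y) : affDim A = 1 := by
  apply le_antisymm
  · have h2 := affDim_le_two hν hνA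
    by_contra hcon
    obtain ⟨c, hc⟩ := exists_eq_smul_of_const (by omega) hν hνA hwA
    exact hw c hc
  · rw [affDim_eq, Nat.one_le_iff_ne_zero, ← pos_iff_ne_zero, Module.finrank_pos_iff_exists_ne_zero]
    exact ⟨⟨x - y, vsub_mem_vectorSpan ℝ hx hy⟩, by simpa [sub_eq_zero] using hxy⟩

/-- With equal dimensions the two direction spaces would coincide, so `⟪u, ·⟫` would be constant on
`B`. -/
lemma affDim_lt (hx : x ∈ expo P u) (hAB : expo P u ⊆ B) (hBP : B ⊆ P) (hne : ¬ B ⊆ expo P u) :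
    affDim (expo P u) < affDim B := by
  obtain ⟨b, hb, hbu⟩ := not_subset.1 hne
  have hle := vectorSpan_mono ℝ hAB
  rw [affDim_eq, affDim_eq]
  refine lt_of_le_of_ne (Submodule.finrank_mono hle) fun heq => ?_
  have heq := Submodule.eq_of_le_of_finrank_eq hle heq
  have hm : b - x ∈ vectorSpan ℝ B := vsub_mem_vectorSpan ℝ hb (hAB hx)
  rw [← heq] at hm
  have := vectorSpan_le_orthogonal expo_const hm
  rw [Submodule.mem_orthogonal_singleton_iff_inner_right, inner_sub_right] at this
  exact hbu (mem_expo_of_inner_eq hx (hBP hb) (by linarith))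

lemma affDim_singleton (x : E3) : affDim ({x} : Set E3) = 0 := by
  rw [affDim_eq, vectorSpan_singleton, finrank_bot]

lemma exists_ne_of_affDim (h : affDim A ≠ 0) (x : E3) : ∃ y ∈ A, y ≠ x := by
  by_contra hcon
  push Not at hcon
  apply h
  rcases A.eq_empty_or_nonempty with rfl | ⟨z, hz⟩
  · simp [affDim_eq]
  · have : A = {z} := by
      ext y
      simp only [mem_singleton_iff]
      exact ⟨fun hy => (hcon y hy).trans (hcon z hz).symm, fun hy => hy ▸ hz⟩
    rw [this, affDim_singleton]

lemma eq_or_eq_of_mem_segment (hz : expo P u = {z}) (hx : x ∈ P) (hy : y ∈ P)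
    (h : z ∈ segment ℝ x y) : z = x ∨ z = y := by
  have hzm : z ∈ expo P u := by rw [hz]; rfl
  by_contra hcon
  push Not at hcon
  have h1 := inner_lt_of_notMem_expo hzm hx (by rw [hz]; exact fun e => hcon.1 e.symm)
  have h2 := inner_lt_of_notMem_expo hzm hy (by rw [hz]; exact fun e => hcon.2 e.symm)
  obtain ⟨s, t, hs, ht, hst, rfl⟩ := h
  rw [inner_add_right, inner_smul_right, inner_smul_right] at h1 h2
  obtain rfl : s = 1 - t := by linarith
  have h3 : ⟪u, y⟫ ≤ ⟪u, x⟫ := by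
    by_contra h
    nlinarith
  nlinarith

/-- One-dimensional faces are segments between vertices. -/
lemma exists_eq_segment {S : Set E3} (hS : S.Finite) (h1 : affDim (expo (convexHull ℝ S) u) = 1) :
    ∃ x ∈ S, ∃ y ∈ S, x ≠ y ∧ expo (convexHull ℝ S) u = segment ℝ x y := by
  set E := expo (convexHull ℝ S) u with hE
  have hEc : E = convexHull ℝ (S ∩ E) := expo_convexHull
  have hne : (S ∩ E).Nonempty := by
    by_contra h
    rw [not_nonempty_iff_eq_empty] at h
    rw [h, convexHull_empty] at hEc
    rw [hEc, affDim_eq, vectorSpan_empty, finrank_bot] at h1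
    exact zero_ne_one h1
  rw [affDim_eq] at h1
  obtain ⟨⟨δ, hδ⟩, hδ0, hspan⟩ := finrank_eq_one_iff'.1 h1
  have hδ0 : δ ≠ 0 := fun h => hδ0 (by simpa using h)
  have hδδ : 0 < ⟪δ, δ⟫ := real_inner_self_pos.2 hδ0
  have hfin : (S ∩ E).Finite := hS.subset inter_subset_left
  obtain ⟨x, hx, hxmax⟩ := exists_max_image (S ∩ E) (fun z => ⟪δ, z⟫) hfin hne
  obtain ⟨y, hy, hymin⟩ := exists_min_image (S ∩ E) (fun z => ⟪δ, z⟫) hfin hne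
  have hc : ∀ z ∈ S ∩ E, ∃ c : ℝ, c • δ = z - y := by
    intro z hz
    obtain ⟨c, hc⟩ := hspan ⟨z - y, vsub_mem_vectorSpan ℝ hz.2 hy.2⟩
    exact ⟨c, congrArg Subtype.val hc⟩
  have hval : ∀ z c, c • δ = z - y → ⟪δ, z⟫ - ⟪δ, y⟫ = c * ⟪δ, δ⟫ := by
    intro z c h
    rw [← inner_sub_right, ← h, inner_smul_right]
  obtain ⟨c, hcx⟩ := hc x hx
  have hcv := hval x c hcx
  have hsub : S ∩ E ⊆ segment ℝ x y := by
    intro z hz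
    obtain ⟨b, hb⟩ := hc z hz
    have hbv := hval z b hb
    have l1 := hxmax z hz
    have l2 := hymin z hz
    have hb0 : 0 ≤ b := by by_contra h; nlinarith
    have hbc : b ≤ c := by by_contra h; nlinarith
    rcases eq_or_lt_of_le (hb0.trans hbc) with h0 | h0
    · have : b = 0 := by linarith
      rw [this, zero_smul] at hb
      rw [sub_eq_zero.1 hb.symm]
      exact right_mem_segment ℝ _ _
    · rw [segment_symm, segment_eq_image']
      refine ⟨b / c, ⟨by positivity, by rw [div_le_one h0]; exact hbc⟩, ?_⟩
      show y + (b / c) • (x - y) = z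
      rw [← hcx, smul_smul, div_mul_cancel₀ _ h0.ne', hb]
      abel
  have hEseg : E = segment ℝ x y := by
    apply Subset.antisymm
    · rw [hEc]
      exact convexHull_min hsub (convex_segment x y)
    · rw [hEc, ← convexHull_pair]
      exact convexHull_mono (pair_subset hx hy)
  refine ⟨x, hx.1, y, hy.1, ?_, hEseg⟩
  rintro rfl
  rw [hEseg, segment_same, ← affDim_eq, affDim_singleton] at h1
  exact zero_ne_one h1

/-- A finite family of maximizers along a continuous path of functionals. -/
lemma exists_tie {S : Set E3} (hS : S.Finite) (hne : S.Nonempty) {u : ℝ → E3} (hu : Continuous u)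
    (A B : E3 → Prop) (hAB : ∀ s ∈ S, A s ∨ B s)
    (h0 : ∃ a ∈ S, A a ∧ ∀ s ∈ S, ⟪u 0, s⟫ ≤ ⟪u 0, a⟫)
    (h1 : ∃ b ∈ S, B b ∧ ∀ s ∈ S, ⟪u 1, s⟫ ≤ ⟪u 1, b⟫) :
    ∃ t ∈ Icc (0 : ℝ) 1, (∃ a ∈ S, A a ∧ ∀ s ∈ S, ⟪u t, s⟫ ≤ ⟪u t, a⟫) ∧
      ∃ b ∈ S, B b ∧ ∀ s ∈ S, ⟪u t, s⟫ ≤ ⟪u t, b⟫ := by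
  have hclosed : ∀ C : E3 → Prop,
      IsClosed {t : ℝ | ∃ a ∈ S, C a ∧ ∀ s ∈ S, ⟪u t, s⟫ ≤ ⟪u t, a⟫} := by
    intro C
    have : {t : ℝ | ∃ a ∈ S, C a ∧ ∀ s ∈ S, ⟪u t, s⟫ ≤ ⟪u t, a⟫} =
        ⋃ a ∈ {a | a ∈ S ∧ C a}, ⋂ s ∈ S, {t : ℝ | ⟪u t, s⟫ ≤ ⟪u t, a⟫} := by
      ext t
      simp [and_assoc]
    rw [this]
    refine (hS.subset fun a ha => ha.1).isClosed_biUnion fun a _ => ?_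
    exact isClosed_biInter fun s _ => isClosed_le (by fun_prop) (by fun_prop)
  -- The parameters with a maximizer of either kind form closed sets covering `[0, 1]`, both
  -- nonempty; connectedness makes them meet.
  have hpre := (isPreconnected_closed_iff.1 (isPreconnected_Icc (a := (0 : ℝ)) (b := 1))) _ _
    (hclosed A) (hclosed B) ?_ ⟨0, by simp, h0⟩ ⟨1, by simp, h1⟩
  · obtain ⟨t, ht, h⟩ := hpre
    exact ⟨t, ht, h.1, h.2⟩
  · intro t _
    obtain ⟨a, ha, hmax⟩ := exists_max_image S (fun z => ⟪u t, z⟫) hS hne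
    rcases hAB a ha with h | h
    · exact Or.inl ⟨a, ha, h, hmax⟩
    · exact Or.inr ⟨a, ha, h, hmax⟩

end Dimension

/-! ### Edges of a facet -/

section Facet

variable {S P F e : Set E3} {u ν g x y z c : E3}

lemma isVertex_of_expo (hK : IsCompact P) (h : expo P u = {x}) (hy : y ∈ P) (hyx : y ≠ x) :
    IsVertex P x := by
  refine (isFace_iff hK).2 ⟨u, ?_, h⟩
  rintro rfl
  have : y ∈ expo P 0 := ⟨hy, fun z _ => by simp⟩
  rw [h] at this
  exact hyx this

lemma IsVertex.exists_expo (hK : IsCompact P) (h : IsVertex P x) : ∃ u, u ≠ 0 ∧ expo P u = {x} :=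
  (isFace_iff hK).1 h

lemma IsVertex.mem (hS : S.Finite) (h : IsVertex (convexHull ℝ S) x) : x ∈ S := by
  obtain ⟨u, -, hu⟩ := h.exists_expo (hS.isCompact_convexHull ℝ)
  exact mem_of_expo_eq_singleton hu

lemma IsFacet.exists_expo (hK : IsCompact P) (h : IsFacet P F) :
    ∃ u : E3, ‖u‖ = 1 ∧ expo P u = F ∧ affDim F = 2 := by
  obtain ⟨u, hu0, hu⟩ := (isFace_iff hK).1 h.1
  refine ⟨‖u‖⁻¹ • u, norm_smul_inv_norm hu0, ?_, by have := h.2; omega⟩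
  rw [expo_smul (inv_pos.2 (norm_pos_iff.2 hu0)), hu]

/-- The endpoints of an edge of a polytope. -/
lemma IsEdge.exists_segment (hS : S.Finite) (hvert : ∀ s ∈ S, ∃ u, expo (convexHull ℝ S) u = {s})
    (h : IsEdge (convexHull ℝ S) e) :
    ∃ x y, x ≠ y ∧ IsVertex (convexHull ℝ S) x ∧ IsVertex (convexHull ℝ S) y ∧
      e = segment ℝ x y := by
  have hK := hS.isCompact_convexHull ℝ
  obtain ⟨⟨u, hu0, rfl⟩, h1⟩ := And.imp_left (isFace_iff hK).1 h
  obtain ⟨x, hx, y, hy, hxy, heq⟩ := exists_eq_segment hS h1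
  obtain ⟨a, ha⟩ := hvert x hx
  obtain ⟨b, hb⟩ := hvert y hy
  exact ⟨x, y, hxy, isVertex_of_expo hK ha (subset_convexHull ℝ S hy) hxy.symm,
    isVertex_of_expo hK hb (subset_convexHull ℝ S hx) hxy, heq⟩

lemma IsVertex.eq_or_eq (hK : IsCompact P) (h : IsVertex P z) (hx : x ∈ P) (hy : y ∈ P)
    (hz : z ∈ segment ℝ x y) : z = x ∨ z = y := by
  obtain ⟨u, -, hu⟩ := h.exists_expo hK
  exact eq_or_eq_of_mem_segment hu hx hy hz

/-- The other endpoint of an edge at a given vertex. -/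
lemma IsEdge.exists_segment_left (hS : S.Finite)
    (hvert : ∀ s ∈ S, ∃ u, expo (convexHull ℝ S) u = {s})
    (h : IsEdge (convexHull ℝ S) e) (hx : IsVertex (convexHull ℝ S) x) (hxe : x ∈ e) :
    ∃ y, y ≠ x ∧ IsVertex (convexHull ℝ S) y ∧ e = segment ℝ x y := by
  have hK := hS.isCompact_convexHull ℝ
  obtain ⟨a, b, hab, ha, hb, rfl⟩ := h.exists_segment hS hvert
  rcases hx.eq_or_eq hK (subset_convexHull ℝ S (ha.mem hS)) (subset_convexHull ℝ S (hb.mem hS)) hxe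
    with rfl | rfl
  · exact ⟨b, hab.symm, hb, rfl⟩
  · exact ⟨a, hab, ha, segment_symm ℝ _ _⟩

/-- The maximizers of a functional on a facet form an edge as soon as there are two of them and the
functional is not a multiple of the normal. -/
lemma isEdge_expo_expo (hS : S.Finite) (hν : ν ≠ 0)
    (hu : ∀ c : ℝ, u ≠ c • ν) (hx : x ∈ expo (expo (convexHull ℝ S) ν) u)
    (hy : y ∈ expo (expo (convexHull ℝ S) ν) u) (hxy : x ≠ y) :
    IsEdge (convexHull ℝ S) (expo (expo (convexHull ℝ S) ν) u) := by
  have hK := hS.isCompact_convexHull ℝ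
  have hne : S.Nonempty := convexHull_nonempty_iff.1 ⟨x, hx.1.1⟩
  refine ⟨?_, affDim_eq_one hν (fun a ha b hb => expo_const a ha.1 b hb.1) expo_const hu hx hy hxy⟩
  obtain ⟨ε, hε, h⟩ := exists_expo_expo hS hne ν u
  refine (isFace_iff hK).2 ⟨_, fun h0 => hu (-ε⁻¹) ?_, h⟩
  rw [add_eq_zero_iff_eq_neg] at h0
  rw [h0, smul_neg, neg_smul, neg_neg, smul_smul, inv_mul_cancel₀ hε.ne', one_smul]

lemma mem_expo_face_iff : x ∈ expo (expo (convexHull ℝ S) ν) u ↔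
    x ∈ expo (convexHull ℝ S) ν ∧ ∀ s ∈ S ∩ expo (convexHull ℝ S) ν, ⟪u, s⟫ ≤ ⟪u, x⟫ := by
  constructor
  · exact fun h => ⟨h.1, fun s hs => h.2 s hs.2⟩
  · refine fun h => ⟨h.1, fun y hy => ?_⟩
    rw [expo_convexHull] at hy
    exact inner_le_of_mem_convexHull h.2 hy

lemma const_face_of_const {k : ℝ}
    (h : ∀ s ∈ S ∩ expo (convexHull ℝ S) ν, ⟪u, s⟫ = k) :
    ∀ y ∈ expo (convexHull ℝ S) ν, ⟪u, y⟫ = k := by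
  intro y hy
  rw [expo_convexHull] at hy
  refine le_antisymm (inner_le_of_mem_convexHull (fun s hs => (h s hs).le) hy) ?_
  have := inner_le_of_mem_convexHull (u := -u) (c := -k)
    (fun s hs => by rw [inner_neg_left, h s hs]) hy
  rw [inner_neg_left] at this
  linarith

/-- A vertex of a facet lies on two edges of the facet. -/
lemma exists_two_edges (hS : S.Finite) (hν : ν ≠ 0)
    (hF : affDim (expo (convexHull ℝ S) ν) = 2) (hx : IsVertex (convexHull ℝ S) x)
    (hxF : x ∈ expo (convexHull ℝ S) ν) :
    ∃ e₁ e₂, e₁ ≠ e₂ ∧ (IsEdge (convexHull ℝ S) e₁ ∧ e₁ ⊆ expo (convexHull ℝ S) ν) ∧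
      (IsEdge (convexHull ℝ S) e₂ ∧ e₂ ⊆ expo (convexHull ℝ S) ν) ∧ x ∈ e₁ ∧ x ∈ e₂ := by
  have hK := hS.isCompact_convexHull ℝ
  obtain ⟨g, -, hg⟩ := hx.exists_expo hK
  have hgx : x ∈ expo (convexHull ℝ S) g := by rw [hg]; rfl
  obtain ⟨h, h0, hhν, hhg⟩ := exists_orthogonal_pair ν g
  set T := (S ∩ expo (convexHull ℝ S) ν) \ {x} with hT
  have hTfin : T.Finite := (hS.subset inter_subset_left).subset sdiff_subset
  have hTg : ∀ y ∈ T, 0 < ⟪g, x - y⟫ := by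
    intro y hy
    rw [inner_sub_right, sub_pos]
    refine inner_lt_of_notMem_expo hgx hy.1.2.1 ?_
    rw [hg]
    exact hy.2
  have hTne : T.Nonempty := by
    by_contra hcon
    rw [not_nonempty_iff_eq_empty, hT, sdiff_eq_empty] at hcon
    have hle : expo (convexHull ℝ S) ν ⊆ {x} := by
      rw [expo_convexHull]
      exact convexHull_min hcon (convex_singleton x)
    obtain ⟨y, hy, hyx⟩ := exists_ne_of_affDim (by rw [hF]; norm_num) x
    exact hyx (hle hy)
  have hnot : ∀ l k : ℝ, h + l • g ≠ k • ν := by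
    intro l k heq
    have := congrArg (fun z => ⟪h, z⟫) heq
    simp only [inner_add_right, inner_smul_right, hhν, hhg, mul_zero, add_zero] at this
    exact h0 (inner_self_eq_zero.1 this)
  -- Within the plane of the facet, the functional `h + l • g` rotates about `x` as `l` varies. The
  -- extreme slopes `r` are where its level line first supports the facet along an edge.
  set r : E3 → ℝ := fun y => ⟪h, y - x⟫ / ⟪g, x - y⟫ with hr
  have hval : ∀ l, ∀ y, ⟪h + l • g, y⟫ - ⟪h + l • g, x⟫ = ⟪h, y - x⟫ - l * ⟪g, x - y⟫ := by
    intro l y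
    simp only [inner_add_left, inner_smul_left, RCLike.conj_to_real, inner_sub_right]
    ring
  have hrv : ∀ y ∈ T, ⟪h, y - x⟫ = r y * ⟪g, x - y⟫ := fun y hy =>
    (div_mul_cancel₀ _ (hTg y hy).ne').symm
  obtain ⟨y₁, hy₁, hmax⟩ := exists_max_image T r hTfin hTne
  obtain ⟨y₂, hy₂, hmin⟩ := exists_min_image T r hTfin hTne
  have hx1 : x ∈ expo (expo (convexHull ℝ S) ν) (h + r y₁ • g) := by
    refine mem_expo_face_iff.2 ⟨hxF, fun s hs => ?_⟩
    rcases eq_or_ne s x with rfl | hsx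
    · exact le_rfl
    have := hval (r y₁) s
    rw [hrv s ⟨hs, hsx⟩] at this
    nlinarith [hmax s ⟨hs, hsx⟩, hTg s ⟨hs, hsx⟩]
  have hx2 : x ∈ expo (expo (convexHull ℝ S) ν) (-(h + r y₂ • g)) := by
    refine mem_expo_face_iff.2 ⟨hxF, fun s hs => ?_⟩
    rcases eq_or_ne s x with rfl | hsx
    · exact le_rfl
    have := hval (r y₂) s
    rw [hrv s ⟨hs, hsx⟩] at this
    rw [inner_neg_left, inner_neg_left]
    nlinarith [hmin s ⟨hs, hsx⟩, hTg s ⟨hs, hsx⟩]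
  have hy1 : y₁ ∈ expo (expo (convexHull ℝ S) ν) (h + r y₁ • g) := by
    refine mem_expo_of_inner_eq hx1 hy₁.1.2 ?_
    have := hval (r y₁) y₁
    rw [hrv y₁ hy₁] at this
    linarith
  have hy2 : y₂ ∈ expo (expo (convexHull ℝ S) ν) (-(h + r y₂ • g)) := by
    refine mem_expo_of_inner_eq hx2 hy₂.1.2 ?_
    have := hval (r y₂) y₂
    rw [hrv y₂ hy₂] at this
    rw [inner_neg_left, inner_neg_left]
    linarith
  refine ⟨_, _, ?_, ⟨isEdge_expo_expo hS hν (hnot _) hx1 hy1 (Ne.symm hy₁.2), expo_subset⟩,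
    ⟨isEdge_expo_expo hS hν ?_ hx2 hy2 (Ne.symm hy₂.2), expo_subset⟩, hx1, hx2⟩
  · intro heq
    have hy2' := hy2
    rw [← heq] at hy2'
    have h1 := inner_eq_of_mem_expo hx1 hy2'
    have h2 := hval (r y₁) y₂
    rw [hrv y₂ hy₂, h1] at h2
    -- If both extreme edges agreed, all slopes would be equal and the functional would be constant
    -- on the facet, hence a multiple of `ν`.
    have h3 : r y₂ = r y₁ := by
      have : (r y₂ - r y₁) * ⟪g, x - y₂⟫ = 0 := by linarith
      rcases mul_eq_zero.1 this with h | h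
      · linarith
      · exact absurd h (hTg y₂ hy₂).ne'
    have hconst := const_face_of_const (S := S) (ν := ν) (u := h + r y₁ • g)
      (k := ⟪h + r y₁ • g, x⟫) (fun s hs => by
        rcases eq_or_ne s x with rfl | hsx
        · rfl
        have h4 := hmax s ⟨hs, hsx⟩
        have h5 := hmin s ⟨hs, hsx⟩
        have h6 := hval (r y₁) s
        rw [hrv s ⟨hs, hsx⟩, show r s = r y₁ by linarith] at h6
        linarith)
    obtain ⟨k, hk⟩ := exists_eq_smul_of_const hF hν expo_const
      (fun a ha b hb => (hconst a ha).trans (hconst b hb).symm)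
    exact hnot _ _ hk
  · intro k hk
    refine hnot (r y₂) (-k) ?_
    rw [neg_smul, ← hk, neg_neg]

/-- A plane through a point of a facet that misses the vertices crosses an edge of the facet. -/
lemma exists_crossing_edge (hS : S.Finite) (hvert : ∀ s ∈ S, ∃ u, expo (convexHull ℝ S) u = {s})
    (hν : ν ≠ 0) (hF : affDim (expo (convexHull ℝ S) ν) = 2) (hc : c ∈ expo (convexHull ℝ S) ν)
    (hg : ∀ x ∈ expo (convexHull ℝ S) ν, IsVertex (convexHull ℝ S) x → ⟪g, x - c⟫ ≠ 0) :
    ∃ e, IsEdge (convexHull ℝ S) e ∧ e ⊆ expo (convexHull ℝ S) ν ∧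
      (∃ x ∈ e, 0 < ⟪g, x - c⟫) ∧ ∃ y ∈ e, ⟪g, y - c⟫ < 0 := by
  have hK := hS.isCompact_convexHull ℝ
  set F := expo (convexHull ℝ S) ν with hFdef
  have hFc : F = convexHull ℝ (S ∩ F) := expo_convexHull
  have hfin : (S ∩ F).Finite := hS.subset inter_subset_left
  have hne : (S ∩ F).Nonempty := by
    rw [← convexHull_nonempty_iff (𝕜 := ℝ), ← hFc]
    exact ⟨c, hc⟩
  have hgS : ∀ s ∈ S ∩ F, ⟪g, s - c⟫ ≠ 0 := by
    intro s hs
    obtain ⟨u, hu⟩ := hvert s hs.1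
    obtain ⟨y, hy, hyx⟩ := exists_ne_of_affDim (by rw [hF]; norm_num) s
    exact hg s hs.2 (isVertex_of_expo hK hu hy.1 hyx)
  obtain ⟨h, h0, hhν, hhg⟩ := exists_orthogonal_pair ν g
  -- A path from `g` to `-g` turning through `h`, so that no functional with two maximizers
  -- separated by `g` is a multiple of `ν`. The maximizer passes from the positive to the negative
  -- side, and a tie yields the crossing edge.
  set u : ℝ → E3 := fun t => (1 - 2 * t) • g + (t * (1 - t)) • h with hu
  have hcF : c ∈ convexHull ℝ (S ∩ F) := hFc ▸ hc
  obtain ⟨t, ht, ⟨a, ha, hag, hamax⟩, b, hb, hbg, hbmax⟩ := exists_tie hfin hne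
    (u := u) (by fun_prop) (fun s => 0 < ⟪g, s - c⟫) (fun s => ⟪g, s - c⟫ < 0)
    (fun s hs => (lt_or_gt_of_ne (hgS s hs)).symm) (by
      obtain ⟨a, ha, hmax⟩ := exists_max_image (S ∩ F) (fun z => ⟪g, z⟫) hfin hne
      refine ⟨a, ha, lt_of_le_of_ne ?_ (hgS a ha).symm, fun s hs => ?_⟩
      · rw [inner_sub_right, sub_nonneg]
        exact inner_le_of_mem_convexHull hmax hcF
      · simpa [hu] using hmax s hs) (by
      obtain ⟨a, ha, hmin⟩ := exists_min_image (S ∩ F) (fun z => ⟪g, z⟫) hfin hne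
      refine ⟨a, ha, lt_of_le_of_ne ?_ (hgS a ha), fun s hs => ?_⟩
      · rw [inner_sub_right, sub_nonpos]
        have := inner_le_of_mem_convexHull (u := -g) (c := -⟪g, a⟫)
          (fun s hs => by rw [inner_neg_left]; exact neg_le_neg (hmin s hs)) hcF
        rw [inner_neg_left] at this
        linarith
      · have e1 : u 1 = -g := by
          simp only [hu]
          norm_num
        rw [e1, inner_neg_left, inner_neg_left]
        exact neg_le_neg (hmin s hs))
  have hau : a ∈ expo F (u t) := mem_expo_face_iff.2 ⟨ha.2, hamax⟩
  have hbu : b ∈ expo F (u t) := mem_expo_face_iff.2 ⟨hb.2, hbmax⟩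
  refine ⟨expo F (u t), isEdge_expo_expo hS hν ?_ hau hbu ?_, expo_subset, ⟨a, hau, hag⟩,
    b, hbu, hbg⟩
  · intro k hk
    have h1 := congrArg (fun z => ⟪h, z⟫) hk
    simp only [hu, inner_add_right, inner_smul_right, hhν, hhg, mul_zero, zero_add] at h1
    have h2 : t * (1 - t) = 0 := by
      rcases mul_eq_zero.1 h1 with h2 | h2
      · exact h2
      · exact absurd (inner_self_eq_zero.1 h2) h0
    have h3 := congrArg (fun z => ⟪z, a⟫ - ⟪z, b⟫) hk
    simp only [hu, h2, zero_smul, add_zero, inner_smul_left, RCLike.conj_to_real] at h3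
    rw [← mul_sub, ← mul_sub, expo_const a ha.2 b hb.2, sub_self, mul_zero] at h3
    rw [inner_sub_right] at hag hbg
    rcases mul_eq_zero.1 h3 with h4 | h4
    · nlinarith
    · linarith
  · rintro rfl
    linarith

end Facet

/-! ### Vertex–edge incidence of a facet -/

section Incidence

variable {S P F e : Set E3} {u ν g x y z c : E3}

/-- The vertices of `P` that lie in `F`. -/
abbrev FaceVertex (P F : Set E3) : Type := {x : E3 // IsVertex P x ∧ x ∈ F}

/-- The edges of `P` that lie in `F`. -/
abbrev FaceEdge (P F : Set E3) : Type := {e : Set E3 // IsEdge P e ∧ e ⊆ F}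

lemma finite_faceVertex (hS : S.Finite) (F : Set E3) : Finite (FaceVertex (convexHull ℝ S) F) :=
  (hS.subset fun _ hx => hx.1.mem hS : {x | IsVertex (convexHull ℝ S) x ∧ x ∈ F}.Finite)

lemma finite_faceEdge (hS : S.Finite) (hvert : ∀ s ∈ S, ∃ u, expo (convexHull ℝ S) u = {s})
    (F : Set E3) : Finite (FaceEdge (convexHull ℝ S) F) := by
  have hfin : ((fun z : E3 × E3 => segment ℝ z.1 z.2) '' (S ×ˢ S)).Finite := (hS.prod hS).image _
  refine (hfin.subset ?_ : {e | IsEdge (convexHull ℝ S) e ∧ e ⊆ F}.Finite)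
  rintro e ⟨he, -⟩
  obtain ⟨x, y, -, hx, hy, rfl⟩ := he.exists_segment hS hvert
  exact ⟨(x, y), ⟨hx.mem hS, hy.mem hS⟩, rfl⟩

lemma IsEdge.exists_normal (hK : IsCompact P) (h : IsEdge P e) : ∃ u, u ≠ 0 ∧ expo P u = e :=
  (isFace_iff hK).1 h.1

/-- Three distinct edges of a facet have no common vertex. -/
lemma not_three_edges (hS : S.Finite) (hvert : ∀ s ∈ S, ∃ u, expo (convexHull ℝ S) u = {s})
    (hν : ν ≠ 0) (hx : IsVertex (convexHull ℝ S) x) {e : Fin 3 → Set E3}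
    (he : ∀ i, IsEdge (convexHull ℝ S) (e i)) (hsub : ∀ i, e i ⊆ expo (convexHull ℝ S) ν)
    (hxe : ∀ i, x ∈ e i) (hinj : Function.Injective e) : False := by
  have hK := hS.isCompact_convexHull ℝ
  choose y hyx hy heq using fun i => (he i).exists_segment_left hS hvert hx (hxe i)
  choose n _ hn using fun i => (he i).exists_normal hK
  have hyne : ∀ i j, i ≠ j → y i ≠ y j := by
    intro i j hij h
    exact hij (hinj (by rw [heq i, heq j, h]))
  have hye : ∀ i, y i ∈ e i := fun i => heq i ▸ right_mem_segment ℝ _ _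
  have hneg : ∀ i j, i ≠ j → ⟪n i, y j - x⟫ < 0 := fun i j hij =>
    inner_sub_lt_of_segment (hyne i j hij) (hyx j) ((hn i).trans (heq i)) ((hn j).trans (heq j))
  have hzero : ∀ i, ⟪n i, y i - x⟫ = 0 := by
    intro i
    have h1 : x ∈ expo _ (n i) := (hn i).symm ▸ hxe i
    have h2 : y i ∈ expo _ (n i) := (hn i).symm ▸ hye i
    rw [inner_sub_right, inner_eq_of_mem_expo h1 h2, sub_self]
  have hplane : ∀ i, ⟪ν, y i - x⟫ = 0 := by
    intro i
    rw [inner_sub_right, inner_eq_of_mem_expo (hsub i (hxe i)) (hsub i (hye i)), sub_self]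
  exact false_of_three hν (hplane 0) (hplane 1) (hplane 2) (hzero 0) (hneg 0 1 (by decide))
    (hneg 0 2 (by decide)) (hneg 1 0 (by decide)) (hzero 1) (hneg 1 2 (by decide))
    (hneg 2 0 (by decide)) (hneg 2 1 (by decide)) (hzero 2)

/-- Vertices and edges of a facet: every edge has two endpoints and every vertex lies on two
edges. -/
theorem exists_incidence (hS : S.Finite) (hvert : ∀ s ∈ S, ∃ u, expo (convexHull ℝ S) u = {s})
    (hν : ν ≠ 0) (hF : affDim (expo (convexHull ℝ S) ν) = 2) (hFeq : expo (convexHull ℝ S) ν = F)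
    [Fintype (FaceVertex (convexHull ℝ S) F)] [Fintype (FaceEdge (convexHull ℝ S) F)] :
    ∃ (p q : FaceEdge (convexHull ℝ S) F → FaceVertex (convexHull ℝ S) F)
      (e₁ e₂ : FaceVertex (convexHull ℝ S) F → FaceEdge (convexHull ℝ S) F),
      (∀ e, p e ≠ q e) ∧ (∀ a, e₁ a ≠ e₂ a) ∧
      (∀ φ : FaceVertex (convexHull ℝ S) F → FaceEdge (convexHull ℝ S) F → ℝ,
        ∑ a, (φ a (e₁ a) + φ a (e₂ a)) = ∑ e, (φ (p e) e + φ (q e) e)) ∧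
      (∀ e : FaceEdge (convexHull ℝ S) F, (e : Set E3) = segment ℝ (p e : E3) (q e)) ∧
      ∀ a, (a : E3) ∈ (e₁ a : Set E3) ∧ (a : E3) ∈ (e₂ a : Set E3) := by
  classical
  have hK := hS.isCompact_convexHull ℝ
  have hedge : ∀ e : FaceEdge (convexHull ℝ S) F, ∃ p q : FaceVertex (convexHull ℝ S) F,
      p ≠ q ∧ (e : Set E3) = segment ℝ (p : E3) q := by
    rintro ⟨e, he, hsub⟩
    obtain ⟨x, y, hxy, hx, hy, rfl⟩ := he.exists_segment hS hvert
    exact ⟨⟨x, hx, hsub (left_mem_segment ℝ _ _)⟩, ⟨y, hy, hsub (right_mem_segment ℝ _ _)⟩,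
      fun h => hxy (congrArg Subtype.val h), rfl⟩
  have hvtx : ∀ a : FaceVertex (convexHull ℝ S) F, ∃ e₁ e₂ : FaceEdge (convexHull ℝ S) F,
      e₁ ≠ e₂ ∧ (a : E3) ∈ (e₁ : Set E3) ∧ (a : E3) ∈ (e₂ : Set E3) := by
    rintro ⟨a, ha, haF⟩
    obtain ⟨e₁, e₂, hne, h1, h2, h3, h4⟩ := exists_two_edges hS hν hF ha (hFeq ▸ haF)
    rw [hFeq] at h1 h2
    exact ⟨⟨e₁, h1⟩, ⟨e₂, h2⟩, fun h => hne (congrArg Subtype.val h), h3, h4⟩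
  choose p q hpq hseg using hedge
  choose e₁ e₂ he he1 he2 using hvtx
  have hpe : ∀ e : FaceEdge (convexHull ℝ S) F, (p e : E3) ∈ (e : Set E3) := fun e => by
    rw [hseg e]; exact left_mem_segment ℝ _ _
  have hqe : ∀ e : FaceEdge (convexHull ℝ S) F, (q e : E3) ∈ (e : Set E3) := fun e => by
    rw [hseg e]; exact right_mem_segment ℝ _ _
  refine ⟨p, q, e₁, e₂, hpq, he, fun φ => ?_, hseg, fun a => ⟨he1 a, he2 a⟩⟩
  -- Exactly two edges pass through each vertex: `not_three_edges` rules out a third. Both sides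
  -- then become one sum over incident pairs.
  have hA : ∀ a, φ a (e₁ a) + φ a (e₂ a) = ∑ e : FaceEdge (convexHull ℝ S) F,
      if (a : E3) ∈ (e : Set E3) then φ a e else 0 := by
    intro a
    rw [← Finset.sum_filter, ← Finset.sum_pair (he a)]
    refine Finset.sum_congr ?_ fun _ _ => rfl
    ext e
    simp only [Finset.mem_insert, Finset.mem_singleton, Finset.mem_filter, Finset.mem_univ,
      true_and]
    constructor
    · rintro (rfl | rfl)
      exacts [he1 a, he2 a]
    · intro hae
      by_contra hcon
      push Not at hcon
      refine not_three_edges hS hvert hν a.2.1 (e := ![(e : Set E3), e₁ a, e₂ a]) ?_ ?_ ?_ ?_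
      · intro i; fin_cases i
        exacts [e.2.1, (e₁ a).2.1, (e₂ a).2.1]
      · rw [hFeq]; intro i; fin_cases i
        exacts [e.2.2, (e₁ a).2.2, (e₂ a).2.2]
      · intro i; fin_cases i
        exacts [hae, he1 a, he2 a]
      · have h1 : (e : Set E3) ≠ e₁ a := fun h => hcon.1 (Subtype.ext h)
        have h2 : (e : Set E3) ≠ e₂ a := fun h => hcon.2 (Subtype.ext h)
        have h3 : (e₁ a : Set E3) ≠ e₂ a := fun h => he a (Subtype.ext h)
        intro i j hij
        fin_cases i <;> fin_cases j <;>
          first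
            | rfl
            | exact absurd hij h1
            | exact absurd hij h2
            | exact absurd hij h3
            | exact absurd hij h1.symm
            | exact absurd hij h2.symm
            | exact absurd hij h3.symm
  have hB : ∀ e, φ (p e) e + φ (q e) e = ∑ a : FaceVertex (convexHull ℝ S) F,
      if (a : E3) ∈ (e : Set E3) then φ a e else 0 := by
    intro e
    rw [← Finset.sum_filter, ← Finset.sum_pair (f := fun a => φ a e) (hpq e)]
    refine Finset.sum_congr ?_ fun _ _ => rfl
    ext a
    simp only [Finset.mem_insert, Finset.mem_singleton, Finset.mem_filter, Finset.mem_univ,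
      true_and]
    constructor
    · rintro (rfl | rfl)
      exacts [hpe e, hqe e]
    · intro hae
      rw [hseg e] at hae
      have hsub : ∀ a : FaceVertex (convexHull ℝ S) F, (a : E3) ∈ convexHull ℝ S := fun a =>
        subset_convexHull ℝ S (a.2.1.mem hS)
      rcases a.2.1.eq_or_eq hK (hsub _) (hsub _) hae with h | h
      · exact Or.inl (Subtype.ext h)
      · exact Or.inr (Subtype.ext h)
  simp only [hA, hB]
  exact Finset.sum_comm

/-- The endpoints of some edge of a facet are separated by a generic plane through a point of the
facet. -/
lemma exists_separated_endpoints (hS : S.Finite)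
    (hvert : ∀ s ∈ S, ∃ u, expo (convexHull ℝ S) u = {s})
    (hν : ν ≠ 0) (hF : affDim (expo (convexHull ℝ S) ν) = 2) (hc : c ∈ expo (convexHull ℝ S) ν)
    (hg : ∀ x ∈ expo (convexHull ℝ S) ν, IsVertex (convexHull ℝ S) x → ⟪g, x - c⟫ ≠ 0) :
    ∃ e, IsEdge (convexHull ℝ S) e ∧ e ⊆ expo (convexHull ℝ S) ν ∧
      ∀ x y, e = segment ℝ x y → ⟪g, x - c⟫ ≠ 0 → ⟪g, y - c⟫ ≠ 0 →
        ⟪g, x - c⟫ * ⟪g, y - c⟫ < 0 := by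
  obtain ⟨e, he, hsub, ⟨a, ha, hag⟩, b, hb, hbg⟩ := exists_crossing_edge hS hvert hν hF hc hg
  refine ⟨e, he, hsub, ?_⟩
  rintro x y rfl hx hy
  have hcomb : ∀ z ∈ segment ℝ x y, ∃ s t : ℝ, 0 ≤ s ∧ 0 ≤ t ∧ s + t = 1 ∧
      ⟪g, z - c⟫ = s * ⟪g, x - c⟫ + t * ⟪g, y - c⟫ := by
    rintro z ⟨s, t, hs, ht, hst, rfl⟩
    refine ⟨s, t, hs, ht, hst, ?_⟩
    obtain rfl : s = 1 - t := by linarith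
    simp only [inner_sub_right, inner_add_right, inner_smul_right]
    ring
  obtain ⟨s, t, hs, ht, -, h1⟩ := hcomb a ha
  obtain ⟨s', t', hs', ht', -, h2⟩ := hcomb b hb
  rcases lt_or_gt_of_ne hx with hx | hx <;> rcases lt_or_gt_of_ne hy with hy | hy
  · nlinarith [mul_nonpos_of_nonneg_of_nonpos hs hx.le, mul_nonpos_of_nonneg_of_nonpos ht hy.le]
  · exact mul_neg_of_neg_of_pos hx hy
  · exact mul_neg_of_pos_of_neg hx hy
  · nlinarith [mul_nonneg hs' hx.le, mul_nonneg ht' hy.le]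

end Incidence

/-! ### The cyclically indexed configuration -/

section Cyclic

variable {P : Set E3}

lemma IsPolytope.exists_vertices (hP : IsPolytope P) : ∃ S : Set E3, S.Finite ∧
    P = convexHull ℝ S ∧ ∀ s ∈ S, ∃ u, expo (convexHull ℝ S) u = {s} := by
  obtain ⟨S, hS, rfl⟩ := hP
  obtain ⟨T, hT, heq, hvert⟩ := exists_irredundant hS
  exact ⟨T, hT, heq.symm, by rwa [heq]⟩

lemma ne_of_isEdge_segment {x y : E3} (h : IsEdge P (segment ℝ x y)) : x ≠ y := by
  rintro rfl
  have := h.2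
  rw [segment_same, affDim_singleton] at this
  exact zero_ne_one this

lemma ne_zero_of_norm_eq_one {u : E3} (h : ‖u‖ = 1) : u ≠ 0 := by
  rintro rfl
  simp at h

theorem not_antipodal_cyclic (hP : IsPolytope P) (k : ℕ) (hk : 0 < k) (F : Set E3)
    (a : ZMod k → E3) (hF : IsFacet P F) (ha : Function.Injective a)
    (hedges : {e | IsEdge P e ∧ e ⊆ F} = Set.range fun j : ZMod k => segment ℝ (a (j - 1)) (a j))
    (v : E3) (w : ZMod k → E3) (hw : Function.Injective w)
    (hvedges : {e | IsEdge P e ∧ v ∈ e} = Set.range fun j : ZMod k => segment ℝ v (w j))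
    (G : ZMod k → Set E3)
    (hG : ∀ j : ZMod k, IsFacet P (G j) ∧ segment ℝ v (w j) ⊆ G j ∧ segment ℝ v (w (j + 1)) ⊆ G j)
    (h1 : StrictlyAntipodal P F {v}) (h1' : affDist {v} F = minWidth P)
    (h2 : ∀ j : ZMod k, StrictlyAntipodal P (segment ℝ v (w j)) (segment ℝ (a (j - 1)) (a j)))
    (h3 : ∀ j : ZMod k, StrictlyAntipodal P (G j) {a j} ∧
      affDist {a j} (G j) = minWidth P) : False := by
  have : NeZero k := ⟨hk.ne'⟩
  obtain ⟨S, hS, rfl, hvert⟩ := hP.exists_vertices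
  have hK := hS.isCompact_convexHull ℝ
  have hconv := convex_convexHull ℝ S
  simp only [strictlyAntipodal_iff hK] at h1 h2 h3
  obtain ⟨-, u, hu, huF, huv⟩ := h1
  choose hne U hU hUG hUa using fun j => (h3 j).1
  choose hne' n hn hnw hna using h2
  have hnonempty : (convexHull ℝ S).Nonempty := ⟨v, (by rw [huv]; rfl : v ∈ expo _ (-u)).1⟩
  have hFdim : affDim F = 2 := by have := hF.2; omega
  have huw : width (convexHull ℝ S) (-u) = minWidth (convexHull ℝ S) :=
    width_eq_of_affDist hK hnonempty (by rwa [norm_neg]) (by rw [neg_neg, huF, huv, h1'])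
  have hUw : ∀ j, width (convexHull ℝ S) (U j) = minWidth (convexHull ℝ S) := fun j =>
    width_eq_of_affDist hK hnonempty (hU j) (by rw [hUG, hUa, affDist_comm, (h3 j).2])
  have hedge : ∀ j, IsEdge (convexHull ℝ S) (segment ℝ (a (j - 1)) (a j)) ∧
      segment ℝ (a (j - 1)) (a j) ⊆ F := fun j =>
    (hedges ▸ mem_range_self j : segment ℝ (a (j - 1)) (a j) ∈ {e | IsEdge _ e ∧ e ⊆ F})
  have hvedge : ∀ j, IsEdge (convexHull ℝ S) (segment ℝ v (w j)) ∧ v ∈ segment ℝ v (w j) := fun j =>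
    (hvedges ▸ mem_range_self j : segment ℝ v (w j) ∈ {e | IsEdge _ e ∧ v ∈ e})
  have hpq : ∀ j : ZMod k, j - 1 ≠ j := fun j h => by
    have := ne_of_isEdge_segment (hedge j).1
    rw [h] at this
    exact this rfl
  have haF : ∀ j, a j ∈ expo (convexHull ℝ S) (- -u) := fun j => by
    rw [neg_neg, huF]
    exact (hedge j).2 (right_mem_segment ℝ _ _)
  have hcF : v - minWidth (convexHull ℝ S) • (-u) ∈ expo (convexHull ℝ S) u := by
    have := sub_smul_mem_expo_neg hK hconv (by rwa [norm_neg]) huv huw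
    rwa [neg_neg] at this
  have hwG : ∀ j, w (j + 1) ∈ G j := fun j => (hG j).2.2 (right_mem_segment ℝ _ _)
  -- Edge `j` of `F` has endpoints `a (j - 1)` and `a j`, so vertex `j` lies on edges `j` and `j +
  -- 1`. The direction exposing `v` is `-u`.
  refine false_of_configuration hK hconv (fun j : ZMod k => j - 1) (fun j => j) (fun j => j)
    (fun j => j + 1) hpq (fun j h => hpq (j + 1) (by simpa using h)) (fun φ => ?_)
    (by rwa [norm_neg] : ‖-u‖ = 1) huv huw ha haF hU hUa ?_ hUw hw
    (fun j => (ne_of_isEdge_segment (hvedge j).1).symm) hn hnw ?_ ?_ ?_ ?_ ?_ ?_ ?_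
  · rw [Finset.sum_add_distrib, Finset.sum_add_distrib, add_comm]
    congr 1
    rw [← Equiv.sum_comp (Equiv.addRight (1 : ZMod k)) fun j => φ (j - 1) j]
    simp
  · intro j
    rw [hUG]
    exact (hG j).2.1 (left_mem_segment ℝ _ _)
  · intro j
    rw [hna]
    exact left_mem_segment ℝ _ _
  · intro j
    rw [hna]
    exact right_mem_segment ℝ _ _
  · intro j
    rw [hUG]
    exact (hG j).2.1 (right_mem_segment ℝ _ _)
  · intro j
    rw [hUG]
    exact hwG j
  · intro j
    rw [hUG]
    simpa using hwG (j - 1)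
  · intro j
    rw [hUG]
    exact (hG j).2.1 (right_mem_segment ℝ _ _)
  · intro g hg
    have hu0 := ne_zero_of_norm_eq_one hu
    have hdim : affDim (expo (convexHull ℝ S) u) = 2 := by rw [huF, hFdim]
    obtain ⟨e, he, hsub, hcross⟩ := exists_separated_endpoints (g := g) hS hvert hu0 hdim hcF (by
      intro x hx hxv
      obtain ⟨e, -, -, he, -, hxe, -⟩ := exists_two_edges hS hu0 hdim hxv hx
      rw [huF] at he
      have hmem : e ∈ {e | IsEdge (convexHull ℝ S) e ∧ e ⊆ F} := he
      rw [hedges] at hmem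
      obtain ⟨j, rfl⟩ := hmem
      have hsubP : ∀ j, a j ∈ convexHull ℝ S := fun j => (haF j).1
      rcases hxv.eq_or_eq hK (hsubP _) (hsubP _) hxe with rfl | rfl
      · exact hg _
      · exact hg _)
    rw [huF] at hsub
    have hmem : e ∈ {e | IsEdge (convexHull ℝ S) e ∧ e ⊆ F} := ⟨he, hsub⟩
    rw [hedges] at hmem
    obtain ⟨j, rfl⟩ := hmem
    exact ⟨j, hcross _ _ rfl (hg _) (hg _)⟩

end Cyclic

/-! ### First-order conditions at a direction of minimum width -/

section Reduced

variable {S P : Set E3} {u v t : E3}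

lemma exists_norm_eq_one : ∃ u : E3, ‖u‖ = 1 := ⟨EuclideanSpace.single 0 1, by simp⟩

lemma minWidth_pos (hP : IsConvexBody P) : 0 < minWidth P := by
  obtain ⟨-, hK, x, hx⟩ := hP
  obtain ⟨r, hr, hball⟩ := Metric.isOpen_iff.1 isOpen_interior x hx
  have hball := hball.trans interior_subset
  refine lt_of_lt_of_le (half_pos hr) ?_
  obtain ⟨w, hw⟩ := exists_norm_eq_one
  refine le_csInf ⟨_, w, hw, rfl⟩ ?_
  rintro _ ⟨w, hw, rfl⟩
  have h1 : x + (r / 2) • w ∈ P := hball (by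
    rw [mem_ball_iff_norm, add_sub_cancel_left, norm_smul, hw, mul_one,
      Real.norm_of_nonneg (by positivity)]
    linarith)
  have h2 := inner_sub_le_width (u := w) hK h1 (interior_subset hx)
  rwa [add_sub_cancel_left, inner_smul_right, real_inner_self_eq_norm_sq, hw, one_pow,
    mul_one] at h2

/-- In a direction of minimum width, the opposite faces surround the contact segment. -/
lemma exists_inner_sub_pos (hS : S.Finite) (hω : 0 < minWidth (convexHull ℝ S)) (hu : ‖u‖ = 1)
    (hw : width (convexHull ℝ S) u = minWidth (convexHull ℝ S)) (ht : t ≠ 0) (hut : ⟪u, t⟫ = 0)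
    (hne : S.Nonempty) :
    ∃ a ∈ expo (convexHull ℝ S) u, ∃ b ∈ expo (convexHull ℝ S) (-u), 0 < ⟪t, a - b⟫ := by
  have hK := hS.isCompact_convexHull ℝ
  set ω := minWidth (convexHull ℝ S) with hωdef
  obtain ⟨a, ha⟩ := expo_nonempty hK hne.convexHull u
  obtain ⟨b, hb⟩ := expo_nonempty hK hne.convexHull (-u)
  have hab : ⟪u, a - b⟫ = ω := by rw [← hw, width_eq ha hb]
  by_contra! hcon
  -- If no pair of opposite points gains in the direction `t`, tilting `u` slightly toward `t` keeps
  -- all differences at most `ω`, while the normal becomes longer than 1.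
  have hev : ∀ᶠ ε in 𝓝[>] (0 : ℝ), ∀ s ∈ S, ∀ s' ∈ S, ε * ⟪t, s - s'⟫ ≤ ω - ⟪u, s - s'⟫ := by
    rw [Filter.eventually_all_finite hS]
    intro s hs
    rw [Filter.eventually_all_finite hS]
    intro s' hs'
    have hs := subset_convexHull ℝ S hs
    have hs' := subset_convexHull ℝ S hs'
    have l1 := ha.2 s hs
    have l2 := hb.2 s' hs'
    have e1 : ⟪u, s - s'⟫ = ⟪u, s⟫ - ⟪u, s'⟫ := inner_sub_right _ _ _
    have e2 : ω = ⟪u, a⟫ - ⟪u, b⟫ := by rw [← hab, inner_sub_right]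
    rw [inner_neg_left, inner_neg_left] at l2
    by_cases h : ⟪u, s - s'⟫ = ω
    · have h1 : s ∈ expo (convexHull ℝ S) u := mem_expo_of_inner_eq ha hs (by linarith)
      have h2 : s' ∈ expo (convexHull ℝ S) (-u) :=
        mem_expo_of_inner_eq hb hs' (by rw [inner_neg_left, inner_neg_left]; linarith)
      have h3 := hcon s h1 s' h2
      filter_upwards [self_mem_nhdsWithin] with ε hε
      have hε : 0 < ε := hε
      nlinarith
    · have hlt : ⟪u, s - s'⟫ < ω := lt_of_le_of_ne (by linarith) h
      have hcont : Tendsto (fun ε : ℝ => ε * ⟪t, s - s'⟫) (𝓝 0) (𝓝 0) := by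
        have : Continuous (fun ε : ℝ => ε * ⟪t, s - s'⟫) := by fun_prop
        simpa using this.tendsto 0
      exact (hcont.mono_left nhdsWithin_le_nhds).eventually_le_const (by linarith)
  obtain ⟨ε, hε, hε0⟩ := (hev.and self_mem_nhdsWithin).exists
  have hε0 : 0 < ε := hε0
  obtain ⟨x, hx⟩ := expo_nonempty hK hne.convexHull (u + ε • t)
  obtain ⟨y, hy⟩ := expo_nonempty hK hne.convexHull (-(u + ε • t))
  have h1 := minWidth_mul_norm_le hK hx hy
  have h2 : ⟪u + ε • t, x - y⟫ ≤ ω := by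
    have h3 : ∀ s' ∈ S, ⟪u + ε • t, x⟫ ≤ ω + ⟪u + ε • t, s'⟫ := by
      intro s' hs'
      refine inner_le_of_mem_convexHull (fun s hs => ?_) hx.1
      have := hε s hs s' hs'
      rw [inner_sub_right, inner_sub_right] at this
      simp only [inner_add_left, inner_smul_left, RCLike.conj_to_real]
      linarith
    have h4 := inner_le_of_mem_convexHull (u := -(u + ε • t)) (c := ω - ⟪u + ε • t, x⟫)
      (fun s hs => by have := h3 s hs; rw [inner_neg_left]; linarith) hy.1
    rw [inner_neg_left] at h4
    rw [inner_sub_right]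
    linarith
  have h5 : ‖u + ε • t‖ ^ 2 = 1 + ε ^ 2 * ‖t‖ ^ 2 := by
    rw [norm_add_sq_real, hu, inner_smul_right, hut, norm_smul, mul_pow, Real.norm_eq_abs, sq_abs]
    ring
  have h6 : 0 < ε ^ 2 * ‖t‖ ^ 2 := by
    have := norm_pos_iff.2 ht
    positivity
  have h7 : 1 < ‖u + ε • t‖ := by nlinarith [norm_nonneg (u + ε • t)]
  nlinarith

/-- If the face opposite to the single point `v` were at most one-dimensional, some `t` orthogonal
to `u` would be constant on it; `exists_inner_sub_pos` for `t` and for `-t` gives contradictory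
signs. -/
lemma affDim_expo_neg_eq_two (hS : S.Finite) (hω : 0 < minWidth (convexHull ℝ S)) (hu : ‖u‖ = 1)
    (hw : width (convexHull ℝ S) u = minWidth (convexHull ℝ S))
    (hv : expo (convexHull ℝ S) u = {v}) : affDim (expo (convexHull ℝ S) (-u)) = 2 := by
  have hu0 := ne_zero_of_norm_eq_one hu
  have hle : affDim (expo (convexHull ℝ S) (-u)) ≤ 2 :=
    affDim_le_two (neg_ne_zero.2 hu0) expo_const
  by_contra hcon
  have hle1 : Module.finrank ℝ (vectorSpan ℝ (expo (convexHull ℝ S) (-u))) ≤ 1 := by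
    rw [← affDim_eq]; omega
  obtain ⟨⟨δ, hδm⟩, hδ⟩ := finrank_le_one_iff.1 hle1
  obtain ⟨t, ht, htu, htδ⟩ := exists_orthogonal_pair u δ
  have hne : S.Nonempty := ⟨v, mem_of_expo_eq_singleton hv⟩
  have hconst : ∀ b ∈ expo (convexHull ℝ S) (-u), ∀ b' ∈ expo (convexHull ℝ S) (-u),
      ⟪t, b⟫ = ⟪t, b'⟫ := by
    intro b hb b' hb'
    obtain ⟨c, hc⟩ := hδ ⟨b - b', vsub_mem_vectorSpan ℝ hb hb'⟩
    have hc : c • δ = b - b' := congrArg Subtype.val hc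
    have := congrArg (fun z => ⟪t, z⟫) hc
    simp only [inner_smul_right, htδ, mul_zero, inner_sub_right] at this
    linarith
  obtain ⟨a, ha, b, hb, h1⟩ := exists_inner_sub_pos hS hω hu hw ht (by rwa [real_inner_comm]) hne
  obtain ⟨a', ha', b', hb', h2⟩ := exists_inner_sub_pos hS hω hu hw (neg_ne_zero.2 ht)
    (by rw [inner_neg_right, real_inner_comm, htu, neg_zero]) hne
  rw [hv] at ha ha'
  rw [mem_singleton_iff] at ha ha'
  subst ha ha'
  rw [inner_sub_right] at h1
  rw [inner_neg_left, inner_sub_right, hconst b' hb' b hb] at h2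
  linarith

/-- Directions close to one of minimum width do not make the opposite faces much narrower. -/
lemma false_of_narrow (hS : S.Finite) (hω : 0 < minWidth (convexHull ℝ S)) (hu : ‖u‖ = 1)
    (hw : width (convexHull ℝ S) u = minWidth (convexHull ℝ S)) (hne : S.Nonempty)
    {un : ℕ → E3} (hun : ∀ n, ‖un n‖ = 1) (hlim : Tendsto un atTop (𝓝 u))
    (H : ∀ a ∈ expo (convexHull ℝ S) u, ∀ b ∈ expo (convexHull ℝ S) (-u),
      ∃ a' b' : ℕ → E3, Tendsto a' atTop (𝓝 a) ∧ Tendsto b' atTop (𝓝 b) ∧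
        ∀ n, a' n ∈ expo (convexHull ℝ S) u ∧ b' n ∈ expo (convexHull ℝ S) (-u) ∧
          ⟪un n, a' n - b' n⟫ < minWidth (convexHull ℝ S)) : False := by
  have hK := hS.isCompact_convexHull ℝ
  set ω := minWidth (convexHull ℝ S) with hωdef
  set c : ℕ → ℝ := fun n => ⟪u, un n⟫ with hc
  set τ : ℕ → E3 := fun n => un n - c n • u with hτ
  have huu : ⟪u, u⟫ = 1 := by rw [real_inner_self_eq_norm_sq, hu]; norm_num
  have hclim : Tendsto c atTop (𝓝 1) := by
    rw [← huu]
    exact tendsto_const_nhds.inner hlim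
  have hτlim : Tendsto τ atTop (𝓝 0) := by
    have := hlim.sub (hclim.smul_const u)
    rwa [one_smul, sub_self] at this
  have hτu : ∀ n, ⟪u, τ n⟫ = 0 := fun n => by
    simp only [hτ, hc, inner_sub_right, inner_smul_right, huu]; ring
  have hτn : ∀ n, ‖τ n‖ ^ 2 = 1 - c n ^ 2 := fun n => by
    simp only [hτ, hc]
    rw [@norm_sub_sq_real, hun n, norm_smul, hu, inner_smul_right, real_inner_comm,
      Real.norm_eq_abs, mul_one, sq_abs]
    ring
  have hval : ∀ n, ∀ a ∈ expo (convexHull ℝ S) u, ∀ b ∈ expo (convexHull ℝ S) (-u),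
      ⟪un n, a - b⟫ = c n * ω + ⟪τ n, a - b⟫ := by
    intro n a ha b hb
    have : un n = c n • u + τ n := by simp [hτ]
    conv_lhs => rw [this]
    rw [inner_add_left, inner_smul_left, RCLike.conj_to_real, ← width_eq ha hb, hw]
  obtain ⟨a₀, ha₀⟩ := expo_nonempty hK hne.convexHull u
  obtain ⟨b₀, hb₀⟩ := expo_nonempty hK hne.convexHull (-u)
  obtain ⟨a', b', -, -, h0⟩ := H a₀ ha₀ b₀ hb₀
  have hc0 : ∀ᶠ n in atTop, 0 < c n := hclim.eventually_const_lt one_pos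
  have hτ0 : ∀ᶠ n in atTop, τ n ≠ 0 := by
    filter_upwards [hc0] with n hn h
    have h1 := hτn n
    rw [h, norm_zero] at h1
    have h2 : c n = 1 := by nlinarith
    obtain ⟨h3, h4, h5⟩ := h0 n
    rw [hval n _ h3 _ h4, h2, h, inner_zero_left] at h5
    linarith
  have hfreq : ∃ᶠ n in atTop, ‖τ n‖⁻¹ • τ n ∈ Metric.sphere (0 : E3) 1 := by
    refine Eventually.frequently ?_
    filter_upwards [hτ0] with n hn
    rw [mem_sphere_zero_iff_norm]
    exact norm_smul_inv_norm hn
  -- A limit of the normalized tilts. A pair gaining in this direction gains linearly in `‖τ‖`,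
  -- whereas the loss from `c n < 1` is quadratic.
  obtain ⟨t, ht, φ, hφ, hφlim⟩ := (isCompact_sphere (0 : E3) 1).tendsto_subseq' hfreq
  have ht1 : ‖t‖ = 1 := mem_sphere_zero_iff_norm.1 ht
  have htu : ⟪u, t⟫ = 0 := by
    have h1 : Tendsto (fun n => ⟪u, ((fun n => ‖τ n‖⁻¹ • τ n) ∘ φ) n⟫) atTop (𝓝 ⟪u, t⟫) :=
      tendsto_const_nhds.inner hφlim
    have h2 : (fun n => ⟪u, ((fun n => ‖τ n‖⁻¹ • τ n) ∘ φ) n⟫) = fun _ => 0 := by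
      ext n
      simp [inner_smul_right, hτu]
    rw [h2] at h1
    exact tendsto_nhds_unique tendsto_const_nhds h1 |>.symm
  obtain ⟨a, ha, b, hb, hpos⟩ := exists_inner_sub_pos hS hω hu hw (ne_zero_of_norm_eq_one ht1) htu
    hne
  obtain ⟨a', b', ha', hb', h0⟩ := H a ha b hb
  set m := ⟪t, a - b⟫ with hm
  have hlim2 : Tendsto (fun n => ⟪((fun n => ‖τ n‖⁻¹ • τ n) ∘ φ) n, a' (φ n) - b' (φ n)⟫) atTop
      (𝓝 m) :=
    hφlim.inner ((ha'.comp hφ.tendsto_atTop).sub (hb'.comp hφ.tendsto_atTop))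
  have hsmall : Tendsto (fun n => ω * ‖τ (φ n)‖) atTop (𝓝 0) := by
    have := (hτlim.comp hφ.tendsto_atTop).norm.const_mul ω
    simpa using this
  obtain ⟨n, h1, h2, h3, h4⟩ := ((hlim2.eventually_const_lt (half_lt_self hpos)).and
    ((hsmall.eventually_lt_const (half_pos hpos)).and
      ((hφ.tendsto_atTop.eventually hc0).and (hφ.tendsto_atTop.eventually hτ0)))).exists
  obtain ⟨h5, h6, h7⟩ := h0 (φ n)
  rw [hval _ _ h5 _ h6] at h7
  simp only [Function.comp, inner_smul_left, RCLike.conj_to_real] at h1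
  have hpos' : 0 < ‖τ (φ n)‖ := norm_pos_iff.2 h4
  rw [← div_eq_inv_mul, lt_div_iff₀ hpos'] at h1
  have h8 := hτn (φ n)
  have h9 : c (φ n) ≤ 1 := by nlinarith
  have h10 : 1 - ‖τ (φ n)‖ ^ 2 ≤ c (φ n) := by nlinarith
  nlinarith [mul_le_mul_of_nonneg_right h10 hω.le, mul_lt_mul_of_pos_right h2 hpos']

end Reduced

/-! ### Vertices of reduced polytopes are antipodal to facets -/

section Reduced

variable {S P : Set E3} {u v t g x : E3}

lemma notMem_expo_of_mem_interior (hg : g ≠ 0) (hx : x ∈ interior P) : x ∉ expo P g := by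
  intro h
  have hlim : Tendsto (fun ε : ℝ => x + ε • g) (𝓝[>] 0) (𝓝 x) := by
    have : Continuous (fun ε : ℝ => x + ε • g) := by fun_prop
    have := this.tendsto 0
    rw [zero_smul, add_zero] at this
    exact this.mono_left nhdsWithin_le_nhds
  obtain ⟨ε, h1, h2⟩ := ((hlim.eventually (isOpen_interior.mem_nhds hx)).and
    self_mem_nhdsWithin).exists
  have h2 : 0 < ε := h2
  have h3 := h.2 _ (interior_subset h1)
  rw [inner_add_right, inner_smul_right] at h3
  have := mul_pos h2 (real_inner_self_pos.2 hg)
  linarith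

/-- Every vertex of a reduced polytope is antipodal to a facet at distance the minimum width. -/
theorem IsReduced.exists_antipodal (hS : S.Finite) (hred : IsReduced (convexHull ℝ S))
    (hv : IsVertex (convexHull ℝ S) v) :
    ∃ u : E3, ‖u‖ = 1 ∧ expo (convexHull ℝ S) u = {v} ∧
      affDim (expo (convexHull ℝ S) (-u)) = 2 ∧
      width (convexHull ℝ S) u = minWidth (convexHull ℝ S) := by
  have hK := hS.isCompact_convexHull ℝ
  have hconv := convex_convexHull ℝ S
  have hω := minWidth_pos hred.1
  obtain ⟨x₀, hx₀⟩ := hred.1.2.2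
  obtain ⟨g, hg0, hg⟩ := hv.exists_expo hK
  have hvg : v ∈ expo (convexHull ℝ S) g := by rw [hg]; rfl
  set P := convexHull ℝ S with hP
  set ω := minWidth P with hωdef
  have hne : P.Nonempty := ⟨v, hvg.1⟩
  have hSne : S.Nonempty := convexHull_nonempty_iff.1 hne
  have hx₀g : ⟪g, x₀⟫ < ⟪g, v⟫ :=
    inner_lt_of_notMem_expo hvg (interior_subset hx₀) (notMem_expo_of_mem_interior hg0 hx₀)
  -- A cap depth so small that every other point of `S` and an interior point survive the cut.
  obtain ⟨c, hc0, hcx, hcS⟩ : ∃ c : ℝ, 0 < c ∧ c < ⟪g, v⟫ - ⟪g, x₀⟫ ∧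
      ∀ s ∈ S, s ≠ v → c ≤ ⟪g, v⟫ - ⟪g, s⟫ := by
    have h1 : ∀ᶠ c in 𝓝[>] (0 : ℝ), ∀ s ∈ S, s ≠ v → c ≤ ⟪g, v⟫ - ⟪g, s⟫ := by
      rw [Filter.eventually_all_finite hS]
      intro s hs
      by_cases hsv : s = v
      · exact Eventually.of_forall fun _ h => absurd hsv h
      · have : ⟪g, s⟫ < ⟪g, v⟫ :=
          inner_lt_of_notMem_expo hvg (subset_convexHull ℝ S hs) (by rw [hg]; exact hsv)
        filter_upwards [nhdsWithin_le_nhds (eventually_le_nhds (sub_pos.2 this))] with c hc _ using hc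
    have h2 : ∀ᶠ c in 𝓝[>] (0 : ℝ), c < ⟪g, v⟫ - ⟪g, x₀⟫ :=
      nhdsWithin_le_nhds (eventually_lt_nhds (sub_pos.2 hx₀g))
    obtain ⟨c, ⟨h3, h4⟩, h5⟩ := ((h1.and h2).and self_mem_nhdsWithin).exists
    exact ⟨c, h5, h4, h3⟩
  obtain ⟨s₀, hs₀, hs₀v⟩ : ∃ s ∈ S, s ≠ v := by
    by_contra! hcon
    have : P ⊆ {v} := convexHull_min (fun s hs => hcon s hs) (convex_singleton v)
    have := this (interior_subset hx₀)
    rw [mem_singleton_iff] at this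
    rw [this] at hx₀g
    exact lt_irrefl _ hx₀g
  set δ : ℕ → ℝ := fun n => 1 / ((n : ℝ) + 1) with hδ
  have hδ0 : ∀ n, 0 < δ n := fun n => by positivity
  have hδ1 : ∀ n, δ n ≤ 1 := fun n => by
    rw [hδ]
    simp only
    rw [div_le_one (by positivity)]
    have : (0 : ℝ) ≤ n := Nat.cast_nonneg n
    linarith
  have hδlim : Tendsto δ atTop (𝓝 0) := tendsto_one_div_add_atTop_nhds_zero_nat
  set Q : ℕ → Set E3 := fun n => P ∩ {x | ⟪g, x⟫ ≤ ⟪g, v⟫ - δ n * c} with hQ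
  have hQK : ∀ n, IsCompact (Q n) := fun n =>
    hK.inter_right (isClosed_le (by fun_prop) continuous_const)
  have hQbody : ∀ n, IsConvexBody (Q n) := by
    intro n
    refine ⟨hconv.inter (convex_halfSpace_le (innerₛₗ ℝ g).isLinear _), hQK n, x₀, ?_⟩
    rw [hQ]
    simp only [interior_inter]
    refine ⟨hx₀, ?_⟩
    rw [mem_interior]
    refine ⟨{x | ⟪g, x⟫ < ⟪g, v⟫ - δ n * c}, fun x hx => le_of_lt (show ⟪g, x⟫ < _ from hx),
      isOpen_lt (by fun_prop) continuous_const, ?_⟩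
    show ⟪g, x₀⟫ < ⟪g, v⟫ - δ n * c
    nlinarith [hδ1 n]
  have hQsub : ∀ n, Q n ⊂ P := by
    intro n
    refine ⟨inter_subset_left, fun h => ?_⟩
    have h1 : ⟪g, v⟫ ≤ ⟪g, v⟫ - δ n * c := (h hvg.1).2
    nlinarith [mul_pos (hδ0 n) hc0]
  -- Moving by the fraction `δ n` toward a surviving vertex lowers `g` by enough to enter `Q n`, so
  -- every point of `P` is a limit of points of the truncated bodies.
  have happrox : ∀ n, ∀ z ∈ P, ∀ s ∈ S, s ≠ v → z + δ n • (s - z) ∈ Q n := by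
    intro n z hz s hs hsv
    refine ⟨hconv.add_smul_sub_mem hz (subset_convexHull ℝ S hs) ⟨(hδ0 n).le, hδ1 n⟩, ?_⟩
    show ⟪g, z + δ n • (s - z)⟫ ≤ ⟪g, v⟫ - δ n * c
    rw [inner_add_right, inner_smul_right, inner_sub_right]
    have h1 := hvg.2 z hz
    have h2 := hcS s hs hsv
    nlinarith [hδ0 n, hδ1 n, mul_nonneg (sub_nonneg.2 (hδ1 n)) (sub_nonneg.2 h1),
      mul_nonneg (hδ0 n).le (sub_nonneg.2 h2)]
  have hSQ : ∀ n, ∀ s ∈ S, s ≠ v → s ∈ Q n := fun n s hs hsv => by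
    simpa using happrox n s (subset_convexHull ℝ S hs) s hs hsv
  have happroxlim : ∀ z s : E3, Tendsto (fun n => z + δ n • (s - z)) atTop (𝓝 z) := by
    intro z s
    have := (hδlim.smul_const (s - z)).const_add z
    rwa [zero_smul, add_zero] at this
  -- A direction in which `Q n` is narrower than `ω` must have `v` extremal for `P`, since otherwise
  -- extremal vertices of `P` survive on both sides. The sign is chosen so that `v` maximizes.
  have hdir : ∀ n, ∃ w : E3, ‖w‖ = 1 ∧ v ∈ expo P w ∧ ∀ x ∈ Q n, ∀ y ∈ Q n, ⟪w, x - y⟫ < ω := by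
    intro n
    obtain ⟨w, hw, hlt⟩ := exists_width_lt exists_norm_eq_one (hred.2 (Q n) (hQbody n) (hQsub n))
    have hlt' : ∀ x ∈ Q n, ∀ y ∈ Q n, ⟪w, x - y⟫ < ω := fun x hx y hy =>
      (inner_sub_le_width (hQK n) hx hy).trans_lt hlt
    obtain ⟨x, hx, hxmax⟩ := exists_max_image S (fun z => ⟪w, z⟫) hS hSne
    obtain ⟨y, hy, hymin⟩ := exists_min_image S (fun z => ⟪w, z⟫) hS hSne
    have hxe : x ∈ expo P w := mem_expo_convexHull_iff.2 ⟨subset_convexHull ℝ S hx, hxmax⟩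
    have hye : y ∈ expo P (-w) := mem_expo_convexHull_iff.2 ⟨subset_convexHull ℝ S hy, fun s hs => by
      rw [inner_neg_left, inner_neg_left]; exact neg_le_neg (hymin s hs)⟩
    by_cases hxv : x = v
    · exact ⟨w, hw, hxv ▸ hxe, hlt'⟩
    by_cases hyv : y = v
    · refine ⟨-w, by rwa [norm_neg], hyv ▸ hye, fun a ha b hb => ?_⟩
      rw [inner_neg_left, ← inner_neg_right, neg_sub]
      exact hlt' b hb a ha
    · exfalso
      have h1 := hlt' x (hSQ n x hx hxv) y (hSQ n y hy hyv)
      rw [← width_eq hxe hye] at h1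
      exact absurd (minWidth_le hK hne hw) (not_le.2 h1)
  choose un hun hvun hunQ using hdir
  obtain ⟨u, hu, φ, hφ, hφlim⟩ := (isCompact_sphere (0 : E3) 1).tendsto_subseq
    fun n => mem_sphere_zero_iff_norm.2 (hun n)
  have hu : ‖u‖ = 1 := mem_sphere_zero_iff_norm.1 hu
  have hvu : v ∈ expo P u := by
    refine ⟨hvg.1, fun y hy => ?_⟩
    exact le_of_tendsto_of_tendsto' (hφlim.inner tendsto_const_nhds)
      (hφlim.inner tendsto_const_nhds) fun n => (hvun (φ n)).2 y hy
  have hwid : ∀ x ∈ P, ∀ y ∈ P, ⟪u, x - y⟫ ≤ ω := by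
    intro x hx y hy
    refine le_of_tendsto' (hφlim.inner (((happroxlim x s₀).comp hφ.tendsto_atTop).sub
      ((happroxlim y s₀).comp hφ.tendsto_atTop))) fun n => ?_
    exact (hunQ (φ n) _ (happrox _ x hx s₀ hs₀ hs₀v) _ (happrox _ y hy s₀ hs₀ hs₀v)).le
  have hw : width P u = ω := by
    obtain ⟨x, hx⟩ := expo_nonempty hK hne u
    obtain ⟨y, hy⟩ := expo_nonempty hK hne (-u)
    refine le_antisymm ?_ (minWidth_le hK hne hu)
    rw [width_eq hx hy]
    exact hwid x hx.1 y hy.1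
  -- If the limit face had another vertex `s`, its points could be pushed toward `s`, and those of
  -- the opposite face toward `y`, without leaving the faces; they then lie in `Q n`, contrary to
  -- `false_of_narrow`.
  have hsingle : expo P u = {v} := by
    by_contra hcon
    obtain ⟨s, ⟨hs, hsu⟩, hsv⟩ : ∃ s ∈ S ∩ expo P u, s ≠ v := by
      by_contra! h
      apply hcon
      refine Subset.antisymm ?_ (singleton_subset_iff.2 hvu)
      rw [hP, expo_convexHull]
      exact convexHull_min (fun s hs => h s hs) (convex_singleton v)
    obtain ⟨y, hy, hymin⟩ := exists_min_image S (fun z => ⟪u, z⟫) hS hSne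
    have hyu : y ∈ expo P (-u) := mem_expo_convexHull_iff.2 ⟨subset_convexHull ℝ S hy, fun s hs => by
      rw [inner_neg_left, inner_neg_left]; exact neg_le_neg (hymin s hs)⟩
    have hyv : y ≠ v := by
      rintro rfl
      have := width_eq hvu hyu
      rw [hw, sub_self, inner_zero_right] at this
      exact hω.ne' this
    have hkeep : ∀ (w z s : E3) (n : ℕ), z ∈ expo P w → s ∈ expo P w →
        z + δ n • (s - z) ∈ expo P w := by
      intro w z s n hz hs
      refine mem_expo_of_inner_eq hz (hconv.add_smul_sub_mem hz.1 hs.1 ⟨(hδ0 n).le, hδ1 n⟩) ?_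
      rw [inner_add_right, inner_smul_right, inner_sub_right, inner_eq_of_mem_expo hz hs]
      ring
    refine false_of_narrow hS hω hu hw hSne (fun n => hun (φ n)) hφlim fun a ha b hb => ?_
    refine ⟨fun n => a + δ (φ n) • (s - a), fun n => b + δ (φ n) • (y - b),
      (happroxlim a s).comp hφ.tendsto_atTop, (happroxlim b y).comp hφ.tendsto_atTop, fun n => ?_⟩
    exact ⟨hkeep u a s _ ha hsu, hkeep (-u) b y _ hb hyu,
      hunQ (φ n) _ (happrox _ a ha.1 s hs hsv) _ (happrox _ b hb.1 y hy hyv)⟩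
  exact ⟨u, hu, hsingle, affDim_expo_neg_eq_two hS hω hu hw hsingle, hw⟩

end Reduced

/-! ### Self-dual polytopes -/

section SelfDual

variable {S P F : Set E3} {u u' v x : E3}

/-- The configuration theorem with edges and vertices taken from a facet of a polytope. -/
theorem false_of_facet_configuration (hS : S.Finite)
    (hvert : ∀ s ∈ S, ∃ u, expo (convexHull ℝ S) u = {s})
    (hu : ‖u‖ = 1) (hv : expo (convexHull ℝ S) u = {v})
    (huw : width (convexHull ℝ S) u = minWidth (convexHull ℝ S))
    (hF : expo (convexHull ℝ S) (-u) = F) (hdim : affDim F = 2)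
    {U : FaceVertex (convexHull ℝ S) F → E3} (hU : ∀ a, ‖U a‖ = 1)
    (haU : ∀ a, expo (convexHull ℝ S) (-(U a)) = {(a : E3)})
    (hvU : ∀ a, v ∈ expo (convexHull ℝ S) (U a))
    (hUw : ∀ a, width (convexHull ℝ S) (U a) = minWidth (convexHull ℝ S))
    {w n : FaceEdge (convexHull ℝ S) F → E3} (hw : Function.Injective w) (hwv : ∀ e, w e ≠ v)
    (hn : ∀ e, ‖n e‖ = 1) (hnw : ∀ e, expo (convexHull ℝ S) (n e) = segment ℝ v (w e))
    (hne : ∀ e : FaceEdge (convexHull ℝ S) F, (e : Set E3) ⊆ expo (convexHull ℝ S) (-(n e)))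
    (hwU : ∀ (a : FaceVertex (convexHull ℝ S) F) (e : FaceEdge (convexHull ℝ S) F),
      (a : E3) ∈ (e : Set E3) → w e ∈ expo (convexHull ℝ S) (U a)) : False := by
  have hK := hS.isCompact_convexHull ℝ
  have hconv := convex_convexHull ℝ S
  have := finite_faceVertex hS F
  have := finite_faceEdge hS hvert F
  have := Fintype.ofFinite (FaceVertex (convexHull ℝ S) F)
  have := Fintype.ofFinite (FaceEdge (convexHull ℝ S) F)
  have hu0 : -u ≠ 0 := neg_ne_zero.2 (ne_zero_of_norm_eq_one hu)
  have hdim' : affDim (expo (convexHull ℝ S) (-u)) = 2 := by rw [hF, hdim]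
  obtain ⟨p, q, e₁, e₂, hpq, he, hinc, hseg, hmem⟩ := exists_incidence hS hvert hu0 hdim' hF
  have hp : ∀ e : FaceEdge (convexHull ℝ S) F, (p e : E3) ∈ (e : Set E3) := fun e => by
    rw [hseg e]; exact left_mem_segment ℝ _ _
  have hq : ∀ e : FaceEdge (convexHull ℝ S) F, (q e : E3) ∈ (e : Set E3) := fun e => by
    rw [hseg e]; exact right_mem_segment ℝ _ _
  refine false_of_configuration hK hconv p q e₁ e₂ hpq he hinc hu hv huw
    (a := fun a : FaceVertex (convexHull ℝ S) F => (a : E3)) Subtype.val_injective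
    (fun a => hF.symm ▸ a.2.2) hU haU hvU hUw hw hwv hn hnw (fun e => hne e (hp e))
    (fun e => hne e (hq e)) (fun a => hwU a _ (hmem a).1) (fun a => hwU a _ (hmem a).2)
    (fun e => hwU _ e (hp e)) (fun e => hwU _ e (hq e)) fun g hg => ?_
  have hc := sub_smul_mem_expo_neg hK hconv hu hv huw
  obtain ⟨e, he, hsub, hcross⟩ := exists_separated_endpoints (g := g) hS hvert hu0 hdim' hc
    fun x hx hxv => hg ⟨x, hxv, hF ▸ hx⟩
  rw [hF] at hsub
  exact ⟨⟨e, he, hsub⟩, hcross _ _ (hseg ⟨e, he, hsub⟩) (hg _) (hg _)⟩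

lemma expo_ne_expo_neg (hK : IsCompact P) (hω : 0 < minWidth P) (hu : ‖u‖ = 1)
    (hx : x ∈ expo P u) : x ∉ expo P (-u) := by
  intro h
  have h1 := width_eq hx h
  have h2 := minWidth_le hK ⟨x, hx.1⟩ hu
  rw [h1, sub_self, inner_zero_right] at h2
  linarith

/-- A facet has a unique outer unit normal. -/
lemma facet_normal_unique (hK : IsCompact P) (hω : 0 < minWidth P) (hu : ‖u‖ = 1) (hu' : ‖u'‖ = 1)
    (h : expo P u = F) (h' : expo P u' = F) (hF : affDim F = 2) : u' = u := by
  obtain ⟨c, hc⟩ := exists_eq_smul_of_const (w := u') hF (ne_zero_of_norm_eq_one hu)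
    (h ▸ expo_const) (h' ▸ expo_const)
  have h1 : |c| = 1 := by
    have := congrArg norm hc
    rw [norm_smul, hu, hu'] at this
    simpa using this.symm
  rcases (abs_eq zero_le_one).1 h1 with rfl | rfl
  · simpa using hc
  · exfalso
    have hc : u' = -u := by simpa using hc
    obtain ⟨y, hy, -⟩ := exists_ne_of_affDim (by rw [hF]; norm_num : affDim F ≠ 0) 0
    refine expo_ne_expo_neg hK hω hu (h.symm ▸ hy : y ∈ expo P u) ?_
    rw [← hc, h']
    exact hy

/-- Extends the duality to a map on all sets, with junk value `∅` off the face lattice. Positive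
minimum width ensures that a nonempty face is not `P` itself. -/
lemma IsSelfDual.exists_map (hK : IsCompact P) (hω : 0 < minWidth P) (h : IsSelfDual P) :
    ∃ ψ : Set E3 → Set E3,
      (∀ G G', IsFace P G → IsFace P G' → (G ⊆ G' ↔ ψ G' ⊆ ψ G)) ∧
      ∀ G, IsFace P G → G.Nonempty → ∃ u : E3, ‖u‖ = 1 ∧ expo P u = G ∧ expo P (-u) = ψ G := by
  classical
  obtain ⟨φ, hφ⟩ := h
  refine ⟨fun G => if h : G = ∅ ∨ IsFace P G ∨ G = P then
    ((OrderDual.ofDual (φ ⟨G, h⟩) : FaceLattice P) : Set E3) else ∅, fun G G' hG hG' => ?_,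
    fun G hG hne => ?_⟩
  · have h1 : G = ∅ ∨ IsFace P G ∨ G = P := Or.inr (Or.inl hG)
    have h2 : G' = ∅ ∨ IsFace P G' ∨ G' = P := Or.inr (Or.inl hG')
    simp only [dif_pos h1, dif_pos h2]
    exact (φ.le_iff_le (x := ⟨G, h1⟩) (y := ⟨G', h2⟩)).symm
  · have h1 : G = ∅ ∨ IsFace P G ∨ G = P := Or.inr (Or.inl hG)
    simp only [dif_pos h1]
    have hGP : G ≠ P := by
      obtain ⟨u, hu0, rfl⟩ := (isFace_iff hK).1 hG
      intro heq
      obtain ⟨x, hx⟩ := hne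
      obtain ⟨y, hy⟩ := expo_nonempty hK ⟨x, hx.1⟩ (-u)
      have hyu : y ∈ expo P u := heq.symm.subset hy.1
      have h1 := minWidth_mul_norm_le hK hyu hy
      rw [sub_self, inner_zero_right] at h1
      have := mul_pos hω (norm_pos_iff.2 hu0)
      linarith
    exact ((strictlyAntipodal_iff hK).1 (hφ ⟨G, h1⟩ hne.ne_empty hGP)).2

/-- Self-dual polytopes are not reduced. -/
theorem not_isReduced_of_isSelfDual (hP : IsPolytope P) (hself : IsSelfDual P) :
    ¬ IsReduced P := by
  intro hred
  obtain ⟨S, hS, rfl, hvert⟩ := hP.exists_vertices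
  have hK := hS.isCompact_convexHull ℝ
  have hω := minWidth_pos hred.1
  obtain ⟨ψ, hψle, hψ⟩ := hself.exists_map hK hω
  have hinj : ∀ G G', IsFace (convexHull ℝ S) G → IsFace (convexHull ℝ S) G' → ψ G = ψ G' →
      G = G' := fun G G' hG hG' h =>
    Subset.antisymm ((hψle G G' hG hG').2 h.ge) ((hψle G' G hG' hG).2 h.le)
  have hface : ∀ u : E3, ‖u‖ = 1 → IsFace (convexHull ℝ S) (expo (convexHull ℝ S) u) := fun u hu =>
    (isFace_iff hK).2 ⟨u, ne_zero_of_norm_eq_one hu, rfl⟩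
  have hψface : ∀ G, IsFace (convexHull ℝ S) G → G.Nonempty → IsFace (convexHull ℝ S) (ψ G) := by
    intro G hG hne
    obtain ⟨u, hu, -, h⟩ := hψ G hG hne
    rw [← h]
    exact hface _ (by rwa [norm_neg])
  -- A facet has only one outer unit normal, so the face antipodal to it is determined.
  have hψfacet : ∀ u v : E3, ‖u‖ = 1 → expo (convexHull ℝ S) u = {v} →
      affDim (expo (convexHull ℝ S) (-u)) = 2 → ψ (expo (convexHull ℝ S) (-u)) = {v} := by
    intro u v hu huv hd
    have hu' : ‖-u‖ = 1 := by rwa [norm_neg]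
    have hvm : v ∈ expo (convexHull ℝ S) u := by rw [huv]; rfl
    obtain ⟨u', h1, h2, h3⟩ := hψ _ (hface _ hu') (expo_nonempty hK ⟨v, hvm.1⟩ _)
    rw [facet_normal_unique hK hω hu' h1 rfl h2 hd, neg_neg, huv] at h3
    exact h3.symm
  have hlt : ∀ G G', IsFace (convexHull ℝ S) G → IsFace (convexHull ℝ S) G' → G.Nonempty →
      G ⊆ G' → G ≠ G' → affDim G < affDim G' := by
    intro G G' hG hG' ⟨x, hx⟩ hsub hne
    obtain ⟨u, -, rfl⟩ := (isFace_iff hK).1 hG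
    obtain ⟨u', -, rfl⟩ := (isFace_iff hK).1 hG'
    exact affDim_lt hx hsub expo_subset fun h => hne (Subset.antisymm hsub h)
  have hle2 : ∀ G, IsFace (convexHull ℝ S) G → affDim G ≤ 2 := by
    intro G hG
    obtain ⟨u, hu, rfl⟩ := (isFace_iff hK).1 hG
    exact affDim_le_two hu expo_const
  obtain ⟨v, hv⟩ : ∃ v, IsVertex (convexHull ℝ S) v := by
    obtain ⟨x, hx⟩ := hred.1.2.2
    obtain ⟨g, hg⟩ := exists_norm_eq_one
    obtain ⟨s, hs⟩ : S.Nonempty := convexHull_nonempty_iff.1 ⟨x, interior_subset hx⟩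
    obtain ⟨u, hu⟩ := hvert s hs
    by_cases hxs : x = s
    · obtain ⟨y, hy⟩ := expo_nonempty hK ⟨x, interior_subset hx⟩ g
      refine ⟨s, isVertex_of_expo hK hu hy.1 ?_⟩
      rintro rfl
      exact notMem_expo_of_mem_interior (ne_zero_of_norm_eq_one hg) hx (hxs ▸ hy)
    · exact ⟨s, isVertex_of_expo hK hu (interior_subset hx) hxs⟩
  obtain ⟨u, hu, huv, hdim, huw⟩ := hred.exists_antipodal hS hv
  set F := expo (convexHull ℝ S) (-u) with hF
  have hFface : IsFace (convexHull ℝ S) F := hface _ (by rwa [norm_neg])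
  have hψF : ψ F = {v} := hψfacet u v hu huv hdim
  -- images of edges and vertices of the facet
  have hedge : ∀ e : FaceEdge (convexHull ℝ S) F, (e : Set E3).Nonempty := by
    rintro ⟨e, he, hsub⟩
    obtain ⟨x, y, -, -, -, rfl⟩ := he.exists_segment hS hvert
    exact ⟨x, left_mem_segment ℝ _ _⟩
  have hchain : ∀ (a : FaceVertex (convexHull ℝ S) F) (e : FaceEdge (convexHull ℝ S) F),
      (a : E3) ∈ (e : Set E3) → affDim (ψ e) = 1 ∧ affDim (ψ {(a : E3)}) = 2 := by
    intro a e hae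
    have ha : IsFace (convexHull ℝ S) {(a : E3)} := a.2.1
    have he := e.2.1.1
    have h1 : {(a : E3)} ⊆ (e : Set E3) := singleton_subset_iff.2 hae
    have h2 : ({(a : E3)} : Set E3) ≠ e := fun h => by
      have := e.2.1.2
      rw [← h, affDim_singleton] at this
      exact zero_ne_one this
    have h3 : (e : Set E3) ≠ F := fun h => by
      have := e.2.1.2
      rw [h, hdim] at this
      norm_num at this
    -- The images form a strict chain `{v} ⊂ ψ e ⊂ ψ {a}` of faces of dimension at most 2, which
    -- forces dimensions 0, 1, 2.
    have h4 := hlt _ _ (hψface _ hFface ⟨a, a.2.2⟩) (hψface _ he (hedge e))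
      (by rw [hψF]; exact singleton_nonempty v) ((hψle _ _ he hFface).1 e.2.2)
      fun h => h3 (hinj _ _ he hFface h.symm)
    have h5 : v ∈ ψ e := (hψle _ _ he hFface).1 e.2.2 (by rw [hψF]; rfl)
    have h6 := hlt _ _ (hψface _ he (hedge e)) (hψface _ ha (singleton_nonempty _)) ⟨v, h5⟩
      ((hψle _ _ ha he).1 h1) fun h => h2 (hinj _ _ ha he h.symm)
    have h7 := hle2 _ (hψface _ ha (singleton_nonempty _))
    rw [hψF, affDim_singleton] at h4
    omega
  have hedgevtx : ∀ e : FaceEdge (convexHull ℝ S) F,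
      ∃ a : FaceVertex (convexHull ℝ S) F, (a : E3) ∈ (e : Set E3) := by
    rintro ⟨e, he, hsub⟩
    obtain ⟨x, y, -, hx, -, rfl⟩ := he.exists_segment hS hvert
    exact ⟨⟨x, hx, hsub (left_mem_segment ℝ _ _)⟩, left_mem_segment ℝ _ _⟩
  have hvtxedge : ∀ a : FaceVertex (convexHull ℝ S) F,
      ∃ e : FaceEdge (convexHull ℝ S) F, (a : E3) ∈ (e : Set E3) := by
    rintro ⟨a, ha, haF⟩
    obtain ⟨e, -, -, he, -, hae, -⟩ := exists_two_edges hS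
      (neg_ne_zero.2 (ne_zero_of_norm_eq_one hu)) hdim ha haF
    exact ⟨⟨e, he⟩, hae⟩
  have hw : ∀ e : FaceEdge (convexHull ℝ S) F, ∃ w, w ≠ v ∧ ψ e = segment ℝ v w := by
    intro e
    obtain ⟨a, ha⟩ := hedgevtx e
    have h1 : IsEdge (convexHull ℝ S) (ψ e) :=
      ⟨hψface _ e.2.1.1 (hedge e), (hchain a e ha).1⟩
    have h2 : v ∈ ψ e := (hψle _ _ e.2.1.1 hFface).1 e.2.2 (by rw [hψF]; rfl)
    obtain ⟨w, hwv, -, hw⟩ := h1.exists_segment_left hS hvert hv h2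
    exact ⟨w, hwv, hw⟩
  choose w hwv hψw using hw
  have hn : ∀ e : FaceEdge (convexHull ℝ S) F, ∃ n : E3, ‖n‖ = 1 ∧
      expo (convexHull ℝ S) n = ψ e ∧ expo (convexHull ℝ S) (-n) = e := by
    intro e
    obtain ⟨n, h1, h2, h3⟩ := hψ _ e.2.1.1 (hedge e)
    exact ⟨-n, by rwa [norm_neg], h3, by rwa [neg_neg]⟩
  choose n hn hnψ hne using hn
  have hU : ∀ a : FaceVertex (convexHull ℝ S) F, ∃ U : E3, ‖U‖ = 1 ∧
      expo (convexHull ℝ S) (-U) = {(a : E3)} ∧ expo (convexHull ℝ S) U = ψ {(a : E3)} ∧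
      width (convexHull ℝ S) U = minWidth (convexHull ℝ S) := by
    intro a
    have ha : IsFace (convexHull ℝ S) {(a : E3)} := a.2.1
    obtain ⟨e, hae⟩ := hvtxedge a
    obtain ⟨t, ht, hta, htd, htw⟩ := hred.exists_antipodal hS a.2.1
    obtain ⟨t', ht', hta', htψ⟩ := hψ _ ha (singleton_nonempty _)
    have h1 := hψfacet t a ht hta htd
    have h2 := hψfacet t' a ht' hta' (by rw [htψ]; exact (hchain a e hae).2)
    -- Reducedness and duality may realize the antipodality of `a` by different normals. Both
    -- opposite facets have image `{a}`, so they are the same facet, now at distance `ω`.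
    have h3 := hinj _ _ (hface _ (by rwa [norm_neg])) (hface _ (by rwa [norm_neg]))
      (h1.trans h2.symm)
    refine ⟨-t, by rwa [norm_neg], by rwa [neg_neg], h3.trans htψ, by rwa [width_neg]⟩
  choose U hU haU hUψ hUw using hU
  refine false_of_facet_configuration hS hvert hu huv huw rfl hdim hU haU ?_ hUw ?_ hwv hn
    (fun e => (hnψ e).trans (hψw e)) (fun e => (hne e).ge) ?_
  · intro a
    rw [hUψ]
    exact (hψle _ _ a.2.1 hFface).1 (singleton_subset_iff.2 a.2.2) (by rw [hψF]; rfl)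
  · intro e e' h
    exact Subtype.ext (hinj _ _ e.2.1.1 e'.2.1.1 (by rw [hψw, hψw, h]))
  · intro a e hae
    rw [hUψ]
    refine (hψle _ _ a.2.1 e.2.1.1).1 (singleton_subset_iff.2 hae) ?_
    rw [hψw]
    exact right_mem_segment ℝ _ _

end SelfDual

/-! ### Pyramids -/

section Pyramid

variable {S P Q F : Set E3} {u v w U p x y z b : E3}

/-- Functionals on a plane with a common level line are proportional. -/
lemma exists_proportional (hu : u ≠ 0) (hQ : ∀ x ∈ Q, ∀ y ∈ Q, ⟪u, x⟫ = ⟪u, y⟫) (hx : x ∈ Q)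
    (hy : y ∈ Q) (hb : b ∈ Q) (hxy : x ≠ y) (hw : ⟪w, x⟫ = ⟪w, y⟫) (hwb : ⟪w, b⟫ ≠ ⟪w, x⟫)
    (hU : ⟪U, x⟫ = ⟪U, y⟫) :
    ∃ l : ℝ, ∀ z ∈ Q, ⟪U, z⟫ - ⟪U, x⟫ = l * (⟪w, z⟫ - ⟪w, x⟫) := by
  have hwb' := sub_ne_zero.2 hwb
  -- Chosen so that `U - l • w` agrees at `x`, `y` and `b`, which are not collinear; it is therefore
  -- constant on the plane.
  set l := (⟪U, b⟫ - ⟪U, x⟫) / (⟪w, b⟫ - ⟪w, x⟫) with hl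
  have hlb : l * (⟪w, b⟫ - ⟪w, x⟫) = ⟪U, b⟫ - ⟪U, x⟫ := div_mul_cancel₀ _ hwb'
  have hk : ∀ z, ⟪U - l • w, z⟫ = ⟪U, z⟫ - l * ⟪w, z⟫ := fun z => by
    rw [inner_sub_left, inner_smul_left, RCLike.conj_to_real]
  refine ⟨l, fun z hz => ?_⟩
  by_cases hc : ∃ c : ℝ, U - l • w = c • u
  · obtain ⟨c, hc⟩ := hc
    have h1 := hk z
    have h2 := hk x
    rw [hc, inner_smul_left] at h1 h2
    rw [hQ z hz x hx] at h1
    linarith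
  · exfalso
    push Not at hc
    set A := {z | z ∈ Q ∧ ⟪U - l • w, z⟫ = ⟪U - l • w, x⟫} with hA
    have hxA : x ∈ A := ⟨hx, rfl⟩
    have hyA : y ∈ A := ⟨hy, by rw [hk, hk, hU, hw]⟩
    have hbA : b ∈ A := ⟨hb, by rw [hk, hk]; linarith⟩
    have h1 := affDim_eq_one hu (fun a ha a' ha' => hQ a ha.1 a' ha'.1)
      (fun a ha a' ha' => ha.2.trans ha'.2.symm) hc hxA hyA hxy
    rw [affDim_eq] at h1
    obtain ⟨⟨δ, hδ⟩, -, hspan⟩ := finrank_eq_one_iff'.1 h1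
    obtain ⟨c₁, hc₁⟩ := hspan ⟨y - x, vsub_mem_vectorSpan ℝ hyA hxA⟩
    obtain ⟨c₂, hc₂⟩ := hspan ⟨b - x, vsub_mem_vectorSpan ℝ hbA hxA⟩
    have hc₁ : c₁ • δ = y - x := congrArg Subtype.val hc₁
    have hc₂ : c₂ • δ = b - x := congrArg Subtype.val hc₂
    have h2 := congrArg (fun z => ⟪w, z⟫) hc₁
    have h3 := congrArg (fun z => ⟪w, z⟫) hc₂
    simp only [inner_smul_right, inner_sub_right] at h2 h3
    rw [hw, sub_self] at h2
    rcases mul_eq_zero.1 h2 with h | h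
    · rw [h, zero_smul] at hc₁
      exact hxy (sub_eq_zero.1 hc₁.symm).symm
    · rw [h, mul_zero] at h3
      exact hwb' h3.symm

/-- Two distinct edges at a vertex meet only there. -/
lemma eq_of_mem_two_edges (hS : S.Finite) (hvert : ∀ s ∈ S, ∃ u, expo (convexHull ℝ S) u = {s})
    {e e' : Set E3} (he : IsEdge (convexHull ℝ S) e) (he' : IsEdge (convexHull ℝ S) e')
    (hne : e ≠ e') (hx : IsVertex (convexHull ℝ S) x) (hxe : x ∈ e) (hxe' : x ∈ e')
    (hz : z ∈ e) (hz' : z ∈ e') : z = x := by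
  have hK := hS.isCompact_convexHull ℝ
  obtain ⟨y, -, -, hy⟩ := he.exists_segment_left hS hvert hx hxe
  obtain ⟨y', hyx', -, hy'⟩ := he'.exists_segment_left hS hvert hx hxe'
  obtain ⟨n, -, hn⟩ := he.exists_normal hK
  obtain ⟨n', -, hn'⟩ := he'.exists_normal hK
  have hlt := inner_sub_lt_of_segment (fun h => hne (by rw [hy, hy', h])) hyx' (hn.trans hy)
    (hn'.trans hy')
  have h1 : ⟪n, z⟫ = ⟪n, x⟫ := inner_eq_of_mem_expo (hn.symm ▸ hxe) (hn.symm ▸ hz)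
  rw [hy', segment_eq_image'] at hz'
  obtain ⟨θ, -, rfl⟩ := hz'
  simp only [inner_add_right, inner_smul_right] at h1
  have h2 : θ * ⟪n, y' - x⟫ = 0 := by linarith
  rcases mul_eq_zero.1 h2 with h | h
  · simp [h]
  · exact absurd h hlt.ne

/-- Faces of a pyramid away from the apex lie in the base. -/
lemma expo_pyramid (hP : ∀ z ∈ P, ∃ q ∈ Q, z ∈ segment ℝ p q) (hp : p ∈ P) (hQP : Q ⊆ P)
    (hz : z ∈ expo P u) : ∃ q ∈ Q, z ∈ segment ℝ p q ∧ (z = p ∨ q ∈ expo P u) ∧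
      (z = q ∨ p ∈ expo P u) := by
  obtain ⟨q, hq, s, t, hs, ht, hst, rfl⟩ := hP z hz.1
  have h1 := hz.2 p hp
  have h2 := hz.2 q (hQP hq)
  refine ⟨q, hq, ⟨s, t, hs, ht, hst, rfl⟩, ?_, ?_⟩
  · rcases eq_or_lt_of_le ht with rfl | ht
    · left
      obtain rfl : s = 1 := by linarith
      simp
    · right
      refine mem_expo_of_inner_eq hz (hQP hq) (le_antisymm h2 ?_)
      rw [inner_add_right, inner_smul_right, inner_smul_right] at *
      obtain rfl : s = 1 - t := by linarith
      nlinarith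
  · rcases eq_or_lt_of_le hs with rfl | hs
    · left
      obtain rfl : t = 1 := by linarith
      simp
    · right
      refine mem_expo_of_inner_eq hz hp (le_antisymm h1 ?_)
      rw [inner_add_right, inner_smul_right, inner_smul_right] at *
      obtain rfl : t = 1 - s := by linarith
      nlinarith

lemma const_of_subset (hFQ : F ⊆ Q) (hF : affDim F = 2) (hQ : affDim Q = 2)
    (h : ∀ x ∈ F, ∀ y ∈ F, ⟪u, x⟫ = ⟪u, y⟫) : ∀ x ∈ Q, ∀ y ∈ Q, ⟪u, x⟫ = ⟪u, y⟫ := by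
  intro x hx y hy
  have heq : vectorSpan ℝ F = vectorSpan ℝ Q :=
    Submodule.eq_of_le_of_finrank_eq (vectorSpan_mono ℝ hFQ) (by
      rw [← affDim_eq, ← affDim_eq, hF, hQ])
  have h1 : x - y ∈ vectorSpan ℝ Q := vsub_mem_vectorSpan ℝ hx hy
  rw [← heq] at h1
  have := vectorSpan_le_orthogonal h h1
  rw [Submodule.mem_orthogonal_singleton_iff_inner_right, inner_sub_right] at this
  linarith

/-- Pyramids are not reduced. -/
theorem not_isReduced_of_isPyramid (hpyr : IsPyramid P) : ¬ IsReduced P := by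
  intro hred
  obtain ⟨Q, p, ⟨T, hT, rfl⟩, hQne, hQdim, hpQ, hPeq⟩ := hpyr
  set Q := convexHull ℝ T with hQ
  have hQdim : affDim Q = 2 := by omega
  have hQK : IsCompact Q := hT.isCompact_convexHull ℝ
  have hpQ' : p ∉ Q := fun h => hpQ (subset_affineSpan ℝ Q h)
  have hPpoly : IsPolytope P := ⟨insert p T, hT.insert p, by
    rw [hPeq, convexHull_insert hQne, convexHull_insert (convexHull_nonempty_iff.1 hQne), hQ,
      (convex_convexHull ℝ T).convexHull_eq]⟩
  have hPseg : ∀ z ∈ P, ∃ q ∈ Q, z ∈ segment ℝ p q := by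
    intro z hz
    rw [hPeq, convexHull_insert hQne, (convex_convexHull ℝ T).convexHull_eq,
      mem_convexJoin] at hz
    obtain ⟨a, rfl, q, hq, h⟩ := hz
    exact ⟨q, hq, h⟩
  have hpP : p ∈ P := hPeq ▸ subset_convexHull ℝ _ (mem_insert p Q)
  have hQP : Q ⊆ P := hPeq ▸ (subset_insert p Q).trans (subset_convexHull ℝ _)
  clear hPeq
  obtain ⟨S, hS, rfl, hvert⟩ := hPpoly.exists_vertices
  set P := convexHull ℝ S with hP
  have hK : IsCompact P := hS.isCompact_convexHull ℝ
  have hω := minWidth_pos hred.1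
  obtain ⟨q₀, hq₀⟩ := hQne
  have hpv : IsVertex P p := by
    obtain ⟨f, c, h1, h2⟩ := geometric_hahn_banach_closed_point (convex_convexHull ℝ T)
      hQK.isClosed hpQ'
    obtain ⟨g, rfl⟩ := (InnerProductSpace.toDual ℝ _).surjective f
    simp only [InnerProductSpace.toDual_apply_apply] at h1 h2
    have hlt : ∀ q ∈ Q, ⟪g, q⟫ < ⟪g, p⟫ := fun q hq => (h1 q hq).trans h2
    have hpg : p ∈ expo P g := by
      obtain ⟨z, hz⟩ := expo_nonempty hK ⟨p, hpP⟩ g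
      obtain ⟨q, hq, -, h3, h4⟩ := expo_pyramid hPseg hpP hQP hz
      rcases h4 with rfl | h4
      · exact absurd (hlt z hq) (not_lt.2 (hz.2 p hpP))
      · exact h4
    refine isVertex_of_expo hK (u := g) (Subset.antisymm ?_ (singleton_subset_iff.2 hpg))
      (hQP hq₀) (fun h => hpQ' (h ▸ hq₀))
    intro z hz
    obtain ⟨q, hq, -, h3, -⟩ := expo_pyramid hPseg hpP hQP hz
    rcases h3 with h3 | h3
    · exact h3
    · exact absurd (hlt q hq) (not_lt.2 (h3.2 p hpP))
  obtain ⟨u, hu, hup, hFdim, huw⟩ := hred.exists_antipodal hS hpv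
  have hu0 : -u ≠ 0 := neg_ne_zero.2 (ne_zero_of_norm_eq_one hu)
  have hpu : p ∈ expo P u := by rw [hup]; rfl
  have hsubQ : ∀ t : E3, p ∉ expo P t → expo P t ⊆ Q := by
    intro t hpt z hz
    obtain ⟨q, hq, -, -, h4⟩ := expo_pyramid hPseg hpP hQP hz
    rcases h4 with rfl | h4
    · exact hq
    · exact absurd h4 hpt
  -- A facet missing the apex lies in the base and, having the same dimension, is the base.
  have hconst : ∀ t : E3, p ∉ expo P t → affDim (expo P t) = 2 → expo P t = Q := by
    intro t hpt hdim
    have hsub := hsubQ t hpt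
    refine Subset.antisymm hsub fun z hz => ?_
    have h1 := const_of_subset hsub hdim hQdim expo_const
    obtain ⟨y, hy⟩ := expo_nonempty hK ⟨p, hpP⟩ t
    exact mem_expo_of_inner_eq hy (hQP hz) (h1 z hz y (hsub hy))
  have hF : expo P (-u) = Q := hconst _ (expo_ne_expo_neg hK hω hu hpu) hFdim
  have hQu : ∀ x ∈ Q, ∀ y ∈ Q, ⟪-u, x⟫ = ⟪-u, y⟫ := hF ▸ expo_const
  -- the facets antipodal to the vertices of the base
  have hUex : ∀ a : FaceVertex P Q, ∃ U : E3, ‖U‖ = 1 ∧ expo P (-U) = {(a : E3)} ∧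
      affDim (expo P U) = 2 ∧ width P U = minWidth P := by
    intro a
    obtain ⟨t, h1, h2, h3, h4⟩ := hred.exists_antipodal hS a.2.1
    exact ⟨-t, by rwa [norm_neg], by rwa [neg_neg], h3, by rwa [width_neg]⟩
  choose U hU haU hUdim hUw using hUex
  have haUm : ∀ a : FaceVertex P Q, (a : E3) ∈ expo P (-(U a)) := fun a => by rw [haU a]; rfl
  have haUn : ∀ a : FaceVertex P Q, (a : E3) ∉ expo P (U a) := fun a h =>
    expo_ne_expo_neg hK hω (hU a) h (haUm a)
  have hUlt : ∀ (a : FaceVertex P Q) (z : E3), z ∈ P → z ≠ a → ⟪U a, (a : E3)⟫ < ⟪U a, z⟫ := by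
    intro a z hz hza
    have := inner_lt_of_notMem_expo (haUm a) hz (by rw [haU a]; exact hza)
    rwa [inner_neg_left, inner_neg_left, neg_lt_neg_iff] at this
  have hpU : ∀ a, p ∈ expo P (U a) := by
    intro a
    by_contra h
    have := hconst _ h (hUdim a)
    exact haUn a (this.symm.subset a.2.2)
  have hEeq : ∀ a, expo Q (U a) = expo P (U a) ∩ Q := by
    intro a
    obtain ⟨z, hz, hzp⟩ := exists_ne_of_affDim (by rw [hUdim a]; norm_num :
      affDim (expo P (U a)) ≠ 0) p
    obtain ⟨q, hq, -, h3, -⟩ := expo_pyramid hPseg hpP hQP hz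
    have hqU := h3.resolve_left hzp
    have hqQ : q ∈ expo Q (U a) := ⟨hq, fun y hy => hqU.2 y (hQP hy)⟩
    ext y
    constructor
    · intro hy
      exact ⟨mem_expo_of_inner_eq hqU (hQP hy.1) (inner_eq_of_mem_expo hqQ hy), hy.1⟩
    · rintro ⟨hy, hyQ⟩
      exact ⟨hyQ, fun y' hy' => hy.2 y' (hQP hy')⟩
  have hUnot : ∀ a, ∀ c : ℝ, U a ≠ c • (-u) := by
    intro a c hc
    have hcQ : ∀ x ∈ Q, ∀ y ∈ Q, ⟪U a, x⟫ = ⟪U a, y⟫ := by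
      intro x hx y hy
      rw [hc, inner_smul_left, inner_smul_left, hQu x hx y hy]
    have : (a : E3) ∈ expo Q (U a) := ⟨a.2.2, fun y hy => (hcQ y hy _ a.2.2).le⟩
    rw [hEeq a] at this
    exact haUn a this.1
  -- The facet antipodal to a base vertex contains the apex. If it met the base in one point only,
  -- it would lie on a line through the apex.
  have hEedge : ∀ a, IsEdge P (expo Q (U a)) := by
    intro a
    have htwo : ∃ x₁ ∈ expo Q (U a), ∃ x₂ ∈ expo Q (U a), x₁ ≠ x₂ := by
      by_contra! hcon
      obtain ⟨x₁, hx₁⟩ := expo_nonempty hQK ⟨q₀, hq₀⟩ (U a)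
      obtain ⟨h, h0, hhU, hhx⟩ := exists_orthogonal_pair (U a) (x₁ - p)
      have hline : ∀ z ∈ expo P (U a), ⟪h, z⟫ = ⟪h, p⟫ := by
        intro z hz
        obtain ⟨q, hq, hzq, h3, -⟩ := expo_pyramid hPseg hpP hQP hz
        rcases h3 with rfl | h3
        · rfl
        · have hqE : q ∈ expo Q (U a) := by rw [hEeq]; exact ⟨h3, hq⟩
          rw [hcon q hqE x₁ hx₁, segment_eq_image'] at hzq
          obtain ⟨θ, -, rfl⟩ := hzq
          simp only [inner_add_right, inner_smul_right, hhx, mul_zero, add_zero]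
      obtain ⟨c, hc⟩ := exists_eq_smul_of_const (hUdim a) (ne_zero_of_norm_eq_one (hU a))
        expo_const fun x hx y hy => (hline x hx).trans (hline y hy).symm
      have := congrArg (fun z => ⟪h, z⟫) hc
      simp only [inner_smul_right, hhU, mul_zero] at this
      exact h0 (inner_self_eq_zero.1 this)
    obtain ⟨x₁, hx₁, x₂, hx₂, hx⟩ := htwo
    rw [← hF] at hx₁ hx₂ ⊢
    exact isEdge_expo_expo hS hu0 (hUnot a) hx₁ hx₂ hx
  set E : FaceVertex P Q → FaceEdge P Q := fun a => ⟨expo Q (U a), hEedge a, expo_subset⟩ with hE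
  have hEinj : Function.Injective E := by
    have hle : ∀ a b, E a = E b → expo P (U a) ⊆ expo P (U b) := by
      intro a b h z hz
      have h : expo Q (U a) = expo Q (U b) := congrArg Subtype.val h
      obtain ⟨q, hq, hzq, h3, -⟩ := expo_pyramid hPseg hpP hQP hz
      rcases h3 with rfl | h3
      · exact hpU b
      · have hqE : q ∈ expo Q (U a) := by rw [hEeq]; exact ⟨h3, hq⟩
        rw [h, hEeq] at hqE
        rw [expo_convexHull] at hqE ⊢
        have hpb := hpU b
        rw [expo_convexHull] at hpb
        exact (convex_convexHull ℝ _).segment_subset hpb hqE.1 hzq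
    intro a b h
    have heq := Subset.antisymm (hle a b h) (hle b a h.symm)
    have hUU := facet_normal_unique hK hω (hU b) (hU a) rfl heq (hUdim b)
    have := haU a
    rw [hUU, haU b] at this
    exact Subtype.ext (singleton_injective this).symm
  have := finite_faceVertex hS Q
  have := finite_faceEdge hS hvert Q
  have := Fintype.ofFinite (FaceVertex P Q)
  have := Fintype.ofFinite (FaceEdge P Q)
  obtain ⟨i, j, e₁, e₂, hij, -, hinc, hseg, -⟩ := exists_incidence hS hvert hu0 hFdim hF
  have hcard : Fintype.card (FaceVertex P Q) = Fintype.card (FaceEdge P Q) := by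
    have := hinc fun _ _ => 1
    simp only [Finset.sum_const, Finset.card_univ, nsmul_eq_mul] at this
    have : (Fintype.card (FaceVertex P Q) : ℝ) = Fintype.card (FaceEdge P Q) := by linarith
    exact_mod_cast this
  have hEbij : Function.Bijective E := (Fintype.bijective_iff_injective_and_card E).2 ⟨hEinj, hcard⟩
  choose α hα using hEbij.2
  have hαe : ∀ e : FaceEdge P Q, expo Q (U (α e)) = e := fun e => congrArg Subtype.val (hα e)
  have hαinj : Function.Injective α := fun e e' h => by rw [← hα e, ← hα e', h]
  -- Reciprocity: if `a` lies on the base edge opposite to `x`, then `x` lies on the one opposite to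
  -- `a`. This supplies the matching of edges that the configuration needs.
  have hαmem : ∀ (a : FaceVertex P Q) (e : FaceEdge P Q), (a : E3) ∈ (e : Set E3) →
      (α e : E3) ∈ expo Q (U a) := by
    intro a e hae
    by_contra hcon
    set x := α e with hx
    have haE : (a : E3) ∈ expo Q (U x) := (hαe e).symm ▸ hae
    have hxS : (x : E3) ∈ S ∩ expo P (-u) := ⟨x.2.1.mem hS, hF.symm ▸ x.2.2⟩
    have hfin : (S ∩ expo P (-u)).Finite := hS.subset inter_subset_left
    -- Interpolates between a functional assumed not to be maximal at `x` and one maximal on `Q`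
    -- only at `x`. A tie gives a base edge through `x`, while `a` stays the strict minimizer on `Q`
    -- for `t < 1`.
    set W : ℝ → E3 := fun t => (1 - t) • U a + t • (-(U x)) with hW
    have hWv : ∀ t z, ⟪W t, z⟫ = (1 - t) * ⟪U a, z⟫ - t * ⟪U x, z⟫ := fun t z => by
      simp only [hW, inner_add_left, inner_smul_left, inner_neg_left, RCLike.conj_to_real]
      ring
    obtain ⟨t, ht, ⟨y, hy, hyx, hymax⟩, x', hx', hxx', hxmax⟩ := exists_tie hfin ⟨_, hxS⟩ (u := W)
      (by fun_prop) (fun s => s ≠ x) (fun s => s = x) (fun s _ => ne_or_eq s _) (by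
        obtain ⟨y, hy, hmax⟩ := exists_max_image _ (fun z => ⟪U a, z⟫) hfin ⟨_, hxS⟩
        refine ⟨y, hy, ?_, fun s hs => by simpa [hWv] using hmax s hs⟩
        rintro rfl
        apply hcon
        exact (congrArg (expo · (U a)) hF).subset (mem_expo_face_iff.2 ⟨hxS.2, hmax⟩)) (by
        refine ⟨x, hxS, rfl, fun s hs => ?_⟩
        have := (haUm x).2 s hs.2.1
        rw [inner_neg_left, inner_neg_left] at this
        simpa [hWv] using this)
    rw [hxx'] at hxmax
    have hxW : (x : E3) ∈ expo (expo P (-u)) (W t) := mem_expo_face_iff.2 ⟨hxS.2, hxmax⟩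
    have hyW : y ∈ expo (expo P (-u)) (W t) := mem_expo_face_iff.2 ⟨hy.2, hymax⟩
    have hxy := inner_eq_of_mem_expo hxW hyW
    have ht1 : t < 1 := by
      refine lt_of_le_of_ne ht.2 ?_
      rintro rfl
      rw [hWv, hWv] at hxy
      have := hUlt x y hy.2.1 hyx
      linarith
    have haW : ∀ z ∈ Q, z ≠ a → ⟪W t, (a : E3)⟫ < ⟪W t, z⟫ := by
      intro z hz hza
      rw [hWv, hWv]
      have h1 := hUlt a z (hQP hz) hza
      have h2 := haE.2 z hz
      nlinarith [ht.1, mul_pos (sub_pos.2 ht1) (sub_pos.2 h1), mul_nonneg ht.1 (sub_nonneg.2 h2)]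
    have hxa : (x : E3) ≠ a := by
      intro h
      rw [← h, hEeq] at haE
      exact haUn x haE.1
    have hWnot : ∀ c : ℝ, W t ≠ c • (-u) := by
      intro c hc
      have := haW x x.2.2 hxa
      rw [hc, inner_smul_left, inner_smul_left, hQu _ x.2.2 _ a.2.2] at this
      exact lt_irrefl _ this
    have hedge := isEdge_expo_expo hS hu0 hWnot hxW hyW (Ne.symm hyx)
    obtain ⟨c, hc⟩ := hEbij.2 ⟨_, hedge, hF ▸ expo_subset⟩
    have hc : expo Q (U c) = expo (expo P (-u)) (W t) := congrArg Subtype.val hc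
    have hxc : (x : E3) ∈ expo Q (U c) := hc ▸ hxW
    have hyc : y ∈ expo Q (U c) := hc ▸ hyW
    -- The tie edge is opposite to some `c`, and `U c` is a nonnegative multiple of `W t` on the
    -- base up to a constant. Comparing the unique minimizers gives `c = a`.
    obtain ⟨l, hl⟩ := exists_proportional (U := U c) hu0 hQu x.2.2 hyc.1 a.2.2 (Ne.symm hyx)
      hxy.symm (haW x x.2.2 hxa).ne (inner_eq_of_mem_expo hyc hxc)
    have hca : c = a := by
      by_contra hne
      have h1 := hl a a.2.2
      have h2 := hl c c.2.2
      have h3 := hUlt c a (hQP a.2.2) fun h => hne (Subtype.ext h.symm)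
      have h4 := haW c c.2.2 fun h => hne (Subtype.ext h)
      have h5 := haW x x.2.2 hxa
      have h6 := hxc.2 a a.2.2
      have h7 : 0 ≤ l := by
        by_contra h
        nlinarith [mul_pos_of_neg_of_neg (not_le.1 h) (sub_neg.2 h5)]
      nlinarith [mul_nonneg h7 (sub_pos.2 h4).le]
    rw [hca] at hxc
    exact hcon hxc
  have hnex : ∀ e : FaceEdge P Q, ∃ n : E3, ‖n‖ = 1 ∧ expo P n = segment ℝ p (α e : E3) ∧
      (e : Set E3) ⊆ expo P (-n) := by
    intro e
    set x := α e with hx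
    have hie : (i e : E3) ∈ (e : Set E3) := by rw [hseg e]; exact left_mem_segment ℝ _ _
    have hje : (j e : E3) ∈ (e : Set E3) := by rw [hseg e]; exact right_mem_segment ℝ _ _
    have hxi := hαmem _ _ hie
    have hxj := hαmem _ _ hje
    have hiE : (i e : E3) ∈ expo Q (U x) := (hαe e).symm ▸ hie
    have hjE : (j e : E3) ∈ expo Q (U x) := (hαe e).symm ▸ hje
    have hijv : (i e : E3) ≠ j e := fun h => hij e (Subtype.ext h)
    set l := ⟪U (j e), (i e : E3) - j e⟫ with hl
    set m := ⟪U (i e), (j e : E3) - i e⟫ with hm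
    have hl0 : 0 < l := by
      rw [hl, inner_sub_right, sub_pos]
      exact hUlt _ _ (hQP (i e).2.2) hijv
    have hm0 : 0 < m := by
      rw [hm, inner_sub_right, sub_pos]
      exact hUlt _ _ (hQP (j e).2.2) hijv.symm
    -- The weights make `n` equal at both endpoints of `e`. Being positive, they make `n` expose the
    -- intersection of the two facets, which is the edge from `p` to `x`.
    set n := l • U (i e) + m • U (j e) with hn
    have hnv : ∀ z, ⟪n, z⟫ = l * ⟪U (i e), z⟫ + m * ⟪U (j e), z⟫ := fun z => by
      simp only [hn, inner_add_left, inner_smul_left, RCLike.conj_to_real]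
    have hnn : expo P n = expo P (U (i e)) ∩ expo P (U (j e)) := by
      have hpi := hpU (i e)
      have hpj := hpU (j e)
      have hpn : p ∈ expo P n := ⟨hpP, fun y hy => by
        rw [hnv, hnv]
        have := mul_le_mul_of_nonneg_left (hpi.2 y hy) hl0.le
        have := mul_le_mul_of_nonneg_left (hpj.2 y hy) hm0.le
        linarith⟩
      ext z
      constructor
      · intro hz
        have h1 := inner_eq_of_mem_expo hpn hz
        rw [hnv, hnv] at h1
        have h2 := hpi.2 z hz.1
        have h3 := hpj.2 z hz.1
        exact ⟨mem_expo_of_inner_eq hpi hz.1 (by nlinarith),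
          mem_expo_of_inner_eq hpj hz.1 (by nlinarith)⟩
      · rintro ⟨h1, h2⟩
        refine mem_expo_of_inner_eq hpn h1.1 ?_
        rw [hnv, hnv, inner_eq_of_mem_expo hpi h1, inner_eq_of_mem_expo hpj h2]
    have hnseg : expo P n = segment ℝ p (x : E3) := by
      apply Subset.antisymm
      · intro z hz
        obtain ⟨q, hq, hzq, h3, -⟩ := expo_pyramid hPseg hpP hQP hz
        rcases h3 with rfl | h3
        · exact left_mem_segment ℝ _ _
        · rw [hnn] at h3
          have hne : (expo Q (U (i e))) ≠ expo Q (U (j e)) := fun h =>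
            hij e (hEinj (Subtype.ext h))
          have : q = x := eq_of_mem_two_edges hS hvert (hEedge _) (hEedge _) hne x.2.1 hxi hxj
            (by rw [hEeq]; exact ⟨h3.1, hq⟩) (by rw [hEeq]; exact ⟨h3.2, hq⟩)
          rwa [this] at hzq
      · have hpn : p ∈ expo P n := by rw [hnn]; exact ⟨hpU _, hpU _⟩
        have hxn : (x : E3) ∈ expo P n := by
          rw [hEeq] at hxi hxj
          rw [hnn]
          exact ⟨hxi.1, hxj.1⟩
        rw [expo_convexHull] at hpn hxn ⊢
        exact (convex_convexHull ℝ _).segment_subset hpn hxn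
    have hxn : (x : E3) ∈ expo P n := hnseg ▸ right_mem_segment ℝ _ _
    have hpn : p ∈ expo P n := hnseg ▸ left_mem_segment ℝ _ _
    have hn0 : n ≠ 0 := by
      intro h
      have h1 : (i e : E3) ∈ expo P n :=
        mem_expo_of_inner_eq hpn (hQP (i e).2.2) (by rw [h, inner_zero_left, inner_zero_left])
      rw [hnn] at h1
      exact haUn _ h1.1
    have hxlt : ⟪U x, (x : E3)⟫ < ⟪U x, (i e : E3)⟫ := by
      refine hUlt x _ (hQP (i e).2.2) ?_
      intro h
      rw [h, hEeq] at hiE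
      exact haUn x hiE.1
    -- On the base `n` is, up to a constant, a multiple of `U x`, since both are constant along `e`.
    -- The factor is nonpositive because `n` is maximal at `x`, where `U x` is least; hence `n`
    -- attains its minimum along `e`.
    obtain ⟨k, hk⟩ := exists_proportional (U := n) hu0 hQu (i e).2.2 (j e).2.2 x.2.2 hijv
      (inner_eq_of_mem_expo hjE hiE) hxlt.ne (by
        rw [hnv, hnv, hl, hm, inner_sub_right, inner_sub_right]; ring)
    have hk0 : k ≤ 0 := by
      have h1 := hk x x.2.2
      have h2 := hxn.2 _ (hQP (i e).2.2)
      by_contra h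
      nlinarith [mul_pos (not_le.1 h) (sub_pos.2 hxlt)]
    have hmin : ∀ z ∈ P, ⟪n, (i e : E3)⟫ ≤ ⟪n, z⟫ := by
      intro z hz
      obtain ⟨q, hq, s, t, hs, ht, hst, rfl⟩ := hPseg z hz
      have h1 := hk q hq
      have h2 := hiE.2 q hq
      have h3 : ⟪n, (i e : E3)⟫ ≤ ⟪n, q⟫ := by nlinarith
      have h4 := hpn.2 _ (hQP (i e).2.2)
      rw [inner_add_right, inner_smul_right, inner_smul_right]
      obtain rfl : s = 1 - t := by linarith
      nlinarith [mul_nonneg hs (sub_nonneg.2 h4), mul_nonneg ht (sub_nonneg.2 h3)]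
    have hpos : 0 < ‖n‖⁻¹ := inv_pos.2 (norm_pos_iff.2 hn0)
    refine ⟨‖n‖⁻¹ • n, norm_smul_inv_norm hn0, by rw [expo_smul hpos, hnseg], fun z hz => ?_⟩
    rw [← smul_neg, expo_smul hpos]
    have hzE : z ∈ expo Q (U x) := (hαe e).symm ▸ hz
    have h1 := hk z hzE.1
    rw [inner_eq_of_mem_expo hiE hzE, sub_self, mul_zero, sub_eq_zero] at h1
    refine mem_expo_neg.2 ⟨hQP hzE.1, fun y hy => ?_⟩
    rw [h1]
    exact hmin y hy
  choose n hn hnw hne using hnex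
  refine false_of_facet_configuration hS hvert hu hup huw hF hQdim hU haU hpU hUw
    (w := fun e => (α e : E3)) (Subtype.val_injective.comp hαinj)
    (fun e h => hpQ' (h ▸ (α e).2.2)) hn hnw hne fun a e hae => ?_
  have := hαmem a e hae
  rw [hEeq] at this
  exact this.1

end Pyramid

end RedPoly

end

theorem mainTheorem3 :
    -- the three antipodality conditions cannot hold together; indices are cyclic modulo `k`
    (∀ (P : Set (EuclideanSpace ℝ (Fin 3))), RedPoly.IsPolytope P → RedPoly.IsReduced P →
      ∀ (k : ℕ), 0 < k →
      -- `F` is a facet, `a j` are its distinct vertices, its edges are the `a (j-1) a j`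
      ∀ (F : Set (EuclideanSpace ℝ (Fin 3))) (a : ZMod k → EuclideanSpace ℝ (Fin 3)),
      RedPoly.IsFacet P F → Function.Injective a →
      {e | RedPoly.IsEdge P e ∧ e ⊆ F} =
        Set.range (fun j : ZMod k => segment ℝ (a (j - 1)) (a j)) →
      -- `v` is a vertex and the edges incident to `v` are the `v (w j)`
      ∀ (v : EuclideanSpace ℝ (Fin 3)) (w : ZMod k → EuclideanSpace ℝ (Fin 3)),
      RedPoly.IsVertex P v → Function.Injective w →
      {e | RedPoly.IsEdge P e ∧ v ∈ e} = Set.range (fun j : ZMod k => segment ℝ v (w j)) →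
      -- cyclically consecutive edges at `v` bound the facet `G j`
      ∀ (G : ZMod k → Set (EuclideanSpace ℝ (Fin 3))),
      (∀ j : ZMod k, RedPoly.IsFacet P (G j) ∧
        segment ℝ v (w j) ⊆ G j ∧ segment ℝ v (w (j + 1)) ⊆ G j) →
      ¬ ((RedPoly.StrictlyAntipodal P F {v} ∧
            RedPoly.affDist {v} F = RedPoly.minWidth P) ∧
          (∀ j : ZMod k,
            RedPoly.StrictlyAntipodal P (segment ℝ v (w j)) (segment ℝ (a (j - 1)) (a j))) ∧
          (∀ j : ZMod k, RedPoly.StrictlyAntipodal P (G j) {a j} ∧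
            RedPoly.affDist {a j} (G j) = RedPoly.minWidth P))) ∧
    -- self-dual polytopes are not reduced
    (∀ (P : Set (EuclideanSpace ℝ (Fin 3))), RedPoly.IsPolytope P → RedPoly.IsSelfDual P →
      ¬ RedPoly.IsReduced P) ∧
    -- pyramids are not reduced
    (∀ (P : Set (EuclideanSpace ℝ (Fin 3))), RedPoly.IsPyramid P → ¬ RedPoly.IsReduced P) := by
  refine ⟨?_, fun P hP hself => RedPoly.not_isReduced_of_isSelfDual hP hself,
    fun P hP => RedPoly.not_isReduced_of_isPyramid hP⟩
  intro P hP _ k hk F a hF ha hedges v w _ hw hvedges G hG h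
  exact RedPoly.not_antipodal_cyclic hP k hk F a hF ha hedges v w hw hvedges G hG h.1.1 h.1.2
    h.2.1 h.2.2
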